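/- Let $k$ be an algebraically closed field of characteristic $p>0$, let $K=k(t)$, let $q=p^r$ be a power of $p$, and let $m\ge 2$ be an integer with $p\nmid m$. Let $G$ be the regular projective model of the affine curve $\{u^q=x^m+t\}\subset\mathbb A^2_{x,u}$ over $K$, let $G^n$ be its $n$-fold fibre product over $\operatorname{Spec}K$, with coordinate functions $x_i,u_i$ ($u_i^q=x_i^m+t$), and put $y_i=1/x_i$. Embed the function field $K(\mathbb P^n_K)=K(y_1,\dots,y_n)$ in $K(G^n)$, where $y_i=Y_i/Y_0$ for homogeneous coordinates $Y_0,\dots,Y_n$ on $\mathbb P^n_K$, and let $Y(n,m,q)$ be the normalisation of $\mathbb P^n_K$ in $K(G^n)$. If $n\ge m(q-1)$, then $Y=Y(n,m,q)$ is a Fano variety with canonical singularities; that is, $Y$ is a normal, integral, proper scheme over $K$, its canonical divisor $K_Y$ is $\mathbb Q$-Cartier, $-K_Y$ is ample, and every exceptional prime divisor $E$ over $Y$ has discrepancy $a(E,Y)\ge 0$. -/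

import Mathlib

open AlgebraicGeometry CategoryTheory

universe u

noncomputable section

/-! ### The variety `Y(n, m, q)` over `K = k(t)` -/

namespace FanoCover

variable (k : Type u) [Field k]

/-- The ideal of `K[x₁, …, xₙ, u₁, …, uₙ]`, `K = k(t)`, generated by the polynomials
`uᵢ ^ q - (xᵢ ^ m + t)`. The variable `xᵢ` is `X (Sum.inl i)` and `uᵢ` is `X (Sum.inr i)`. -/
def curvePowerIdeal (n m q : ℕ) : Ideal (MvPolynomial (Fin n ⊕ Fin n) (RatFunc k)) :=
  Ideal.span (Set.range fun i : Fin n =>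
    (MvPolynomial.X (Sum.inr i) ^ q -
      (MvPolynomial.X (Sum.inl i) ^ m + MvPolynomial.C RatFunc.X) :
        MvPolynomial (Fin n ⊕ Fin n) (RatFunc k)))

/-- The coordinate ring of the `n`-th fibre power over `K = k(t)` of the affine plane curve
`G_x = {u ^ q = x ^ m + t}`. This fibre power is a dense affine open subscheme of `Gⁿ`, where `G`
is the regular projective model of `G_x`. -/
abbrev CurvePowerRing (n m q : ℕ) : Type u :=
  MvPolynomial (Fin n ⊕ Fin n) (RatFunc k) ⧸ curvePowerIdeal k n m q

/-- The function field `K(Gⁿ)`: the fraction field of the coordinate ring of the dense open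
subscheme `(G_x)ⁿ` of `Gⁿ`. -/
abbrev CurvePowerField (n m q : ℕ) : Type u := FractionRing (CurvePowerRing k n m q)

/-- The rational function `xᵢ` on `Gⁿ`. -/
def xCoord (n m q : ℕ) (i : Fin n) : CurvePowerField k n m q :=
  algebraMap (CurvePowerRing k n m q) _
    (Ideal.Quotient.mk (curvePowerIdeal k n m q) (MvPolynomial.X (Sum.inl i)))

/-- The rational function `yᵢ = 1 / xᵢ` on `Gⁿ`. -/
def yCoord (n m q : ℕ) (i : Fin n) : CurvePowerField k n m q :=
  Ring.inverse (xCoord k n m q i)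

/-- The standard grading of `K[Y₀, …, Yₙ]`. -/
abbrev grading (K : Type u) [Field K] (n : ℕ) :
    ℕ → Submodule K (MvPolynomial (Fin (n + 1)) K) :=
  MvPolynomial.homogeneousSubmodule (Fin (n + 1)) K

instance gradingGradedAlgebra (K : Type u) [Field K] (n : ℕ) : GradedAlgebra (grading K n) :=
  MvPolynomial.gradedAlgebra

/-- Projective space `ℙⁿ` over `K`, with homogeneous coordinates `Y₀, …, Yₙ`. -/
abbrev projSpace (K : Type u) [Field K] (n : ℕ) : Scheme.{u} := Proj (grading K n)

/-- The structure morphism of `ℙⁿ` over `K`. -/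
def projSpaceToSpec (K : Type u) [Field K] (n : ℕ) :
    projSpace K n ⟶ Spec (CommRingCat.of K) :=
  Proj.toSpecZero (grading K n) ≫
    Spec.map (CommRingCat.ofHom (algebraMap K (grading K n 0)))

/-- The homomorphism from the coordinate ring of the chart `{Y₀ ≠ 0}` of `ℙⁿ` to `K(Gⁿ)`
that sends `Yᵢ / Y₀` to `yᵢ` for `i = 1, …, n`. -/
def chartHom (n m q : ℕ) :
    HomogeneousLocalization.Away (grading (RatFunc k) n) (MvPolynomial.X 0) →+*
      CurvePowerField k n m q :=
  (Localization.awayLift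
    (MvPolynomial.eval₂Hom (algebraMap (RatFunc k) (CurvePowerField k n m q))
      (Fin.cons 1 (yCoord k n m q)))
    (MvPolynomial.X 0 : MvPolynomial (Fin (n + 1)) (RatFunc k))
    (by simp)).comp
  (algebraMap (HomogeneousLocalization.Away (grading (RatFunc k) n) (MvPolynomial.X 0))
    (Localization.Away (MvPolynomial.X 0 : MvPolynomial (Fin (n + 1)) (RatFunc k))))

/-- The `K(Gⁿ)`-valued point `[1 : y₁ : ⋯ : yₙ]` of `ℙⁿ` over `K = k(t)`. -/
def genericPt (n m q : ℕ) :
    Spec (CommRingCat.of (CurvePowerField k n m q)) ⟶ projSpace (RatFunc k) n :=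
  Spec.map (CommRingCat.ofHom (chartHom k n m q)) ≫
    Proj.awayι (grading (RatFunc k) n) (MvPolynomial.X 0)
      (MvPolynomial.isHomogeneous_X (RatFunc k) (0 : Fin (n + 1))) Nat.one_pos

/-- `Y(n, m, q)`: the normalisation of `ℙⁿ` over `K = k(t)` in `K(Gⁿ)`. -/
def Y (n m q : ℕ) : Scheme.{u} := (genericPt k n m q).normalization

/-- The structure morphism of `Y(n, m, q)` over `K = k(t)`. -/
def YToSpec (n m q : ℕ) : Y k n m q ⟶ Spec (CommRingCat.of (RatFunc k)) :=
  (genericPt k n m q).fromNormalization ≫ projSpaceToSpec (RatFunc k) n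

end FanoCover

/-! ### Canonical forms

Let `K` be a finitely generated field extension of a perfect field `k`. A regular ring that is
essentially of finite type over `K` is then essentially smooth over `k` (although it need not be
smooth over `K`), so its canonical module over `k` is the top exterior power of its module of
Kähler differentials over `k`; and `ω_{X/k} = ω_{X/K} ⊗ ω_{K/k}` with `ω_{K/k}` a one-dimensional
`K`-vector space (spanned by `dt` if `K = k(t)`). So for a normal variety `X` over `K`, a canonical
divisor is the divisor of a nonzero rational section of `ω_{X/k}`. -/

section Forms

variable (k : Type u) [Field k] (F : Type u) [Field F] [Algebra k F]

/-- Rational canonical forms: the top exterior power of `Ω_{F/k}`. -/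
abbrev RatForm : Type u := ⋀[F]^(Cardinal.toNat (Algebra.trdeg k F)) (Ω[F⁄k])

variable (R : Type u) [CommRing R] [Algebra R F]

/-- The rational forms that are regular on a ring `R` with fraction field `F`: the `R`-module
generated by all `da₁ ∧ ⋯ ∧ da_d` with `aᵢ ∈ R`, that is, the image of `⋀ᵈ Ω_{R/k}`. -/
def regularForms : AddSubgroup (RatForm k F) :=
  AddSubgroup.closure
    {ω | ∃ (r : R) (a : Fin (Cardinal.toNat (Algebra.trdeg k F)) → R),
      ω = algebraMap R F r • exteriorPower.ιMulti F (Cardinal.toNat (Algebra.trdeg k F))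
        (fun i => KaehlerDifferential.D k F (algebraMap R F (a i)))}

variable {F}

/-- `η = f · ω₀`, where `ω₀` is a generator of the module of regular forms on `R`. In other words
`f` is a local equation on `Spec R` of the divisor of `η`. -/
def IsFormEquation (η : RatForm k F) (f : F) : Prop :=
  f ≠ 0 ∧ ∃ ω₀ : RatForm k F, η = f • ω₀ ∧
    ∀ ω : RatForm k F, ω ∈ regularForms k F R ↔ ∃ r : R, ω = algebraMap R F r • ω₀

end Forms

/-! ### Divisors on a normal variety

A Weil divisor is given by its coefficients `D x` at the points `x` of codimension one
(`Order.coheight x = 1`); the values of `D` at other points are never used. -/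

section Divisors

variable (X : Scheme.{u}) [IsIntegral X] [IsLocallyNoetherian X]

/-- `g` is an equation of the divisor `D` on the open set `U`. -/
def IsEquationOn (D : X → ℤ) (U : X.Opens) (g : X.functionField) : Prop :=
  g ≠ 0 ∧ ∀ P ∈ U, Order.coheight P = 1 → D P = X.ord g P

/-- `D` is a Cartier divisor: it is locally principal. -/
def IsCartierDivisor (D : X → ℤ) : Prop :=
  ∀ x : X, ∃ (U : X.Opens) (g : X.functionField), x ∈ U ∧ IsEquationOn X D U g

/-- A Cartier divisor `D` (on a quasi-compact normal scheme) is ample if the open sets `X_s`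
that are affine, for sections `s` of `𝒪(N D)` with `N ≥ 1`, cover `X`. Here a nonzero section of
`𝒪(N D)` is a rational function `g ≠ 0` with `div g + N D ≥ 0`, and `X_s` is the complement of the
support of `div g + N D`. -/
def IsAmpleDivisor (D : X → ℤ) : Prop :=
  IsCartierDivisor X D ∧
    ∀ x : X, ∃ (N : ℕ) (g : X.functionField) (U : X.Opens), 0 < N ∧ g ≠ 0 ∧
      (∀ P : X, Order.coheight P = 1 → 0 ≤ X.ord g P + N * D P) ∧
      (∀ y : X, y ∈ U ↔
        ∀ P : X, Order.coheight P = 1 → P ⤳ y → X.ord g P + N * D P = 0) ∧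
      IsAffineOpen U ∧ x ∈ U

/-- A divisor is `ℚ`-Cartier and ample if some positive multiple is Cartier and ample. -/
def IsQAmpleDivisor (D : X → ℤ) : Prop :=
  ∃ r : ℕ, 0 < r ∧ IsAmpleDivisor X (fun P => r * D P)

variable (k : Type u) [Field k] [Algebra k X.functionField]

/-- `D` is the canonical divisor `div η` of the rational canonical form `η ≠ 0`. -/
def IsCanonicalDivisor (η : RatForm k X.functionField) (D : X → ℤ) : Prop :=
  η ≠ 0 ∧ ∀ P : X, Order.coheight P = 1 →
    ∃ f : X.functionField, IsFormEquation k (X.presheaf.stalk P) η f ∧ D P = X.ord f P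

/-- The ring `R` (a discrete valuation ring) dominates the local ring of `X` at `x` inside the
function field: the centre of the valuation on `X` is `x`. -/
def HasCentre (R : Type u) [CommRing R] [Algebra R X.functionField] (x : X) : Prop :=
  ∃ φ : X.presheaf.stalk x →+* R, IsLocalHom φ ∧
    (algebraMap R X.functionField).comp φ = algebraMap (X.presheaf.stalk x) X.functionField

/-- Canonical singularities of a normal variety `X` over `K`: the canonical divisor `K_X = div η`
is `ℚ`-Cartier and every exceptional prime divisor `E` over `X` has discrepancy `a(E, X) ≥ 0`.

A prime divisor over `X` is given by the local ring `R` at the generic point of a prime divisor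
on a normal variety birational to `X`, that is, by a discrete valuation ring `R` essentially of
finite type over `K` with fraction field `K(X)` which has a centre `x` on `X`; it is
exceptional if `x` is not of codimension one. If `g` is an equation of `r K_X` near `x` and `f`
is an equation of the divisor of `η` along `E`, then `a(E, X) = ord_E f - (1 / r) ord_E g`. -/
def HasCanonicalSing (K : Type u) [Field K] [Algebra K X.functionField] : Prop :=
  ∃ (η : RatForm k X.functionField) (D : X → ℤ), IsCanonicalDivisor X k η D ∧
    (∃ r : ℕ, 0 < r ∧ IsCartierDivisor X (fun P => r * D P)) ∧
    ∀ (R : Type u) [CommRing R] [IsDomain R] [IsDiscreteValuationRing R]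
      [Algebra R X.functionField] [IsFractionRing R X.functionField]
      [Algebra K R] [IsScalarTower K R X.functionField] [Algebra.EssFiniteType K R]
      (x : X), HasCentre X R x → Order.coheight x ≠ 1 →
      ∃ f : X.functionField, IsFormEquation k R η f ∧
        ∀ (r : ℕ) (g : X.functionField) (U : X.Opens), 0 < r → x ∈ U →
          IsEquationOn X (fun P => r * D P) U g →
          0 ≤ ((Ring.ordFrac R f).log : ℚ) - (1 / r : ℚ) * ((Ring.ordFrac R g).log : ℚ)

/-- `-K_X` is ample (and `K_X` is `ℚ`-Cartier). -/
def IsAntiCanonicalAmple : Prop :=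
  ∃ (η : RatForm k X.functionField) (D : X → ℤ), IsCanonicalDivisor X k η D ∧
    IsQAmpleDivisor X (fun P => - D P)

end Divisors

/-! ### Fano varieties with canonical singularities -/

section Fano

variable {X : Scheme.{u}} {K : Type u} [Field K]

/-- The embedding of `K` in the function field of an integral scheme over `K`. -/
def baseToFunctionField [IsIntegral X] (s : X ⟶ Spec (CommRingCat.of K)) :
    K →+* X.functionField :=
  ((Scheme.ΓSpecIso (CommRingCat.of K)).inv ≫ s.appTop ≫
    X.presheaf.germ ⊤ (genericPoint X) trivial).hom

/-- The function field of an integral scheme over `K` as an extension of `K`. -/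
abbrev functionFieldAlgebra [IsIntegral X] (s : X ⟶ Spec (CommRingCat.of K)) :
    Algebra K X.functionField :=
  (baseToFunctionField s).toAlgebra

/-- The function field of an integral scheme over `K` as an extension of a subfield `k` of `K`. -/
abbrev functionFieldSubAlgebra (k : Type u) [Field k] [Algebra k K] [IsIntegral X]
    (s : X ⟶ Spec (CommRingCat.of K)) : Algebra k X.functionField :=
  ((baseToFunctionField s).comp (algebraMap k K)).toAlgebra

/-- A normal variety over a field `K`: a normal integral separated scheme of finite type. -/
structure IsNormalVariety (s : X ⟶ Spec (CommRingCat.of K)) : Prop where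
  isIntegral : IsIntegral X
  isSeparated : IsSeparated s
  locallyOfFiniteType : LocallyOfFiniteType s
  quasiCompact : QuasiCompact s
  isIntegrallyClosed : ∀ x : X, IsIntegrallyClosed (X.presheaf.stalk x)

/-- A normal variety is locally noetherian. -/
theorem IsNormalVariety.isLocallyNoetherian {s : X ⟶ Spec (CommRingCat.of K)}
    (h : IsNormalVariety s) : IsLocallyNoetherian X :=
  haveI := h.locallyOfFiniteType
  LocallyOfFiniteType.isLocallyNoetherian s

/-- `X` is a Fano variety over `K`: a normal proper variety with ample anticanonical divisor. (The
perfect subfield `k` of `K`, over which `K` is finitely generated, serves to form the canonical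
divisor.) -/
def IsFanoVariety (k : Type u) [Field k] [PerfectField k] [Algebra k K]
    (s : X ⟶ Spec (CommRingCat.of K)) : Prop :=
  ∃ h : IsNormalVariety s, IsProper s ∧
    (haveI := h.isIntegral
     haveI := h.isLocallyNoetherian
     letI := functionFieldSubAlgebra k s
     IsAntiCanonicalAmple X k)

/-- `X` is a normal variety over `K` with canonical singularities. -/
def HasCanonicalSingularities (k : Type u) [Field k] [PerfectField k] [Algebra k K]
    (s : X ⟶ Spec (CommRingCat.of K)) : Prop :=
  ∃ h : IsNormalVariety s,
    (haveI := h.isIntegral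
     haveI := h.isLocallyNoetherian
     letI := functionFieldAlgebra s
     letI := functionFieldSubAlgebra k s
     HasCanonicalSing X k K)

end Fano

end

/-! ### Alternating maps and determinants -/

section Alternating

variable {F M N : Type*} [CommRing F] [AddCommGroup M] [Module F M] [AddCommGroup N] [Module F N]
  {ι : Type*} [Fintype ι] [DecidableEq ι]

/-! Write X = [1 : x₁ : ⋯ : xₙ] (`homCoord`), so that the j-th chart of projective space is where
all Xⱼ / Xᵢ are regular. Everything follows from the orders of one form of top degree over k, η = dt
∧ du₁ ∧ ⋯ ∧ duₙ (`volForm`). Put δ = n + 1 - m(q - 1), which is at least 1 because n ≥ m(q - 1).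

Canonical divisor. Along a prime divisor of Y that meets the j-th chart, q · ord η = (m + 1) ∑ ord
xᵢ - δ · ord Xⱼ (`exists_isFormEquation_of_isRootLocalization`). So q K_Y is Cartier, with equation
(∏ xᵢ) ^ (m + 1) · Xⱼ ^ (-δ) on the j-th chart (`chartEquation`). These equations differ by δ-th
powers of ratios of homogeneous coordinates, so -q K_Y is, up to linear equivalence, the pullback of
𝒪(δ) along the finite map Y → ℙⁿ, and it is ample.

Discrepancies. For an arbitrary divisor E with centre on the j-th chart, the claim becomes the
inequality ≥ in the same formula (`exists_isFormEquation_of_le`). If no xᵢ vanishes along E, each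
duᵢ is, modulo dt, a multiple of the differential of a regular function: uᵢ itself, or a monomial in
xᵢ and uᵢ that is a q-th root of 1 / xᵢ up to a unit (`exists_parameter`). If some xᵢ vanishes, take
the xⱼ of largest order. Then η is (up to sign) m xⱼ ^ m ∏ (uᵢ - uⱼ) times the product of duⱼ, dlog
xⱼ and the dlog (uᵢ - uⱼ), and a logarithmic form has at most a simple pole. Since (uᵢ - uⱼ) ^ q =
xᵢ ^ m - xⱼ ^ m, the loss of 1 is compensated by a count that uses n ≥ q and the coprimality of m
and q (`neg_dvrOrd_sum_le`).

Equality at codimension one points of Y needs explicit generators of the differentials of the local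
ring R. Let N be the span of the candidates and B (`diffSubring`) the ring of elements of R with
differential in N. If θ ∈ B is not a p-th power, then 1, θ, …, θ ^ (q - 1) are independent over F ^
q, so an element with q-th power in W = B ^ q[θ] (`frobeniusAdjoin`) lies in B. As R is a
localization of a ring whose q-th powers lie in a chart ring S of projective space, it suffices that
S ⊆ W, that is, that the chart coordinates and t lie in W (`IsRootLocalization.D_mem`). For q = 1 no
such θ is needed. -/

theorem AlternatingMap.map_sum_smul_eq_det_smul (f : M [⋀^ι]→ₗ[F] N) (A : Matrix ι ι F)
    (b : ι → M) : f (fun i => ∑ j, A i j • b j) = A.det • f b := by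
  have h : f.compLinearMap (Fintype.linearCombination F b) =
      (LinearMap.toSpanSingleton F N (f b)).compAlternatingMap Matrix.detRowAlternating := by
    refine Module.Basis.ext_alternating (Pi.basisFun F ι) fun v hv => ?_
    let σ : Equiv.Perm ι := Equiv.ofBijective v (Finite.injective_iff_bijective.mp hv)
    have h1 : (fun i => (Pi.basisFun F ι) (v i)) = (fun i => (Pi.basisFun F ι) i) ∘ σ := rfl
    rw [h1, AlternatingMap.map_perm, AlternatingMap.map_perm]
    congr 1
    have h2 : Matrix.detRowAlternating (fun i => (Pi.basisFun F ι) i) = (1 : F) := by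
      have : (fun i => (Pi.basisFun F ι) i) = (1 : Matrix ι ι F) := by
        ext i j
        simp [Matrix.one_apply, Pi.single_apply, eq_comm]
      rw [this]
      exact Matrix.det_one
    rw [LinearMap.compAlternatingMap_apply, h2, LinearMap.toSpanSingleton_apply, one_smul,
      AlternatingMap.compLinearMap_apply]
    congr 1
    ext i
    simp [Fintype.linearCombination_apply, Pi.single_apply]
  have h' : f (fun i => Fintype.linearCombination F b (A i)) = A.det • f b :=
    congrArg (fun g => g A) h
  simpa [Fintype.linearCombination_apply] using h'

/-- Adding multiples of one entry to the other entries does not change the value of an alternating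
map. -/
theorem AlternatingMap.map_add_smul_pivot (f : M [⋀^ι]→ₗ[F] N) (v : ι → M) (c : ι → F) (j : ι)
    (hc : c j = 0) : f (fun i => v i + c i • v j) = f v := by
  have h := f.map_sum_smul_eq_det_smul (fun i l => (1 : Matrix ι ι F) i l + c i * (1 : Matrix ι ι F) j l) v
  rw [Matrix.det_eq_of_forall_row_eq_smul_add_const c j hc (fun _ _ => rfl), Matrix.det_one,
    one_smul] at h
  rw [← h]
  congr 1
  ext i
  simp [add_smul, Finset.sum_add_distrib, Matrix.one_apply]

end Alternating

/-! ### The rank of the module of differentials -/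

section Kaehler

open KaehlerDifferential

-- A separating transcendence basis makes F formally étale over a polynomial ring, so the
-- differentials of the basis form a basis of Ω.
open scoped IntermediateField.algebraAdjoinAdjoin in
theorem rank_kaehlerDifferential_of_perfectField (k F : Type u) [Field k] [Field F] [Algebra k F]
    [PerfectField k] [Algebra.EssFiniteType k F] :
    Module.rank F (Ω[F⁄k]) = Algebra.trdeg k F := by
  obtain ⟨s, hs, hsep⟩ := exists_isTranscendenceBasis_and_isSeparable_of_perfectField k F
  let P := MvPolynomial s k
  let S := Algebra.adjoin k (Set.range ((↑) : s → F))
  let E := IntermediateField.adjoin k (Set.range ((↑) : s → F))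
  have hsep' : Algebra.IsSeparable E F := by
    convert! hsep <;> simp
  let e : P ≃ₐ[k] S := hs.1.aevalEquiv
  let : Algebra P S := e.toRingEquiv.toRingHom.toAlgebra
  let : Algebra P F := ((algebraMap S F).comp (algebraMap P S)).toAlgebra
  have : IsScalarTower P S F := .of_algebraMap_eq fun _ => rfl
  have : IsScalarTower k P F := .of_algebraMap_eq fun r => by
    change _ = ((algebraMap S F) (e (algebraMap k P r)))
    rw [e.commutes]; rfl
  have h1 : Algebra.FormallyEtale P S := by
    let e' : P ≃ₐ[P] S := AlgEquiv.ofRingEquiv (f := e.toRingEquiv) fun _ => rfl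
    exact .of_equiv e'
  have h2 : Algebra.FormallyEtale S E := .of_isLocalization (nonZeroDivisors S)
  have h3 : Algebra.FormallyEtale E F := .of_isSeparable E F
  have h4 : Algebra.FormallyEtale S F := .comp S E F
  have h5 : Algebra.FormallyEtale P F := .comp P S F
  have b := ((mvPolynomialBasis k s).baseChange F).map (tensorKaehlerEquivOfFormallyEtale k P F)
  rw [← b.mk_eq_rank'', ← hs.cardinalMk_eq_trdeg]

end Kaehler


/-! ### Differentials of discrete valuation rings -/

section DVR

open KaehlerDifferential TensorProduct IsLocalRing

variable (k R : Type u) [Field k] [CommRing R] [IsDomain R] [IsDiscreteValuationRing R]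
  [Algebra k R]

/-- Lifts of a transcendence basis of the residue field stay independent from a uniformizer ϖ: in a
relation for ϖ over them the constant term lies in the maximal ideal, hence is zero, and one divides
by ϖ. -/
theorem trdeg_residueField_add_one_le :
    Algebra.trdeg k (ResidueField R) + 1 ≤ Algebra.trdeg k R := by
  obtain ⟨ι, b, hb⟩ := exists_isTranscendenceBasis' k (ResidueField R)
  obtain ⟨ϖ, hϖ⟩ := IsDiscreteValuationRing.exists_irreducible R
  choose a ha using fun i => residue_surjective (R := R) (b i)
  let f : R →ₐ[k] ResidueField R := IsScalarTower.toAlgHom k R (ResidueField R)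
  have hfa : f ∘ a = b := funext ha
  have hind : AlgebraicIndependent k a := .of_comp f (hfa ▸ hb.1)
  have hinj : ∀ c ∈ Algebra.adjoin k (Set.range a), c ∈ maximalIdeal R → c = 0 := by
    intro c hc hcm
    obtain ⟨P, rfl⟩ : c ∈ (MvPolynomial.aeval (R := k) a).range := by
      rwa [← Algebra.adjoin_range_eq_range_aeval]
    have h0 : f (MvPolynomial.aeval a P) = 0 := (residue_eq_zero_iff _).mpr hcm
    have h1 : MvPolynomial.aeval b P = 0 := by
      rw [← hfa, ← h0, ← AlgHom.comp_apply, MvPolynomial.comp_aeval]; rfl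
    have h2 : P = 0 := (algebraicIndependent_iff.mp hb.1) P h1
    rw [h2]; exact map_zero (MvPolynomial.aeval a)
  have htr : Transcendental (Algebra.adjoin k (Set.range a)) ϖ := by
    rw [transcendental_iff]
    intro p hp
    induction h : p.natDegree using Nat.strong_induction_on generalizing p with
    | _ N ih =>
      have h1 := congrArg (Polynomial.aeval ϖ) p.divX_mul_X_add
      rw [hp, map_add, map_mul, Polynomial.aeval_X, Polynomial.aeval_C] at h1
      have h2 : algebraMap (Algebra.adjoin k (Set.range a)) R (p.coeff 0) ∈ maximalIdeal R := by
        rw [hϖ.maximalIdeal_eq, Ideal.mem_span_singleton]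
        exact ⟨-Polynomial.aeval ϖ p.divX, by linear_combination h1⟩
      have h3 : p.coeff 0 = 0 := Subtype.ext (hinj _ (p.coeff 0).2 h2)
      rw [h3, map_zero, add_zero] at h1
      have h4 : Polynomial.aeval ϖ p.divX = 0 := (mul_eq_zero.mp h1).resolve_right hϖ.ne_zero
      rw [← p.divX_mul_X_add, h3]
      by_cases hN : N = 0
      · have : p.divX = 0 := by
          rw [Polynomial.eq_C_of_natDegree_eq_zero (h.trans hN)]; simp
        simp [this]
      · have h5 : p.divX.natDegree < N := by
          rw [Polynomial.natDegree_divX_eq_natDegree_tsub_one]; lia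
        simp [ih _ h5 _ h4 rfl]
  have h := ((hind.option_iff_transcendental ϖ).mpr htr).cardinalMk_le_trdeg
  rwa [Cardinal.mk_option, hb.cardinalMk_eq_trdeg] at h

/-- The differentials of a discrete valuation ring essentially of finite type over a perfect field
are generated by the differential of a uniformizer and `d` further differentials, where `d + 1` is
the transcendence degree. -/
theorem exists_span_D_eq_top [PerfectField k] [Algebra.EssFiniteType k R] {ϖ : R}
    (hϖ : Irreducible ϖ) {n : ℕ} (hn : Algebra.trdeg k R ≤ n) :
    ∃ (d : ℕ) (_ : d + 1 = n) (a : Fin d → R),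
      Submodule.span R (Set.range (Fin.cons (D k R ϖ) fun i => D k R (a i) : Fin (d + 1) → _)) =
        ⊤ := by
  let κ := ResidueField R
  have hκ : Algebra.EssFiniteType k κ :=
    inferInstanceAs (Algebra.EssFiniteType k (R ⧸ maximalIdeal R))
  have hle : Algebra.trdeg k κ + 1 ≤ n := (trdeg_residueField_add_one_le k R).trans hn
  obtain ⟨e, he⟩ : ∃ e : ℕ, Algebra.trdeg k κ = e :=
    Cardinal.lt_aleph0.mp ((le_self_add.trans hle).trans_lt Cardinal.natCast_lt_aleph0)
  rw [he] at hle
  have hle' : e + 1 ≤ n := by exact_mod_cast hle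
  have hrank := rank_kaehlerDifferential_of_perfectField k κ
  have hfin : Module.finrank κ (Ω[κ⁄k]) = e := by
    rw [Module.finrank, hrank, he, Cardinal.toNat_natCast]
  have hF : Module.Finite κ (Ω[κ⁄k]) := Module.rank_lt_aleph0_iff.mp (by
    rw [hrank, he]; exact Cardinal.natCast_lt_aleph0)
  obtain ⟨f, hf, hfs, -⟩ := Submodule.exists_fun_fin_finrank_span_eq κ (Set.range (D k κ))
  replace hfs := hfs.trans (span_range_derivation k κ)
  have hcard : Module.finrank κ (Submodule.span κ (Set.range (D k κ))) = e := by
    rw [span_range_derivation, finrank_top, hfin]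
  choose c hc using hf
  choose c' hc' using fun i => residue_surjective (R := R) (c i)
  -- The first e elements lift a family whose differentials generate those of the residue field;
  -- zeros fill up the list to the prescribed length.
  let a : Fin (n - 1) → R := fun i => if h : (i : ℕ) < e then c' ⟨i, hcard.symm ▸ h⟩ else 0
  refine ⟨n - 1, by lia, a, ?_⟩
  set N := Submodule.span R (Set.range (Fin.cons (D k R ϖ) fun i => D k R (a i) :
    Fin (n - 1 + 1) → _)) with hN
  have hϖN : D k R ϖ ∈ N := Submodule.subset_span ⟨0, rfl⟩
  have haN : ∀ i, D k R (a i) ∈ N := fun i => Submodule.subset_span ⟨i.succ, by simp⟩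
  -- Nakayama: it suffices to generate after tensoring with the residue field κ.
  rw [← map_tensorProduct_mk_eq_top, eq_top_iff]
  have hsurj : Function.Surjective (algebraMap R κ) := residue_surjective
  rintro ω -
  have h1 : ∃ ν ∈ N, KaehlerDifferential.map k k R κ ν = mapBaseChange k R κ ω := by
    have hmem : mapBaseChange k R κ ω ∈ Submodule.span R (Set.range f) := by
      rw [← Submodule.restrictScalars_span R κ hsurj, hfs]
      trivial
    refine (Submodule.span_le (p := N.map (KaehlerDifferential.map k k R κ))).mpr ?_ hmem
    rintro _ ⟨i, rfl⟩
    refine ⟨D k R (a ⟨i, by have := i.2; lia⟩), haN _, ?_⟩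
    rw [KaehlerDifferential.map_D, ← hc i, ← hc' i]
    have : (i : ℕ) < e := by have := i.2; lia
    simp only [a, this, dite_true]
    rfl
  obtain ⟨ν, hν, hνω⟩ := h1
  have h2 : mapBaseChange k R κ (ω - 1 ⊗ₜ ν) = 0 := by
    rw [map_sub, mapBaseChange_tmul, one_smul, hνω, sub_self]
  -- By the conormal sequence, what remains is dy with y in the maximal ideal, and modulo that ideal
  -- dy is a multiple of dϖ.
  obtain ⟨y, hy⟩ := (exact_kerCotangentToTensor_mapBaseChange k R κ hsurj _).mp h2
  obtain ⟨y, rfl⟩ := Ideal.toCotangent_surjective _ y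
  rw [kerCotangentToTensor_toCotangent] at hy
  have hym : (y : R) ∈ maximalIdeal R := (residue_eq_zero_iff _).mp y.2
  rw [hϖ.maximalIdeal_eq, Ideal.mem_span_singleton] at hym
  obtain ⟨r, hr⟩ := hym
  have h3 : (1 : κ) ⊗ₜ[R] D k R (y : R) = 1 ⊗ₜ (r • D k R ϖ) := by
    rw [hr, Derivation.leibniz, tmul_add, tmul_smul ϖ, smul_tmul', ← Algebra.algebraMap_eq_smul_one]
    have : algebraMap R κ ϖ = 0 := (residue_eq_zero_iff _).mpr (by
      rw [hϖ.maximalIdeal_eq]; exact Ideal.mem_span_singleton_self _)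
    rw [this, zero_tmul, zero_add]
  rw [h3] at hy
  refine ⟨ν + r • D k R ϖ, N.add_mem hν (N.smul_mem _ hϖN), ?_⟩
  rw [mk_apply, tmul_add, hy]
  abel

end DVR


/-! ### Orders with respect to a discrete valuation ring -/

section Order

variable (R : Type u) [CommRing R] [IsDomain R] [IsDiscreteValuationRing R]
  {F : Type u} [Field F] [Algebra R F] [IsFractionRing R F]

/-- The normalized valuation of a discrete valuation ring `R`, as an integer; its value at `0`
is `0`. -/
noncomputable def dvrOrd (f : F) : ℤ := (Ring.ordFrac R f).log

variable {R} {f g : F}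

theorem ordFrac_ne_zero (hf : f ≠ 0) : Ring.ordFrac R f ≠ 0 := by
  simpa using hf

theorem dvrOrd_mul (hf : f ≠ 0) (hg : g ≠ 0) : dvrOrd R (f * g) = dvrOrd R f + dvrOrd R g := by
  rw [dvrOrd, map_mul, WithZero.log_mul (ordFrac_ne_zero hf) (ordFrac_ne_zero hg)]; rfl

@[simp] theorem dvrOrd_one : dvrOrd R (1 : F) = 0 := by simp [dvrOrd]

theorem dvrOrd_pow (f : F) (n : ℕ) : dvrOrd R (f ^ n) = n * dvrOrd R f := by
  simp [dvrOrd, map_pow, WithZero.log_pow]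

theorem dvrOrd_inv (f : F) : dvrOrd R f⁻¹ = -dvrOrd R f := by
  simp [dvrOrd, map_inv₀, WithZero.log_inv]

theorem dvrOrd_div (hf : f ≠ 0) (hg : g ≠ 0) : dvrOrd R (f / g) = dvrOrd R f - dvrOrd R g := by
  rw [div_eq_mul_inv, dvrOrd_mul hf (inv_ne_zero hg), dvrOrd_inv, sub_eq_add_neg]

theorem dvrOrd_zpow (f : F) (n : ℤ) : dvrOrd R (f ^ n) = n * dvrOrd R f := by
  simp [dvrOrd, map_zpow₀, WithZero.log_zpow]

theorem dvrOrd_neg (f : F) : dvrOrd R (-f) = dvrOrd R f := by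
  by_cases hf : f = 0
  · simp [hf]
  have h : dvrOrd R (-1 : F) = 0 := by
    have := dvrOrd_pow (R := R) (-1 : F) 2
    simp only [even_two, Even.neg_pow, one_pow, dvrOrd_one] at this
    push_cast at this
    lia
  rw [← neg_one_mul, dvrOrd_mul (by simp) hf, h, zero_add]

theorem dvrOrd_prod {ι : Type*} (s : Finset ι) (f : ι → F) (hf : ∀ i ∈ s, f i ≠ 0) :
    dvrOrd R (∏ i ∈ s, f i) = ∑ i ∈ s, dvrOrd R (f i) := by
  classical
  induction s using Finset.induction_on with
  | empty => simp
  | insert a s ha ih =>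
    rw [Finset.prod_insert ha, Finset.sum_insert ha, dvrOrd_mul (hf a (by simp))
      (Finset.prod_ne_zero_iff.mpr fun i hi => hf i (by simp [hi])),
      ih fun i hi => hf i (by simp [hi])]

theorem dvrOrd_algebraMap_nonneg (r : R) : 0 ≤ dvrOrd R (algebraMap R F r) := by
  by_cases hr : r = 0
  · simp [hr, dvrOrd]
  have h := Ring.ordFrac_ge_one_of_ne_zero (R := R) (K := F) hr
  have := (WithZero.log_le_log one_ne_zero (ordFrac_ne_zero (R := R)
    ((FaithfulSMul.algebraMap_eq_zero_iff R F).not.mpr hr))).mpr h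
  simpa [dvrOrd] using this

theorem isUnit_iff_dvrOrd_eq_zero {r : R} (hr : r ≠ 0) :
    IsUnit r ↔ dvrOrd R (algebraMap R F r) = 0 := by
  have h0 := ordFrac_ne_zero (R := R) ((FaithfulSMul.algebraMap_eq_zero_iff R F).not.mpr hr)
  rw [Ring.isUnit_iff_ordFrac_one_of_isDiscreteValuationRing (R := R) (K := F), dvrOrd]
  constructor
  · intro h; rw [h]; simp
  · intro h
    have := WithZero.exp_log h0
    rw [h] at this
    simpa using this.symm

theorem dvrOrd_irreducible {ϖ : R} (hϖ : Irreducible ϖ) : dvrOrd R (algebraMap R F ϖ) = 1 := by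
  rw [dvrOrd, Ring.ordFrac_irreducible hϖ, WithZero.log_exp]

theorem exists_algebraMap_eq_iff (hf : f ≠ 0) :
    (∃ r : R, algebraMap R F r = f) ↔ 0 ≤ dvrOrd R f := by
  constructor
  · rintro ⟨r, rfl⟩
    exact dvrOrd_algebraMap_nonneg r
  · intro h
    rcases ValuationRing.isInteger_or_isInteger R f with ⟨r, hr⟩ | ⟨r, hr⟩
    · exact ⟨r, hr⟩
    · have h1 := dvrOrd_algebraMap_nonneg (F := F) r
      rw [hr, dvrOrd_inv] at h1
      have hr0 : r ≠ 0 := by rintro rfl; simp at hr; exact hf hr.symm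
      have h2 : IsUnit r := (isUnit_iff_dvrOrd_eq_zero (F := F) hr0).mpr (by
        rw [hr, dvrOrd_inv]; lia)
      obtain ⟨u, rfl⟩ := h2
      refine ⟨(u⁻¹ : Rˣ), ?_⟩
      rw [← inv_inv f, ← hr]
      exact map_units_inv (algebraMap R F) u

theorem le_dvrOrd_add (hfg : f + g ≠ 0) {n : ℤ} (hf : f = 0 ∨ n ≤ dvrOrd R f)
    (hg : g = 0 ∨ n ≤ dvrOrd R g) : n ≤ dvrOrd R (f + g) := by
  by_cases hf0 : f = 0
  · subst hf0
    have : g ≠ 0 := by simpa using hfg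
    simpa using hg.resolve_left this
  by_cases hg0 : g = 0
  · subst hg0
    simpa using hf.resolve_left hf0
  have h := Ring.ordFrac_add (R := R) f g hfg
  rcases inf_le_iff.mp h with h | h
  · exact (hf.resolve_left hf0).trans
      ((WithZero.log_le_log (ordFrac_ne_zero hf0) (ordFrac_ne_zero hfg)).mpr h)
  · exact (hg.resolve_left hg0).trans
      ((WithZero.log_le_log (ordFrac_ne_zero hg0) (ordFrac_ne_zero hfg)).mpr h)

theorem dvrOrd_add_of_lt (hf : f ≠ 0) (hg : g = 0 ∨ dvrOrd R f < dvrOrd R g) :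
    f + g ≠ 0 ∧ dvrOrd R (f + g) = dvrOrd R f := by
  have h0 : f + g ≠ 0 := by
    intro h
    have hg' : g = -f := by linear_combination h
    rcases hg with hg | hg
    · rw [hg, add_zero] at h; exact hf h
    · rw [hg', dvrOrd_neg] at hg; exact lt_irrefl _ hg
  refine ⟨h0, le_antisymm ?_ (le_dvrOrd_add h0 (.inr le_rfl) (hg.imp_right le_of_lt))⟩
  by_contra! hlt
  have := le_dvrOrd_add (R := R) (f := f + g) (g := -g) (n := dvrOrd R f + 1) (by simpa using hf)
    (.inr (by lia)) (by rw [dvrOrd_neg, neg_eq_zero]; exact hg.imp_right (by lia))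
  simp at this

end Order

/-! ### Top differential forms -/

section Wedge

open KaehlerDifferential

variable {k F : Type u} [Field k] [Field F] [Algebra k F] {n : ℕ}

/-- The exterior product of `n + 1` differentials, where `n + 1` is the transcendence degree. -/
noncomputable def wedge (h : n + 1 = Cardinal.toNat (Algebra.trdeg k F)) :
    (Ω[F⁄k]) [⋀^Fin (n + 1)]→ₗ[F] RatForm k F :=
  (exteriorPower.ιMulti F (Cardinal.toNat (Algebra.trdeg k F))).domDomCongr (finCongr h).symm

variable (h : n + 1 = Cardinal.toNat (Algebra.trdeg k F))

theorem wedge_smul (c : Fin (n + 1) → F) (v : Fin (n + 1) → Ω[F⁄k]) :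
    wedge h (fun i => c i • v i) = (∏ i, c i) • wedge h v :=
  (wedge h).toMultilinearMap.map_smul_univ c v

/-- As many spanning vectors as the dimension form a basis, and the determinant with respect to it
is a functional with value 1 on their wedge. -/
theorem wedge_ne_zero_of_span (hk : Module.rank F (Ω[F⁄k]) = Algebra.trdeg k F)
    {v : Fin (n + 1) → Ω[F⁄k]} (hv : ⊤ ≤ Submodule.span F (Set.range v)) :
    wedge h v ≠ 0 := by
  have hfin : Module.finrank F (Ω[F⁄k]) = n + 1 := by
    rw [Module.finrank, hk, h]
  let b := basisOfTopLeSpanOfCardEqFinrank v hv (by simp [hfin])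
  have hb : ⇑b = v := coe_basisOfTopLeSpanOfCardEqFinrank _ _ _
  intro h0
  have h1 : exteriorPower.alternatingMapLinearEquiv (b.det.domDomCongr (finCongr h))
      (wedge h v) = b.det v := by
    simp only [wedge, AlternatingMap.domDomCongr_apply]
    rw [exteriorPower.alternatingMapLinearEquiv_apply_ιMulti]
    rfl
  rw [h0, map_zero, ← hb, b.det_self] at h1
  exact zero_ne_one h1

variable {R : Type u} [CommRing R] [Algebra R F]

theorem exists_wedge_eq_smul {b v : Fin (n + 1) → Ω[F⁄k]}
    (hv : ∀ i, ∃ c : Fin (n + 1) → R, v i = ∑ j, algebraMap R F (c j) • b j) :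
    ∃ r : R, wedge h v = algebraMap R F r • wedge h b := by
  choose c hc using hv
  refine ⟨Matrix.det (Matrix.of c), ?_⟩
  have : v = fun i => ∑ j, ((Matrix.of c).map (algebraMap R F)) i j • b j := funext hc
  rw [this, AlternatingMap.map_sum_smul_eq_det_smul, ← RingHom.mapMatrix_apply, ← RingHom.map_det]

/-- If the differentials of `a₀, …, aₙ` generate the differentials of `R`, then
`da₀ ∧ ⋯ ∧ daₙ` generates the regular forms on `R`. -/
theorem isFormEquation_of_generators (a : Fin (n + 1) → R)
    (ha : ∀ r : R, ∃ c : Fin (n + 1) → R, D k F (algebraMap R F r) =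
      ∑ j, algebraMap R F (c j) • D k F (algebraMap R F (a j)))
    {η : RatForm k F} (hη : η ≠ 0) {f : F}
    (hf : η = f • wedge h fun i => D k F (algebraMap R F (a i))) :
    IsFormEquation k R η f := by
  refine ⟨fun h0 => hη (by rw [hf, h0, zero_smul]), _, hf, fun ω => ⟨fun hω => ?_, ?_⟩⟩
  · induction hω using AddSubgroup.closure_induction with
    | mem x hx =>
      obtain ⟨r, b, rfl⟩ := hx
      obtain ⟨s, hs⟩ := exists_wedge_eq_smul h (R := R) (b := fun i => D k F (algebraMap R F (a i)))
        (v := fun i => D k F (algebraMap R F (b (finCongr h i)))) (fun i => ha _)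
      refine ⟨r * s, ?_⟩
      rw [map_mul, mul_smul, ← hs]
      congr 1
    | zero => exact ⟨0, by simp⟩
    | add x y _ _ hx hy =>
      obtain ⟨r, rfl⟩ := hx
      obtain ⟨s, rfl⟩ := hy
      exact ⟨r + s, by rw [map_add, add_smul]⟩
    | neg x _ hx =>
      obtain ⟨r, rfl⟩ := hx
      exact ⟨-r, by rw [map_neg]; exact (neg_smul _ _).symm⟩
  · rintro ⟨r, rfl⟩
    exact AddSubgroup.subset_closure ⟨r, fun i => a ((finCongr h).symm i), rfl⟩

/-- Two generators of the same module of rank one differ by a unit; this makes the order of a form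
along a divisor well defined. -/
theorem IsFormEquation.exists_unit_mul [IsDomain R] [IsFractionRing R F] {η : RatForm k F}
    (hη : η ≠ 0) {f g : F} (hf : IsFormEquation k R η f) (hg : IsFormEquation k R η g) :
    ∃ u : Rˣ, f = algebraMap R F u * g := by
  obtain ⟨hf0, ω, hfω, hω⟩ := hf
  obtain ⟨hg0, ω', hgω, hω'⟩ := hg
  have hω0 : ω ≠ 0 := fun h0 => hη (by rw [hfω, h0, smul_zero])
  have hω'0 : ω' ≠ 0 := fun h0 => hη (by rw [hgω, h0, smul_zero])
  obtain ⟨r, hr⟩ := (hω' ω).mp ((hω ω).mpr ⟨1, by simp⟩)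
  obtain ⟨s, hs⟩ := (hω ω').mp ((hω' ω').mpr ⟨1, by simp⟩)
  have hrs : s * r = 1 := by
    apply IsFractionRing.injective R F
    have h1 : (algebraMap R F (s * r)) • ω' = (1 : F) • ω' := by
      rw [map_mul, mul_smul, ← hr, ← hs, one_smul]
    rw [map_one]
    exact smul_left_injective F hω'0 h1
  refine ⟨⟨s, r, hrs, by rw [mul_comm, hrs]⟩, ?_⟩
  have h2 : f • ω = (algebraMap R F s * g) • ω := by
    rw [← hfω, hgω, hs, mul_comm, mul_smul]
  exact smul_left_injective F hω0 h2

theorem IsFormEquation.dvrOrd_eq [IsDomain R] [IsDiscreteValuationRing R] [IsFractionRing R F]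
    {η : RatForm k F} (hη : η ≠ 0) {f g : F} (hf : IsFormEquation k R η f)
    (hg : IsFormEquation k R η g) : dvrOrd R f = dvrOrd R g := by
  obtain ⟨u, rfl⟩ := hf.exists_unit_mul hη hg
  rw [dvrOrd_mul (by simp) hg.1, (isUnit_iff_dvrOrd_eq_zero (F := F) u.ne_zero).mp u.isUnit,
    zero_add]

variable (k F R) in
/-- The `R`-module generated by the differentials of the elements of `R`. -/
noncomputable def regularDiff : Submodule R (Ω[F⁄k]) :=
  Submodule.span R (Set.range fun r : R => D k F (algebraMap R F r))

theorem D_mem_regularDiff (r : R) : D k F (algebraMap R F r) ∈ regularDiff k F R :=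
  Submodule.subset_span ⟨r, rfl⟩

theorem exists_dvr_generators [IsDomain R] [IsDiscreteValuationRing R] [IsFractionRing R F]
    [PerfectField k] [Algebra k R] [IsScalarTower k R F] [Algebra.EssFiniteType k R]
    (h : n + 1 = Cardinal.toNat (Algebra.trdeg k F)) {ϖ : R} (hϖ : Irreducible ϖ) :
    ∃ a : Fin (n + 1) → R, a 0 = ϖ ∧ regularDiff k F R =
      Submodule.span R (Set.range fun i => D k F (algebraMap R F (a i))) := by
  have htr : Algebra.trdeg k F = (n + 1 : ℕ) :=
    ((Cardinal.toNat_eq_iff n.succ_ne_zero).mp h.symm)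
  have hR : Algebra.trdeg k R ≤ (n + 1 : ℕ) := htr ▸
    trdeg_le_of_injective (IsScalarTower.toAlgHom k R F) (IsFractionRing.injective R F)
  obtain ⟨d, hd, a, ha⟩ := exists_span_D_eq_top k R hϖ hR
  obtain rfl : d = n := by lia
  refine ⟨Fin.cons ϖ a, rfl, le_antisymm ?_ ?_⟩
  · rw [regularDiff, Submodule.span_le]
    rintro _ ⟨r, rfl⟩
    have h1 : D k R r ∈ Submodule.span R (Set.range (Fin.cons (D k R ϖ) fun i => D k R (a i) :
        Fin (d + 1) → _)) := ha ▸ trivial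
    have h2 := Submodule.mem_map_of_mem (f := KaehlerDifferential.map k k R F) h1
    rw [Submodule.map_span, ← Set.range_comp, KaehlerDifferential.map_D] at h2
    have h3 : (fun i => D k F (algebraMap R F ((Fin.cons ϖ a : Fin (d + 1) → R) i))) =
        KaehlerDifferential.map k k R F ∘ Fin.cons (D k R ϖ) fun i => D k R (a i) := by
      ext i
      refine Fin.cases ?_ (fun i => ?_) i <;> simp
    rw [h3]
    exact h2
  · rw [Submodule.span_le]
    rintro _ ⟨i, rfl⟩
    exact D_mem_regularDiff _

theorem mem_span_range_iff_exists_algebraMap_smul {b : Fin (n + 1) → Ω[F⁄k]} {ω : Ω[F⁄k]} :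
    ω ∈ Submodule.span R (Set.range b) ↔
      ∃ c : Fin (n + 1) → R, ω = ∑ j, algebraMap R F (c j) • b j := by
  simp only [Submodule.mem_span_range_iff_exists_fun, algebraMap_smul, eq_comm]

/-- For g = u ϖ ^ N with u a unit, dg / g = du / u + N dϖ / ϖ. -/
theorem dlog_mem [IsDomain R] [IsDiscreteValuationRing R] [IsFractionRing R F] {ϖ : R}
    (hϖ : Irreducible ϖ) {g : F} (hg : g ≠ 0) :
    g⁻¹ • D k F g ∈ regularDiff k F R ⊔
      Submodule.span R {(algebraMap R F ϖ)⁻¹ • D k F (algebraMap R F ϖ)} := by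
  have hϖ0 : algebraMap R F ϖ ≠ 0 := by simpa using hϖ.ne_zero
  have key : ∀ (u : Rˣ) (N : ℤ), (algebraMap R F u * algebraMap R F ϖ ^ N)⁻¹ •
      D k F (algebraMap R F u * algebraMap R F ϖ ^ N) ∈ regularDiff k F R ⊔
      Submodule.span R {(algebraMap R F ϖ)⁻¹ • D k F (algebraMap R F ϖ)} := by
    intro u N
    have hu0 : algebraMap R F (u : R) ≠ 0 := by simp
    have h1 : (algebraMap R F u * algebraMap R F ϖ ^ N)⁻¹ •
        D k F (algebraMap R F u * algebraMap R F ϖ ^ N) =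
        ((u⁻¹ : Rˣ) : R) • D k F (algebraMap R F u) +
          (N : R) • (algebraMap R F ϖ)⁻¹ • D k F (algebraMap R F ϖ) := by
      have h2 : algebraMap R F ((u⁻¹ : Rˣ) : R) = (algebraMap R F (u : R))⁻¹ :=
        eq_inv_of_mul_eq_one_left (by rw [← map_mul, Units.inv_mul, map_one])
      rw [← algebraMap_smul F ((u⁻¹ : Rˣ) : R), ← algebraMap_smul F (N : R), h2,
        Derivation.leibniz, Derivation.leibniz_zpow, map_intCast, add_comm]
      simp only [smul_add, smul_smul, ← Int.cast_smul_eq_zsmul F]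
      congr 2
      · field_simp
      · rw [zpow_sub_one₀ hϖ0]
        field_simp
    rw [h1]
    exact Submodule.add_mem_sup (Submodule.smul_mem _ _ (D_mem_regularDiff _))
      (Submodule.smul_mem _ _ (Submodule.mem_span_singleton_self _))
  have hord : Ring.ordFrac R (algebraMap R F ϖ ^ dvrOrd R g) = Ring.ordFrac R g := by
    rw [map_zpow₀, Ring.ordFrac_irreducible hϖ, dvrOrd, ← WithZero.exp_zsmul]
    simpa using WithZero.exp_log (ordFrac_ne_zero (R := R) hg)
  obtain ⟨u, hu⟩ := Ring.associated_of_ordFrac_eq _ _ hord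
  rw [Units.smul_def, Algebra.smul_def] at hu
  rw [← hu]
  exact key u _

section

variable [IsDomain R] [IsDiscreteValuationRing R] [IsFractionRing R F] [PerfectField k]
    [Algebra k R] [IsScalarTower k R F] [Algebra.EssFiniteType k R]

/-- The element r is the determinant that expresses the vᵢ by generators of the differentials of R.
-/
theorem exists_isFormEquation_of_regular {c : Fin (n + 1) → F} {v : Fin (n + 1) → Ω[F⁄k]}
    (hv : ∀ i, v i ∈ regularDiff k F R) (hne : wedge h (fun i => c i • v i) ≠ 0) :
    ∃ (f : F) (r : R), IsFormEquation k R (wedge h fun i => c i • v i) f ∧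
      f = (∏ i, c i) * algebraMap R F r := by
  obtain ⟨ϖ, hϖ⟩ := IsDiscreteValuationRing.exists_irreducible R
  obtain ⟨a, -, ha⟩ := exists_dvr_generators (R := R) h hϖ
  rw [ha] at hv
  obtain ⟨r, hr⟩ := exists_wedge_eq_smul h
    fun i => mem_span_range_iff_exists_algebraMap_smul.mp (hv i)
  refine ⟨_, r, isFormEquation_of_generators h a (fun s => ?_) hne ?_, rfl⟩
  · exact mem_span_range_iff_exists_algebraMap_smul.mp (ha ▸ D_mem_regularDiff s)
  · rw [wedge_smul, hr, mul_smul]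

/-- A logarithmic form has at most a simple pole. -/
theorem exists_isFormEquation_of_log {ϖ : R} (hϖ : Irreducible ϖ) {c : Fin (n + 1) → F}
    {v : Fin (n + 1) → Ω[F⁄k]}
    (hv : ∀ i, v i ∈ regularDiff k F R ⊔
      Submodule.span R {(algebraMap R F ϖ)⁻¹ • D k F (algebraMap R F ϖ)})
    (hne : wedge h (fun i => c i • v i) ≠ 0) :
    ∃ (f : F) (r : R), IsFormEquation k R (wedge h fun i => c i • v i) f ∧
      f = (∏ i, c i) * (algebraMap R F ϖ)⁻¹ * algebraMap R F r := by
  obtain ⟨a, ha0, ha⟩ := exists_dvr_generators (R := R) h hϖ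
  have hϖ0 : algebraMap R F ϖ ≠ 0 := by simpa using hϖ.ne_zero
  -- Replacing dϖ by dϖ / ϖ in a generating family of Ω gives generators of the logarithmic
  -- differentials; this is the only source of the factor ϖ⁻¹.
  let e : Fin (n + 1) → F := Fin.cons (algebraMap R F ϖ)⁻¹ 1
  let b : Fin (n + 1) → Ω[F⁄k] := fun i => e i • D k F (algebraMap R F (a i))
  have he : ∏ i, e i = (algebraMap R F ϖ)⁻¹ := by simp [e, Fin.prod_univ_succ]
  have hb0 : b 0 = (algebraMap R F ϖ)⁻¹ • D k F (algebraMap R F ϖ) := by simp [b, e, ha0]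
  have hle : regularDiff k F R ⊔
      Submodule.span R {(algebraMap R F ϖ)⁻¹ • D k F (algebraMap R F ϖ)} ≤
      Submodule.span R (Set.range b) := by
    refine sup_le ?_ ?_
    · rw [ha, Submodule.span_le]
      rintro _ ⟨i, rfl⟩
      refine Fin.cases ?_ (fun i => ?_) i
      · have : D k F (algebraMap R F (a 0)) = ϖ • b 0 := by
          rw [hb0, ha0, ← algebraMap_smul F ϖ, smul_smul, mul_inv_cancel₀ hϖ0, one_smul]
        change D k F (algebraMap R F (a 0)) ∈ _
        rw [this]
        exact Submodule.smul_mem _ _ (Submodule.subset_span ⟨0, rfl⟩)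
      · exact Submodule.subset_span ⟨i.succ, by simp [b, e]⟩
    · rw [Submodule.span_le, Set.singleton_subset_iff, ← hb0]
      exact Submodule.subset_span ⟨0, rfl⟩
  obtain ⟨r, hr⟩ := exists_wedge_eq_smul h
    fun i => mem_span_range_iff_exists_algebraMap_smul.mp (hle (hv i))
  refine ⟨_, r, isFormEquation_of_generators h a (fun s => ?_) hne ?_, rfl⟩
  · exact mem_span_range_iff_exists_algebraMap_smul.mp (ha ▸ D_mem_regularDiff s)
  · rw [wedge_smul, hr, wedge_smul, he, smul_smul, smul_smul]
    congr 1
    ring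

end

end Wedge


/-! ### The coordinate ring of the fibre power is a domain -/

section Sum

open MvPolynomial

/-- The leading monomial of the summand of largest degree occurs in no other summand. -/
theorem MvPolynomial.sum_ne_zero_of_degree_injOn {σ R α : Type*} [CommRing R]
    (o : MonomialOrder σ) {s : Finset α} (hs : s.Nonempty) {g : α → MvPolynomial σ R}
    (hg : ∀ a ∈ s, g a ≠ 0) (hinj : Set.InjOn (fun a => o.degree (g a)) s) :
    ∑ a ∈ s, g a ≠ 0 := by
  classical
  obtain ⟨a, ha, hmax⟩ := s.exists_max_image (fun a => o.toSyn (o.degree (g a))) hs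
  intro h0
  have h1 : coeff (o.degree (g a)) (∑ b ∈ s, g b) = coeff (o.degree (g a)) (g a) := by
    rw [coeff_sum]
    refine Finset.sum_eq_single_of_mem a ha fun b hb hba => o.coeff_eq_zero_of_lt ?_
    refine lt_of_le_of_ne (hmax b hb) fun h => hba (hinj hb ha ?_)
    exact o.toSyn.injective h
  rw [h0, coeff_zero] at h1
  exact o.coeff_degree_ne_zero_iff.mpr (hg a ha) h1.symm

end Sum

/-! ### Embedding of the coordinate ring in a polynomial ring by the q-th power map -/

namespace FanoCover

open MvPolynomial

variable (k : Type u) [Field k] (p : ℕ) [Fact p.Prime] [CharP k p]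

instance charP_ratFunc : CharP (RatFunc k) p := charP_of_injective_algebraMap
  (algebraMap k (RatFunc k)).injective p

/-- The `q`-th power map, `q = p ^ r`, of the coordinate ring of the fibre power, lifted to
polynomials. It takes values in `K[x₁, …, xₙ]`. -/
noncomputable def frobLift (r n m : ℕ) :
    MvPolynomial (Fin n ⊕ Fin n) (RatFunc k) →+* MvPolynomial (Fin n) (RatFunc k) :=
  eval₂Hom (C.comp (iterateFrobenius (RatFunc k) p r))
    (Sum.elim (fun i => X i ^ p ^ r) fun i => X i ^ m + C RatFunc.X)

variable {k} {r n m : ℕ}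

theorem curvePowerIdeal_le_ker : curvePowerIdeal k n m (p ^ r) ≤
    RingHom.ker (frobLift k p r n m) := by
  rw [curvePowerIdeal, Ideal.span_le]
  rintro _ ⟨i, rfl⟩
  have : CharP (MvPolynomial (Fin n) (RatFunc k)) p := inferInstance
  simp [frobLift, add_pow_char_pow, iterateFrobenius_def, ← pow_mul, mul_comm]

/-- The degree of the polynomial that `frobLift` assigns to a monomial. -/
theorem degree_frobLift_monomial (hm : 0 < m) (d : Fin n ⊕ Fin n →₀ ℕ) {c : RatFunc k}
    (hc : c ≠ 0) : frobLift k p r n m (monomial d c) ≠ 0 ∧ ∀ i,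
      (MonomialOrder.lex (σ := Fin n)).degree (frobLift k p r n m (monomial d c)) i =
        p ^ r * d (Sum.inl i) + m * d (Sum.inr i) := by
  let o := MonomialOrder.lex (σ := Fin n)
  have hX : ∀ i : Fin n, (X i : MvPolynomial (Fin n) (RatFunc k)) ^ p ^ r ≠ 0 := fun i =>
    pow_ne_zero _ (X_ne_zero i)
  have hdX : ∀ (i : Fin n) (a : ℕ), o.degree ((X i : MvPolynomial (Fin n) (RatFunc k)) ^ a) =
      Finsupp.single i a := fun i a => by
    rw [o.degree_pow, o.degree_X, Finsupp.smul_single, nsmul_one, Nat.cast_id]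
  have hlt : ∀ i : Fin n, o.toSyn (o.degree (C RatFunc.X : MvPolynomial (Fin n) (RatFunc k))) <
      o.toSyn (o.degree ((X i : MvPolynomial (Fin n) (RatFunc k)) ^ m)) := fun i => by
    rw [o.degree_C, hdX, map_zero, MonomialOrder.toSyn_lt_iff_ne_zero]
    simp [hm.ne']
  have hdU : ∀ i : Fin n, o.degree ((X i : MvPolynomial (Fin n) (RatFunc k)) ^ m + C RatFunc.X) =
      Finsupp.single i m := fun i => by
    rw [o.degree_add_of_lt (hlt i), hdX]
  have hU : ∀ i : Fin n, (X i : MvPolynomial (Fin n) (RatFunc k)) ^ m + C RatFunc.X ≠ 0 := by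
    intro i h
    have := hdU i
    rw [h, o.degree_zero] at this
    exact hm.ne' (Finsupp.single_eq_zero.mp this.symm)
  have hval : frobLift k p r n m (monomial d c) = C (c ^ p ^ r) *
      ((∏ i : Fin n, (X i ^ p ^ r) ^ d (Sum.inl i)) *
        ∏ i : Fin n, (X i ^ m + C (RatFunc.X : RatFunc k)) ^ d (Sum.inr i)) := by
    rw [frobLift, coe_eval₂Hom, eval₂_monomial, Finsupp.prod_fintype _ _ (by simp),
      Fintype.prod_sum_type]
    simp [iterateFrobenius_def]
  have h1 : ∏ i : Fin n, ((X i : MvPolynomial (Fin n) (RatFunc k)) ^ p ^ r) ^ d (Sum.inl i) ≠ 0 :=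
    Finset.prod_ne_zero_iff.mpr fun i _ => pow_ne_zero _ (hX i)
  have h2 : ∏ i : Fin n, ((X i : MvPolynomial (Fin n) (RatFunc k)) ^ m + C RatFunc.X) ^
      d (Sum.inr i) ≠ 0 := Finset.prod_ne_zero_iff.mpr fun i _ => pow_ne_zero _ (hU i)
  have h3 : (C (c ^ p ^ r) : MvPolynomial (Fin n) (RatFunc k)) ≠ 0 := by
    rw [Ne, C_eq_zero]
    exact pow_ne_zero _ hc
  refine ⟨hval ▸ mul_ne_zero h3 (mul_ne_zero h1 h2), fun i => ?_⟩
  have h4 : o.degree (frobLift k p r n m (monomial d c)) =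
      ∑ i, Finsupp.single i (p ^ r * d (Sum.inl i)) + ∑ i, Finsupp.single i (m * d (Sum.inr i)) := by
    rw [hval, o.degree_mul h3 (mul_ne_zero h1 h2), o.degree_C, zero_add, o.degree_mul h1 h2,
      o.degree_prod fun i _ => pow_ne_zero _ (hX i), o.degree_prod fun i _ => pow_ne_zero _ (hU i)]
    congr 1
    · exact Finset.sum_congr rfl fun i _ => by rw [← pow_mul, hdX]
    · exact Finset.sum_congr rfl fun i _ => by
        rw [o.degree_pow, hdU, Finsupp.smul_single, smul_eq_mul, mul_comm]
  change o.degree _ i = _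
  rw [h4]
  simp [Finsupp.single_apply]

/-- Replacing uᵢ ^ q by xᵢ ^ m + t lowers the total degree in the variables u, on which the
induction runs. -/
theorem exists_reduced {q : ℕ} (hq : 0 < q)
    (f : MvPolynomial (Fin n ⊕ Fin n) (RatFunc k)) :
    ∃ g : MvPolynomial (Fin n ⊕ Fin n) (RatFunc k), f - g ∈ curvePowerIdeal k n m q ∧
      ∀ d ∈ g.support, ∀ i, d (Sum.inr i) < q := by
  classical
  have hadd : ∀ f₁ f₂ : MvPolynomial (Fin n ⊕ Fin n) (RatFunc k),
      (∃ g, f₁ - g ∈ curvePowerIdeal k n m q ∧ ∀ d ∈ g.support, ∀ i, d (Sum.inr i) < q) →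
      (∃ g, f₂ - g ∈ curvePowerIdeal k n m q ∧ ∀ d ∈ g.support, ∀ i, d (Sum.inr i) < q) →
      ∃ g, f₁ + f₂ - g ∈ curvePowerIdeal k n m q ∧ ∀ d ∈ g.support, ∀ i, d (Sum.inr i) < q := by
    rintro f₁ f₂ ⟨g₁, h₁, h₁'⟩ ⟨g₂, h₂, h₂'⟩
    refine ⟨g₁ + g₂, by convert add_mem h₁ h₂ using 1; ring, fun d hd i => ?_⟩
    rcases Finset.mem_union.mp (support_add hd) with h | h
    exacts [h₁' d h i, h₂' d h i]
  have hmon : ∀ (N : ℕ) (d : Fin n ⊕ Fin n →₀ ℕ) (c : RatFunc k), ∑ i, d (Sum.inr i) = N →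
      ∃ g, monomial d c - g ∈ curvePowerIdeal k n m q ∧
        ∀ d ∈ g.support, ∀ i, d (Sum.inr i) < q := by
    intro N
    induction N using Nat.strong_induction_on with
    | _ N ih =>
      intro d c hd
      by_cases hlt : ∀ i, d (Sum.inr i) < q
      · refine ⟨monomial d c, by simp, fun e he => ?_⟩
        obtain rfl : e = d := by simpa using support_monomial_subset he
        exact hlt
      push Not at hlt
      obtain ⟨i, hi⟩ := hlt
      let e := d - Finsupp.single (Sum.inr i) q
      have hde : d = e + Finsupp.single (Sum.inr i) q := by
        refine (tsub_add_cancel_of_le (Finsupp.single_le_iff.mpr hi)).symm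
      have hsum : ∑ j, e (Sum.inr j) < N := by
        rw [← hd]
        refine Finset.sum_lt_sum (fun j _ => by simp [e]) ⟨i, Finset.mem_univ _, ?_⟩
        simp only [e, Finsupp.tsub_apply, Finsupp.single_eq_same]
        lia
      obtain ⟨g, hg, hg'⟩ := hadd (monomial (e + Finsupp.single (Sum.inl i) m) c)
        (monomial e (c * RatFunc.X)) (ih _ hsum _ _ (by simp)) (ih _ hsum _ _ rfl)
      refine ⟨g, ?_, hg'⟩
      have h1 : monomial d c - (monomial (e + Finsupp.single (Sum.inl i) m) c +
          monomial e (c * RatFunc.X)) ∈ curvePowerIdeal k n m q := by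
        have h2 : monomial d c - (monomial (e + Finsupp.single (Sum.inl i) m) c +
            monomial e (c * RatFunc.X)) = monomial e c * (X (Sum.inr i) ^ q -
              (X (Sum.inl i) ^ m + C RatFunc.X)) := by
          rw [hde, mul_sub, mul_add, monomial_add_single, monomial_add_single,
            mul_comm (monomial e c) (C _), C_mul_monomial, mul_comm c]
        rw [h2]
        exact Ideal.mul_mem_left _ _ (Ideal.subset_span ⟨i, rfl⟩)
      convert add_mem h1 hg using 1
      ring
  induction f using MvPolynomial.induction_on' with
  | monomial d c => exact hmon _ d c rfl
  | add f₁ f₂ h₁ h₂ => exact hadd f₁ f₂ h₁ h₂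

/-- The image of a reduced monomial has lex degree q aᵢ + m bᵢ in the i-th variable, with bᵢ < q. As
m is prime to q, this determines bᵢ modulo q, hence bᵢ and aᵢ; so reduced monomials have images of
distinct degrees, and no nonzero reduced polynomial is killed. -/
theorem ker_frobLift (hm : 0 < m) (hpm : ¬ p ∣ m) :
    RingHom.ker (frobLift k p r n m) = curvePowerIdeal k n m (p ^ r) := by
  have hp : p.Prime := Fact.out
  refine le_antisymm (fun f hf => ?_) (curvePowerIdeal_le_ker p)
  obtain ⟨g, hg, hg'⟩ := exists_reduced (k := k) (n := n) (m := m) (pow_pos hp.pos r) f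
  have hg0 : frobLift k p r n m g = 0 := by
    have := curvePowerIdeal_le_ker p hg
    rw [RingHom.mem_ker, map_sub, RingHom.mem_ker.mp hf, zero_sub, neg_eq_zero] at this
    exact this
  suffices g = 0 by simpa [this] using hg
  by_contra hne
  refine MvPolynomial.sum_ne_zero_of_degree_injOn (MonomialOrder.lex (σ := Fin n))
    (s := g.support) (g := fun d => frobLift k p r n m (monomial d (g.coeff d)))
    (support_nonempty.mpr hne)
    (fun d hd => (degree_frobLift_monomial p hm d (mem_support_iff.mp hd)).1) ?_ ?_
  · intro d hd e he hde
    have hcop : Nat.Coprime (p ^ r) m := (hp.coprime_iff_not_dvd.mpr hpm).pow_left r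
    have key : ∀ i, d (Sum.inl i) = e (Sum.inl i) ∧ d (Sum.inr i) = e (Sum.inr i) := by
      intro i
      have h1 := DFunLike.congr_fun hde i
      simp only [(degree_frobLift_monomial p hm _ (mem_support_iff.mp hd)).2,
        (degree_frobLift_monomial p hm _ (mem_support_iff.mp he)).2] at h1
      have h2 : m * d (Sum.inr i) ≡ m * e (Sum.inr i) [MOD p ^ r] := by
        have h3 : p ^ r * d (Sum.inl i) + m * d (Sum.inr i) ≡
          p ^ r * e (Sum.inl i) + m * e (Sum.inr i) [MOD p ^ r] := by rw [h1]
        simpa [Nat.ModEq, Nat.mul_add_mod] using h3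
      have h4 : d (Sum.inr i) = e (Sum.inr i) :=
        (Nat.ModEq.cancel_left_of_coprime hcop h2).eq_of_lt_of_lt (hg' d hd i) (hg' e he i)
      refine ⟨?_, h4⟩
      rw [h4] at h1
      exact Nat.eq_of_mul_eq_mul_left (pow_pos hp.pos r) (by lia)
    ext (i | i)
    exacts [(key i).1, (key i).2]
  · rw [← map_sum, ← g.as_sum, hg0]

theorem isDomain_curvePowerRing (hm : 0 < m) (hpm : ¬ p ∣ m) :
    IsDomain (CurvePowerRing k n m (p ^ r)) := by
  have : (curvePowerIdeal k n m (p ^ r)).IsPrime := by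
    rw [← ker_frobLift p hm hpm]
    exact RingHom.ker_isPrime _
  exact Ideal.Quotient.isDomain _

/-- A field `F` is the function field of the `n`-th fibre power of the curve `u ^ q = x ^ m + t`
over `k(t)`, with coordinate functions `xᵢ` and `uᵢ`. -/
structure IsCurvePowerField (k : Type u) [Field k] {F : Type u} [Field F] [Algebra (RatFunc k) F]
    {n : ℕ} (m q : ℕ) (x u : Fin n → F) : Prop where
  rel : ∀ i, u i ^ q = x i ^ m + algebraMap (RatFunc k) F RatFunc.X
  indep : AlgebraicIndependent (RatFunc k) x
  gen : IntermediateField.adjoin (RatFunc k) (Set.range x ∪ Set.range u) = ⊤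

variable (k n m) in
/-- The rational function `uᵢ` on `Gⁿ`. -/
noncomputable def uCoord (q : ℕ) (i : Fin n) : CurvePowerField k n m q :=
  algebraMap (CurvePowerRing k n m q) _
    (Ideal.Quotient.mk (curvePowerIdeal k n m q) (X (Sum.inr i)))

theorem isCurvePowerField_curvePowerField [IsDomain (CurvePowerRing k n m (p ^ r))]
    (hm : 0 < m) (hpm : ¬ p ∣ m) :
    IsCurvePowerField k m (p ^ r) (xCoord k n m (p ^ r)) (uCoord k n m (p ^ r)) := by
  have haeval : ∀ f : MvPolynomial (Fin n ⊕ Fin n) (RatFunc k),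
      algebraMap (CurvePowerRing k n m (p ^ r)) (CurvePowerField k n m (p ^ r))
        (Ideal.Quotient.mk _ f) = aeval (Sum.elim (xCoord k n m (p ^ r)) (uCoord k n m (p ^ r))) f := by
    intro f
    let φ : MvPolynomial (Fin n ⊕ Fin n) (RatFunc k) →ₐ[RatFunc k] CurvePowerField k n m (p ^ r) :=
      (IsScalarTower.toAlgHom (RatFunc k) (CurvePowerRing k n m (p ^ r)) _).comp
        (Ideal.Quotient.mkₐ (RatFunc k) _)
    have : φ = aeval (Sum.elim (xCoord k n m (p ^ r)) (uCoord k n m (p ^ r))) := by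
      ext (i | i) <;> simp [φ, xCoord, uCoord]
    exact DFunLike.congr_fun this f
  refine ⟨fun i => ?_, ?_, ?_⟩
  · have h1 : Ideal.Quotient.mk (curvePowerIdeal k n m (p ^ r)) (X (Sum.inr i) ^ p ^ r -
        (X (Sum.inl i) ^ m + C RatFunc.X)) = 0 :=
      Ideal.Quotient.eq_zero_iff_mem.mpr (Ideal.subset_span ⟨i, rfl⟩)
    have h2 := haeval (X (Sum.inr i) ^ p ^ r - (X (Sum.inl i) ^ m + C RatFunc.X))
    rw [h1, map_zero] at h2
    simp only [map_sub, map_add, map_pow, aeval_X, aeval_C, Sum.elim_inl, Sum.elim_inr] at h2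
    exact sub_eq_zero.mp h2.symm
  · rw [algebraicIndependent_iff]
    intro f hf
    have h1 := haeval (rename Sum.inl f)
    rw [aeval_rename, Sum.elim_comp_inl, hf, FaithfulSMul.algebraMap_eq_zero_iff,
      Ideal.Quotient.eq_zero_iff_mem, ← ker_frobLift p hm hpm, RingHom.mem_ker] at h1
    -- On polynomials in the xᵢ alone, `frobLift` is the q-th power map, which is injective.
    have h2 : (frobLift k p r n m).comp (rename Sum.inl).toRingHom =
        iterateFrobenius (MvPolynomial (Fin n) (RatFunc k)) p r := by
      refine ringHom_ext (fun c => ?_) fun i => ?_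
      · simp [frobLift, iterateFrobenius_def]
      · simp [frobLift, iterateFrobenius_def]
    have h3 : iterateFrobenius (MvPolynomial (Fin n) (RatFunc k)) p r f = 0 := by
      rw [← h2]; exact h1
    rw [iterateFrobenius_def] at h3
    exact eq_zero_of_pow_eq_zero h3
  · rw [eq_top_iff]
    rintro y -
    obtain ⟨a, b, hb, rfl⟩ := IsFractionRing.div_surjective (A := CurvePowerRing k n m (p ^ r)) y
    have key : ∀ a, algebraMap (CurvePowerRing k n m (p ^ r)) (CurvePowerField k n m (p ^ r)) a ∈
        IntermediateField.adjoin (RatFunc k) (Set.range (xCoord k n m (p ^ r)) ∪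
          Set.range (uCoord k n m (p ^ r))) := by
      intro a
      obtain ⟨f, rfl⟩ := Ideal.Quotient.mk_surjective a
      rw [haeval]
      have h1 := IntermediateField.algebra_adjoin_le_adjoin (RatFunc k)
        (Set.range (xCoord k n m (p ^ r)) ∪ Set.range (uCoord k n m (p ^ r)))
      apply h1
      rw [← Set.Sum.elim_range, Algebra.adjoin_range_eq_range_aeval]
      exact ⟨f, rfl⟩
    exact div_mem (key a) (key b)

end FanoCover


/-! ### Powers of an element that is not a `p`-th power -/

section Independence

open Polynomial

/-- Independence of 1, θ, …, θ ^ (q - 1) over the q-th powers. For α with α ^ q = θ, the sum ∑ gₑ ^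
q θ ^ e is the q-th power of G(α). The minimal polynomial of α is X ^ (p ^ s) - y, and s < r would
make θ a p-th power. -/
theorem Polynomial.eq_zero_of_eval₂_iterateFrobenius_eq_zero {F : Type*} [Field F] (p : ℕ)
    [Fact p.Prime] [CharP F p] (r : ℕ) {θ : F} (hθ : ∀ b : F, b ^ p ≠ θ) {G : F[X]}
    (hG : G.degree < (p ^ r : ℕ)) (h : G.eval₂ (iterateFrobenius F p r) θ = 0) : G = 0 := by
  have hp : p.Prime := Fact.out
  obtain ⟨α, hα⟩ := IsAlgClosed.exists_pow_nat_eq (algebraMap F (AlgebraicClosure F) θ)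
    (pow_pos hp.pos r)
  have hroot : aeval α G = 0 := by
    have h1 : (aeval α G) ^ p ^ r = 0 := by
      have h2 : (aeval α G) ^ p ^ r = eval₂ ((iterateFrobenius (AlgebraicClosure F) p r).comp
          (algebraMap F _)) (α ^ p ^ r) G := by
        rw [aeval_def, ← iterateFrobenius_def, hom_eval₂, iterateFrobenius_def]
      rw [h2, hα, ← RingHom.iterateFrobenius_comm, ← hom_eval₂, h, map_zero]
    exact eq_zero_of_pow_eq_zero h1
  have : IsPurelyInseparable F (IntermediateField.adjoin F {α}) :=
    (IntermediateField.isPurelyInseparable_adjoin_simple_iff_pow_mem F _ p).mpr ⟨r, θ, hα.symm⟩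
  obtain ⟨s, y, hy⟩ := IsPurelyInseparable.minpoly_eq_X_pow_sub_C F p
    (IntermediateField.AdjoinSimple.gen F α)
  rw [IntermediateField.minpoly_gen] at hy
  have hys : α ^ p ^ s = algebraMap F _ y := by
    have := minpoly.aeval F α
    rw [hy] at this
    simpa [sub_eq_zero] using this
  by_contra hG0
  have hdeg := minpoly.degree_le_of_ne_zero F α hG0 hroot
  rw [hy, degree_X_pow_sub_C (pow_pos hp.pos s)] at hdeg
  have hlt : s < r := by
    have := hdeg.trans_lt hG
    exact (Nat.pow_lt_pow_iff_right hp.one_lt).mp (by exact_mod_cast this)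
  refine hθ (y ^ p ^ (r - s - 1)) ((algebraMap F (AlgebraicClosure F)).injective ?_)
  rw [← hα, map_pow, map_pow, ← hys, ← pow_mul, ← pow_mul, ← pow_succ, ← pow_add]
  congr 2
  lia

/-- A subring that contains `θ` and the elements of the form `∑ θ ^ e * gₑ ^ q` with `gₑ ∈ B`. -/
noncomputable def frobeniusAdjoin {F : Type*} [Field F] (p : ℕ) [Fact p.Prime] [CharP F p] (r : ℕ)
    (B : Subring F) (θ : F) : Subring F :=
  (eval₂RingHom ((iterateFrobenius F p r).comp B.subtype) θ).range

section

variable {F : Type*} [Field F] (p : ℕ) [Fact p.Prime] [CharP F p] (r : ℕ) {B : Subring F} {θ : F}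

theorem self_mem_frobeniusAdjoin : θ ∈ frobeniusAdjoin p r B θ :=
  ⟨X, by simp⟩

theorem pow_mem_frobeniusAdjoin {b : F} (hb : b ∈ B) : b ^ p ^ r ∈ frobeniusAdjoin p r B θ :=
  ⟨C ⟨b, hb⟩, by simp [iterateFrobenius_def]⟩

theorem frobeniusAdjoin_le (hθ : θ ∈ B) : frobeniusAdjoin p r B θ ≤ B := by
  rintro _ ⟨G, rfl⟩
  rw [coe_eval₂RingHom, eval₂_eq_sum]
  refine Subring.sum_mem _ fun i _ => B.mul_mem ?_ (B.pow_mem hθ _)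
  simpa [iterateFrobenius_def] using B.pow_mem (G.coeff i).2 _

/-- Dividing by X ^ q - θ, which evaluates to 0 here because its coefficients are raised to the q-th
power, gives b ^ q = ∑ θ ^ e gₑ ^ q with e < q and gₑ ∈ B. By independence b = g₀. -/
theorem mem_of_pow_mem_frobeniusAdjoin (hθB : θ ∈ B) (hθ : ∀ b : F, b ^ p ≠ θ) {b : F}
    (hb : b ^ p ^ r ∈ frobeniusAdjoin p r B θ) : b ∈ B := by
  have hp : p.Prime := Fact.out
  obtain ⟨G, hG⟩ := hb
  let P : B[X] := X ^ p ^ r - C ⟨θ, hθB⟩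
  have hP : P.Monic := monic_X_pow_sub_C _ (pow_pos hp.pos r).ne'
  have hdegP : P.degree = (p ^ r : ℕ) := degree_X_pow_sub_C (pow_pos hp.pos r) _
  have h1 : eval₂ ((iterateFrobenius F p r).comp B.subtype) θ (G %ₘ P) = b ^ p ^ r := by
    rw [← hG]
    conv_rhs => rw [← modByMonic_add_div G P]
    simp [P, iterateFrobenius_def]
  set H := (G %ₘ P).map B.subtype - C b with hH
  have hH0 : H = 0 := by
    refine Polynomial.eq_zero_of_eval₂_iterateFrobenius_eq_zero p r hθ ?_ ?_
    · refine (degree_sub_le _ _).trans_lt (max_lt ?_ ?_)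
      · exact (degree_map_le).trans_lt (hdegP ▸ degree_modByMonic_lt _ hP)
      · exact (degree_C_le).trans_lt (by exact_mod_cast pow_pos hp.pos r)
    · rw [hH, eval₂_sub, eval₂_map, h1, eval₂_C, iterateFrobenius_def, sub_self]
  have h2 := congrArg (fun f => coeff f 0) hH0
  simp only [hH, coeff_sub, coeff_map, coeff_C_zero, coeff_zero, sub_eq_zero] at h2
  rw [← h2]
  exact Subtype.property _

theorem inv_mem_frobeniusAdjoin {a : F} (ha : a ∈ frobeniusAdjoin p r B θ) (ha' : a⁻¹ ∈ B) :
    a⁻¹ ∈ frobeniusAdjoin p r B θ := by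
  have hp : p.Prime := Fact.out
  rcases eq_or_ne a 0 with rfl | h0
  · simp
  -- Only the q-th power of the inverse is needed in addition to a itself.
  have : a⁻¹ = a ^ (p ^ r - 1) * a⁻¹ ^ p ^ r := by
    obtain ⟨e, he⟩ := Nat.exists_eq_succ_of_ne_zero (pow_pos hp.pos r).ne'
    rw [he, Nat.succ_sub_one, pow_succ, ← mul_assoc, inv_pow, mul_inv_cancel₀ (pow_ne_zero _ h0),
      one_mul]
  rw [this]
  exact mul_mem (pow_mem ha _) (pow_mem_frobeniusAdjoin p r ha')

theorem zpow_mem_frobeniusAdjoin {a : F} (ha : a ∈ frobeniusAdjoin p r B θ) (ha' : a⁻¹ ∈ B)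
    (e : ℤ) : a ^ e ∈ frobeniusAdjoin p r B θ := by
  obtain ⟨e, rfl | rfl⟩ := e.eq_nat_or_neg
  · rw [zpow_natCast]
    exact pow_mem ha e
  · rw [zpow_neg, ← inv_zpow, zpow_natCast]
    exact pow_mem (inv_mem_frobeniusAdjoin p r ha ha') e

/-- Bézout: a is a product of integral powers of a ^ m and a ^ q. -/
theorem mem_frobeniusAdjoin_of_pow_mem {a : F} {m : ℕ} (hm : m.Coprime (p ^ r))
    (ham : a ^ m ∈ frobeniusAdjoin p r B θ) (ha : a ∈ B) (ha' : a⁻¹ ∈ B) :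
    a ∈ frobeniusAdjoin p r B θ := by
  rcases eq_or_ne a 0 with rfl | h0
  · exact zero_mem _
  have h1 := Nat.gcd_eq_gcd_ab m (p ^ r)
  rw [hm.gcd_eq_one] at h1
  have h2 : a = (a ^ m) ^ (m.gcdA (p ^ r)) * (a ^ p ^ r) ^ (m.gcdB (p ^ r)) := by
    rw [← zpow_natCast, ← zpow_natCast, ← zpow_mul, ← zpow_mul, ← zpow_add₀ h0, ← h1]
    simp
  rw [h2]
  refine mul_mem (zpow_mem_frobeniusAdjoin p r ham ?_ _)
    (zpow_mem_frobeniusAdjoin p r (pow_mem_frobeniusAdjoin p r ha) ?_ _)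
  · rw [← inv_pow]
    exact pow_mem ha' _
  · rw [← inv_pow]
    exact pow_mem ha' _

end

end Independence

/-! ### The function field: q-th powers and transcendence degree -/

namespace FanoCover.IsCurvePowerField

open KaehlerDifferential

variable {k F : Type u} [Field k] [Field F] [Algebra (RatFunc k) F] {n m q : ℕ} {x u : Fin n → F}

theorem x_ne_zero (hF : IsCurvePowerField k m q x u) (i : Fin n) : x i ≠ 0 :=
  hF.indep.ne_zero i

theorem x_pow_ne (hF : IsCurvePowerField k m q x u) (hm : 0 < m) {i j : Fin n} (hij : i ≠ j) :
    x i ^ m ≠ x j ^ m := by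
  intro h
  have h1 : (MvPolynomial.X i ^ m - MvPolynomial.X j ^ m : MvPolynomial (Fin n) (RatFunc k)) = 0 :=
    hF.indep (by simp [h])
  have h2 := congrArg (MvPolynomial.eval (Pi.single i 1)) h1
  simp [hij.symm, hm.ne'] at h2

/-- The q-th power map is a ring homomorphism and sends uᵢ to xᵢ ^ m + t. -/
theorem pow_mem_adjoin (hF : IsCurvePowerField k m q x u) (p : ℕ) [Fact p.Prime] [CharP F p]
    {r : ℕ} (hq : q = p ^ r) (f : F) :
    f ^ q ∈ IntermediateField.adjoin (RatFunc k) (Set.range x) := by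
  have hf : f ∈ IntermediateField.adjoin (RatFunc k) (Set.range x ∪ Set.range u) :=
    hF.gen ▸ trivial
  have hx : ∀ i, x i ∈ IntermediateField.adjoin (RatFunc k) (Set.range x) :=
    fun i => IntermediateField.subset_adjoin _ _ ⟨i, rfl⟩
  induction hf using IntermediateField.adjoin_induction with
  | mem y hy =>
    rcases hy with ⟨i, rfl⟩ | ⟨i, rfl⟩
    · exact pow_mem (hx i) _
    · rw [hF.rel]
      exact add_mem (pow_mem (hx i) _) (IntermediateField.algebraMap_mem _ _)
  | algebraMap c => exact pow_mem (IntermediateField.algebraMap_mem _ _) _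
  | add a b _ _ ha hb =>
    rw [hq, add_pow_char_pow, ← hq]
    exact add_mem ha hb
  | inv a _ ha =>
    rw [inv_pow]
    exact inv_mem ha
  | mul a b _ _ ha hb =>
    rw [mul_pow]
    exact mul_mem ha hb

theorem essFiniteType_ratFunc (hF : IsCurvePowerField k m q x u) :
    Algebra.EssFiniteType (RatFunc k) F := by
  rw [← IntermediateField.fg_top_iff, ← hF.gen]
  exact IntermediateField.fg_adjoin_of_finite ((Set.finite_range x).union (Set.finite_range u))

theorem isAlgebraic_adjoin (hF : IsCurvePowerField k m q x u) (p : ℕ) [Fact p.Prime] [CharP F p]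
    {r : ℕ} (hq : q = p ^ r) {y : Fin n → F}
    (hy : IntermediateField.adjoin (RatFunc k) (Set.range x) ≤
      IntermediateField.adjoin (RatFunc k) (Set.range y)) :
    Algebra.IsAlgebraic (Algebra.adjoin (RatFunc k) (Set.range y)) F := by
  have hp : p.Prime := Fact.out
  refine ⟨fun f => ?_⟩
  obtain ⟨a, b, hab⟩ := (IntermediateField.mem_adjoin_range_iff _ _ _).mp
    (hy (hF.pow_mem_adjoin p hq f))
  have h1 : ∀ a : MvPolynomial (Fin n) (RatFunc k),
      IsAlgebraic (Algebra.adjoin (RatFunc k) (Set.range y)) (MvPolynomial.aeval y a) := fun a =>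
    isAlgebraic_algebraMap (R := Algebra.adjoin (RatFunc k) (Set.range y)) (A := F)
      ⟨_, Algebra.adjoin_range_eq_range_aeval (RatFunc k) y ▸ ⟨a, rfl⟩⟩
  refine IsAlgebraic.of_pow (n := q) (hq ▸ pow_pos hp.pos r) ?_
  rw [hab, div_eq_mul_inv]
  exact (h1 a).mul (h1 b).inv

theorem isTranscendenceBasis_x (hF : IsCurvePowerField k m q x u) (p : ℕ) [Fact p.Prime]
    [CharP F p] {r : ℕ} (hq : q = p ^ r) : IsTranscendenceBasis (RatFunc k) x :=
  hF.indep.isTranscendenceBasis_iff_isAlgebraic.mpr (hF.isAlgebraic_adjoin p hq le_rfl)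

theorem trdeg_ratFunc (hF : IsCurvePowerField k m q x u) (p : ℕ) [Fact p.Prime]
    [CharP F p] {r : ℕ} (hq : q = p ^ r) : Algebra.trdeg (RatFunc k) F = n := by
  have := (hF.isTranscendenceBasis_x p hq).lift_cardinalMk_eq_trdeg
  simpa using this.symm

end FanoCover.IsCurvePowerField

/-! ### The field k(t): transcendence degree and differentials -/

section RatFunc

variable (k : Type u) [Field k]

instance essFiniteType_ratFunc : Algebra.EssFiniteType k (RatFunc k) := by
  have := Algebra.EssFiniteType.of_isLocalization (RatFunc k) (nonZeroDivisors (Polynomial k))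
  exact Algebra.EssFiniteType.comp k (Polynomial k) (RatFunc k)

theorem RatFunc.trdeg_eq_one : Algebra.trdeg k (RatFunc k) = 1 := by
  have := IsLocalization.isAlgebraic (S := RatFunc k) (nonZeroDivisors (Polynomial k))
  have h1 := trdeg_add_eq k (Polynomial k) (A := RatFunc k)
  rw [Polynomial.trdeg_of_isDomain, trdeg_eq_zero, add_zero] at h1
  exact h1.symm

variable {k} {F : Type u} [Field F] [Algebra (RatFunc k) F] [Algebra k F]
  [IsScalarTower k (RatFunc k) F]

theorem algebraMap_ratFunc_polynomial (P : Polynomial k) :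
    algebraMap (RatFunc k) F (algebraMap (Polynomial k) (RatFunc k) P) =
      Polynomial.aeval (algebraMap (RatFunc k) F RatFunc.X) P := by
  have : (IsScalarTower.toAlgHom k (RatFunc k) F).comp
      (IsScalarTower.toAlgHom k (Polynomial k) (RatFunc k)) =
      Polynomial.aeval (algebraMap (RatFunc k) F RatFunc.X) := by
    ext
    simp
  exact DFunLike.congr_fun this P

theorem exists_D_algebraMap_ratFunc (c : RatFunc k) : ∃ c' : RatFunc k,
    KaehlerDifferential.D k F (algebraMap (RatFunc k) F c) =
      algebraMap (RatFunc k) F c' • KaehlerDifferential.D k F (algebraMap (RatFunc k) F RatFunc.X)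
    := by
  induction c using RatFunc.induction_on with
  | f a b hb =>
    refine ⟨(algebraMap _ (RatFunc k) b)⁻¹ ^ 2 * (algebraMap _ (RatFunc k) b *
      algebraMap _ (RatFunc k) a.derivative - algebraMap _ (RatFunc k) a *
      algebraMap _ (RatFunc k) b.derivative), ?_⟩
    rw [map_div₀, Derivation.leibniz_div]
    simp only [map_mul, map_pow, map_inv₀, map_sub, algebraMap_ratFunc_polynomial,
      Derivation.map_aeval, smul_smul, ← sub_smul]

end RatFunc

/-! ### Differentials of the function field over k -/

namespace FanoCover.IsCurvePowerField

open KaehlerDifferential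

variable {k F : Type u} [Field k] [Field F] [Algebra (RatFunc k) F] {n m q : ℕ} {x u : Fin n → F}
  [Algebra k F] [IsScalarTower k (RatFunc k) F]

theorem essFiniteType (hF : IsCurvePowerField k m q x u) : Algebra.EssFiniteType k F :=
  have := hF.essFiniteType_ratFunc
  Algebra.EssFiniteType.comp k (RatFunc k) F

theorem trdeg_eq (hF : IsCurvePowerField k m q x u) (p : ℕ) [Fact p.Prime]
    [CharP F p] {r : ℕ} (hq : q = p ^ r) : n + 1 = Cardinal.toNat (Algebra.trdeg k F) := by
  have h1 := trdeg_add_eq k (RatFunc k) (A := F)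
  rw [RatFunc.trdeg_eq_one, hF.trdeg_ratFunc p hq] at h1
  rw [← h1, add_comm]
  exact_mod_cast (Cardinal.toNat_natCast.{u} (1 + n)).symm

variable (k F) in
/-- The element `t` of an extension of `k(t)`. -/
noncomputable abbrev tCoord : F := algebraMap (RatFunc k) F RatFunc.X

theorem D_rel (hF : IsCurvePowerField k m q x u) (i : Fin n) :
    (q * u i ^ (q - 1)) • D k F (u i) = (m * x i ^ (m - 1)) • D k F (x i) + D k F (tCoord k F) := by
  have h1 := congrArg (D k F) (hF.rel i)
  rw [map_add, Derivation.leibniz_pow, Derivation.leibniz_pow] at h1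
  rw [mul_smul, mul_smul, Nat.cast_smul_eq_nsmul, Nat.cast_smul_eq_nsmul, h1]

/-- Since m is invertible, the differentiated relation expresses dxᵢ by duᵢ and dt. -/
theorem span_D_eq_top (hF : IsCurvePowerField k m q x u) (hm : (m : F) ≠ 0) :
    Submodule.span F (Set.range (Fin.cons (D k F (tCoord k F)) fun i => D k F (u i) :
      Fin (n + 1) → Ω[F⁄k])) = ⊤ := by
  set N := Submodule.span F (Set.range (Fin.cons (D k F (tCoord k F)) fun i => D k F (u i) :
      Fin (n + 1) → Ω[F⁄k])) with hN
  have ht : D k F (tCoord k F) ∈ N := Submodule.subset_span ⟨0, rfl⟩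
  have hu : ∀ i, D k F (u i) ∈ N := fun i => Submodule.subset_span ⟨i.succ, rfl⟩
  rw [eq_top_iff, ← KaehlerDifferential.span_range_derivation, Submodule.span_le]
  rintro _ ⟨f, rfl⟩
  have hf : f ∈ IntermediateField.adjoin (RatFunc k) (Set.range x ∪ Set.range u) :=
    hF.gen ▸ trivial
  induction hf using IntermediateField.adjoin_induction with
  | mem y hy =>
    rcases hy with ⟨i, rfl⟩ | ⟨i, rfl⟩
    · have h0 : (m * x i ^ (m - 1) : F) ≠ 0 := mul_ne_zero hm (pow_ne_zero _ (hF.x_ne_zero i))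
      have h1 : D k F (x i) = (m * x i ^ (m - 1) : F)⁻¹ • ((q * u i ^ (q - 1) : F) • D k F (u i) -
          D k F (tCoord k F)) := by
        rw [hF.D_rel, add_sub_cancel_right, smul_smul, inv_mul_cancel₀ h0, one_smul]
      rw [h1]
      exact N.smul_mem _ (N.sub_mem (N.smul_mem _ (hu i)) ht)
    · exact hu i
  | algebraMap c =>
    obtain ⟨c', hc⟩ := exists_D_algebraMap_ratFunc (F := F) c
    rw [hc]
    exact N.smul_mem _ ht
  | add a b _ _ ha hb =>
    rw [map_add]
    exact N.add_mem ha hb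
  | inv a _ ha =>
    rw [Derivation.leibniz_inv]
    exact N.smul_mem _ ha
  | mul a b _ _ ha hb =>
    rw [Derivation.leibniz]
    exact N.add_mem (N.smul_mem _ hb) (N.smul_mem _ ha)

theorem wedge_ne_zero [PerfectField k] (hF : IsCurvePowerField k m q x u) (hm : (m : F) ≠ 0)
    (h : n + 1 = Cardinal.toNat (Algebra.trdeg k F)) :
    wedge h (Fin.cons (D k F (tCoord k F)) fun i => D k F (u i)) ≠ 0 := by
  have := hF.essFiniteType
  exact wedge_ne_zero_of_span h (rank_kaehlerDifferential_of_perfectField k F)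
    (hF.span_D_eq_top hm).ge

end FanoCover.IsCurvePowerField


/-! ### The coordinate rings of the charts -/

theorem exists_algebraMap_eq_div_of_isIntegral {S F : Type*} [CommRing S] [IsDomain S]
    [IsIntegrallyClosed S] [Field F] [Algebra S F] [FaithfulSMul S F] {a b : S}
    (h : IsIntegral S (algebraMap S F a / algebraMap S F b)) :
    ∃ c, algebraMap S F c = algebraMap S F a / algebraMap S F b := by
  let φ : FractionRing S →ₐ[S] F := IsFractionRing.liftAlgHom (g := Algebra.ofId S F)
    (FaithfulSMul.algebraMap_injective S F)
  have h1 : φ (algebraMap S _ a / algebraMap S _ b) = algebraMap S F a / algebraMap S F b := by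
    rw [map_div₀, AlgHom.commutes, AlgHom.commutes]
  rw [← h1, isIntegral_algHom_iff φ φ.toRingHom.injective, IsIntegrallyClosed.isIntegral_iff] at h
  obtain ⟨y, hy⟩ := h
  exact ⟨y, by rw [← h1, ← hy, AlgHom.commutes]⟩

namespace FanoCover

section Charts

variable {K F : Type*} [Field K] [Field F] [Algebra K F] {n : ℕ}

/-- The homogeneous coordinates `[1 : x₁ : ⋯ : xₙ]`. -/
def homCoord (x : Fin n → F) : Fin (n + 1) → F := Fin.cons 1 x

@[simp] theorem homCoord_zero (x : Fin n → F) : homCoord x 0 = 1 := rfl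

@[simp] theorem homCoord_succ (x : Fin n → F) (i : Fin n) : homCoord x i.succ = x i := rfl

/-- The coordinate functions on the `j`-th standard chart of the projective space with
homogeneous coordinates `[1 : 1 / x₁ : ⋯ : 1 / xₙ]`. -/
def chartCoord (x : Fin n → F) (j : Fin (n + 1)) (i : Fin n) : F :=
  homCoord x j / homCoord x (j.succAbove i)

variable (K) in
/-- The coordinate ring of the `j`-th standard chart. -/
def chartAlgebra (x : Fin n → F) (j : Fin (n + 1)) : Subalgebra K F :=
  Algebra.adjoin K (Set.range (chartCoord x j))

theorem mem_chartAlgebra_iff {x : Fin n → F} {j : Fin (n + 1)} {a : F} :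
    a ∈ chartAlgebra K x j ↔ ∃ P : MvPolynomial (Fin n) K,
      MvPolynomial.aeval (chartCoord x j) P = a := by
  rw [chartAlgebra, Algebra.adjoin_range_eq_range_aeval, AlgHom.mem_range]

variable {x : Fin n → F} (hx : ∀ i, x i ≠ 0)
include hx

theorem homCoord_ne_zero (i : Fin (n + 1)) : homCoord x i ≠ 0 := by
  cases i using Fin.cases <;> simp [hx]

theorem homCoord_div_mem_chartAlgebra (j i : Fin (n + 1)) :
    homCoord x j / homCoord x i ∈ chartAlgebra K x j := by
  rcases eq_or_ne i j with rfl | hij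
  · rw [div_self (homCoord_ne_zero hx i)]
    exact one_mem _
  · obtain ⟨l, rfl⟩ := Fin.exists_succAbove_eq hij
    exact Algebra.subset_adjoin ⟨l, rfl⟩

theorem adjoin_le_adjoin_chartCoord (j : Fin (n + 1)) :
    IntermediateField.adjoin K (Set.range x) ≤
      IntermediateField.adjoin K (Set.range (chartCoord x j)) := by
  rw [IntermediateField.adjoin_le_iff]
  rintro _ ⟨i, rfl⟩
  have h1 : ∀ i, homCoord x j / homCoord x i ∈
      IntermediateField.adjoin K (Set.range (chartCoord x j)) := fun i =>
    IntermediateField.algebra_adjoin_le_adjoin K (Set.range (chartCoord x j))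
      (homCoord_div_mem_chartAlgebra (K := K) hx j i)
  have h2 := div_mem (h1 0) (h1 i.succ)
  have h3 : homCoord x j / homCoord x 0 / (homCoord x j / homCoord x i.succ) = x i := by
    have := homCoord_ne_zero hx j
    have := hx i
    rw [homCoord_zero, homCoord_succ]
    field_simp
  rwa [h3] at h2

end Charts

namespace IsCurvePowerField

variable {k F : Type u} [Field k] [Field F] [Algebra (RatFunc k) F] {n m q : ℕ} {x u : Fin n → F}
  (hF : IsCurvePowerField k m q x u) (p : ℕ) [Fact p.Prime] [CharP F p] {r : ℕ} (hq : q = p ^ r)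
include hF hq

theorem algebraicIndependent_chartCoord (j : Fin (n + 1)) :
    AlgebraicIndependent (RatFunc k) (chartCoord x j) := by
  have := hF.isAlgebraic_adjoin p hq (adjoin_le_adjoin_chartCoord (K := RatFunc k) hF.x_ne_zero j)
  refine (Algebra.IsAlgebraic.isTranscendenceBasis_of_lift_le_trdeg_of_finite (RatFunc k)
    (chartCoord x j) ?_).1
  rw [hF.trdeg_ratFunc p hq]
  simp

theorem isIntegrallyClosed_chartAlgebra (j : Fin (n + 1)) :
    IsIntegrallyClosed (chartAlgebra (RatFunc k) x j) :=
  .of_equiv (hF.algebraicIndependent_chartCoord p hq j).aevalEquiv.toRingEquiv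

/-- The power f ^ q lies in the fraction field of the chart ring and is integral over it, and the
chart ring is a polynomial ring, hence normal. -/
theorem pow_mem_chartAlgebra (j : Fin (n + 1)) {f : F}
    (hf : IsIntegral (chartAlgebra (RatFunc k) x j) f) : f ^ q ∈ chartAlgebra (RatFunc k) x j := by
  have := hF.isIntegrallyClosed_chartAlgebra p hq j
  have h1 := adjoin_le_adjoin_chartCoord hF.x_ne_zero j (hF.pow_mem_adjoin p hq f)
  rw [IntermediateField.mem_adjoin_iff_div] at h1
  obtain ⟨a, ha, b, hb, hab⟩ := h1
  have h2 := hf.pow q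
  obtain ⟨c, hc⟩ := exists_algebraMap_eq_div_of_isIntegral (S := chartAlgebra (RatFunc k) x j)
    (F := F) (a := ⟨a, ha⟩) (b := ⟨b, hb⟩) (by rw [hab] at h2; exact h2)
  rw [hab]
  exact hc ▸ c.2

/-- The coordinates are variables of a polynomial ring, hence prime. -/
theorem chartCoord_dvd_or_dvd (j : Fin (n + 1)) (i : Fin n) {a b c : F}
    (ha : a ∈ chartAlgebra (RatFunc k) x j) (hb : b ∈ chartAlgebra (RatFunc k) x j)
    (hc : c ∈ chartAlgebra (RatFunc k) x j) (h : a * b = chartCoord x j i * c) :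
    (∃ d ∈ chartAlgebra (RatFunc k) x j, a = chartCoord x j i * d) ∨
      ∃ d ∈ chartAlgebra (RatFunc k) x j, b = chartCoord x j i * d := by
  obtain ⟨a, rfl⟩ := mem_chartAlgebra_iff.mp ha
  obtain ⟨b, rfl⟩ := mem_chartAlgebra_iff.mp hb
  obtain ⟨c, rfl⟩ := mem_chartAlgebra_iff.mp hc
  have h1 : a * b = MvPolynomial.X i * c :=
    hF.algebraicIndependent_chartCoord p hq j (by simpa using h)
  rcases MvPolynomial.X_prime.dvd_or_dvd ⟨c, h1⟩ with ⟨d, rfl⟩ | ⟨d, rfl⟩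
  · exact .inl ⟨_, mem_chartAlgebra_iff.mpr ⟨d, rfl⟩, by simp⟩
  · exact .inr ⟨_, mem_chartAlgebra_iff.mpr ⟨d, rfl⟩, by simp⟩

theorem not_chartCoord_dvd_chartCoord (j : Fin (n + 1)) {i l : Fin n} (hil : l ≠ i) {d : F}
    (hd : d ∈ chartAlgebra (RatFunc k) x j) : chartCoord x j l ≠ chartCoord x j i * d := by
  obtain ⟨d, rfl⟩ := mem_chartAlgebra_iff.mp hd
  intro h
  have h1 : MvPolynomial.X l = MvPolynomial.X i * d :=
    hF.algebraicIndependent_chartCoord p hq j (by simpa using h)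
  have h2 := congrArg (MvPolynomial.eval (Pi.single l 1)) h1
  simp [hil.symm] at h2

theorem not_chartCoord_dvd_one_sub (hm : 0 < m) (j : Fin (n + 1)) (i l : Fin n) {d : F}
    (hd : d ∈ chartAlgebra (RatFunc k) x j) : 1 - chartCoord x j l ^ m ≠ chartCoord x j i * d := by
  obtain ⟨d, rfl⟩ := mem_chartAlgebra_iff.mp hd
  intro h
  have h1 : 1 - MvPolynomial.X l ^ m = MvPolynomial.X i * d :=
    hF.algebraicIndependent_chartCoord p hq j (by simpa using h)
  have h2 := congrArg (MvPolynomial.eval 0) h1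
  simp [hm.ne'] at h2

end IsCurvePowerField

/-- `R` is dominated by the localisation at a prime of an extension of `S` whose elements have
their `q`-th powers in `S`. -/
structure IsRootLocalization {F : Type u} [Field F] (S : Subring F) (q : ℕ) (R : Type u)
    [CommRing R] [IsDomain R] [IsDiscreteValuationRing R] [Algebra R F] [IsFractionRing R F] :
    Prop where
  mem : ∀ s ∈ S, ∃ r : R, algebraMap R F r = s
  exists_mul_eq : ∀ r : R, ∃ b d : F, d ∈ S ∧ b ^ q ∈ S ∧ d ≠ 0 ∧ dvrOrd R d = 0 ∧
    algebraMap R F r * d = b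

/-- The valuation of R lies over the prime divisor z = 0 of S, so it vanishes on elements of S that
the prime z does not divide. -/
theorem IsRootLocalization.dvrOrd_eq_zero {F : Type u} [Field F] {S : Subring F} {q : ℕ}
    {R : Type u} [CommRing R] [IsDomain R] [IsDiscreteValuationRing R] [Algebra R F]
    [IsFractionRing R F] (hR : IsRootLocalization S q R) (hq : 0 < q) {z a : F} (hz0 : z ≠ 0)
    (hzS : z ∈ S) (hz : ∀ a ∈ S, ∀ b ∈ S, ∀ c ∈ S, a * b = z * c →
      (∃ d ∈ S, a = z * d) ∨ ∃ d ∈ S, b = z * d)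
    (hzR : 0 < dvrOrd R z) (ha : a ∈ S) (haz : ∀ d ∈ S, a ≠ z * d) : dvrOrd R a = 0 := by
  have ha0 : a ≠ 0 := fun h => haz 0 S.zero_mem (by simp [h])
  have hpow : ∀ a ∈ S, (∀ d ∈ S, a ≠ z * d) → ∀ e : ℕ, ∀ d ∈ S, a ^ e ≠ z * d := by
    intro a ha haz e
    induction e with
    | zero =>
      intro d hd h
      obtain ⟨r, rfl⟩ := hR.mem d hd
      rw [pow_zero] at h
      have hr : algebraMap R F r ≠ 0 := fun h0 => by simp [h0] at h
      have h1 := congrArg (dvrOrd R) h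
      rw [dvrOrd_one, dvrOrd_mul hz0 hr] at h1
      have := dvrOrd_algebraMap_nonneg (F := F) r
      lia
    | succ e ih =>
      intro d hd h
      rw [pow_succ] at h
      rcases hz _ (S.pow_mem ha e) _ ha _ hd h with ⟨d, hd, h⟩ | ⟨d, hd, h⟩
      · exact ih d hd h
      · exact haz d hd h
  obtain ⟨r, hr⟩ := hR.mem a ha
  have hnn : 0 ≤ dvrOrd R a := hr ▸ dvrOrd_algebraMap_nonneg r
  by_contra hne
  obtain ⟨M, hM⟩ := Int.eq_ofNat_of_zero_le hzR.le
  obtain ⟨A, hA⟩ := Int.eq_ofNat_of_zero_le hnn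
  -- With M = ord z and A = ord a > 0, this quotient has order 0, hence lies in R. Clearing its
  -- denominator d and taking q-th powers gives a relation in S in which z divides a ^ (M q) · d ^
  -- q, although z divides neither a nor d.
  have hf0 : a ^ M / z ^ A ≠ 0 := div_ne_zero (pow_ne_zero _ ha0) (pow_ne_zero _ hz0)
  have hf : dvrOrd R (a ^ M / z ^ A) = 0 := by
    rw [dvrOrd_div (pow_ne_zero _ ha0) (pow_ne_zero _ hz0), dvrOrd_pow, dvrOrd_pow, hM, hA]
    ring
  obtain ⟨f, hf'⟩ := (exists_algebraMap_eq_iff hf0).mpr hf.ge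
  obtain ⟨b, d, hd, hb, hd0, hdR, hfd⟩ := hR.exists_mul_eq f
  have hzd : ∀ e ∈ S, d ≠ z * e := by
    rintro e he rfl
    obtain ⟨r, rfl⟩ := hR.mem e he
    have hr : algebraMap R F r ≠ 0 := fun h0 => by simp [h0] at hd0
    rw [dvrOrd_mul hz0 hr] at hdR
    have := dvrOrd_algebraMap_nonneg (F := F) r
    lia
  have h1 : (a ^ M) ^ q * d ^ q = z * (z ^ (A * q - 1) * b ^ q) := by
    have hAq : 0 < A * q := by
      have : 0 < A := by lia
      positivity
    rw [← hfd, hf', mul_pow, div_pow, ← mul_assoc, ← pow_succ', Nat.sub_add_cancel hAq, pow_mul]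
    field_simp
  rcases hz _ (S.pow_mem (S.pow_mem ha M) q) _ (S.pow_mem hd q) _
    (S.mul_mem (S.pow_mem hzS _) hb) h1 with ⟨e, he, h⟩ | ⟨e, he, h⟩
  · exact hpow a ha haz (M * q) e he (by rw [pow_mul]; exact h)
  · exact hpow d hd hzd q e he h

end FanoCover


/-! ### Functions whose differentials lie in a given module -/

section DiffSubring

open KaehlerDifferential

variable {k F R : Type u} [Field k] [Field F] [Algebra k F] [CommRing R] [Algebra R F]

/-- The subring of the elements of `R` (in the field `F`) whose differentials lie in `N`. -/
def diffSubring (N : Submodule R (Ω[F⁄k])) : Subring F where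
  carrier := {g | g ∈ (algebraMap R F).range ∧ D k F g ∈ N}
  mul_mem' := by
    rintro _ _ ⟨⟨a, rfl⟩, ha⟩ ⟨⟨b, rfl⟩, hb⟩
    refine ⟨mul_mem ⟨a, rfl⟩ ⟨b, rfl⟩, ?_⟩
    rw [Derivation.leibniz, algebraMap_smul, algebraMap_smul]
    exact N.add_mem (N.smul_mem _ hb) (N.smul_mem _ ha)
  one_mem' := ⟨one_mem _, by simp⟩
  add_mem' := by
    rintro _ _ ⟨ha, ha'⟩ ⟨hb, hb'⟩
    exact ⟨add_mem ha hb, by rw [map_add]; exact N.add_mem ha' hb'⟩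
  zero_mem' := ⟨zero_mem _, by simp⟩
  neg_mem' := by
    rintro _ ⟨ha, ha'⟩
    exact ⟨neg_mem ha, by rw [map_neg]; exact N.neg_mem ha'⟩

variable {N : Submodule R (Ω[F⁄k])}

theorem inv_mem_diffSubring {g : F} (hg : g ∈ diffSubring N) (hg' : g⁻¹ ∈ (algebraMap R F).range) :
    g⁻¹ ∈ diffSubring N := by
  refine ⟨hg', ?_⟩
  obtain ⟨a, ha⟩ := hg'
  rw [Derivation.leibniz_inv, ← ha, ← map_pow, ← map_neg, algebraMap_smul]
  exact N.smul_mem _ hg.2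

/-- For a unit g, dg = m⁻¹ g ^ (1 - m) d(g ^ m). -/
theorem mem_diffSubring_of_pow_mem {g : F} {m : ℕ} (hg : g ^ m ∈ diffSubring N)
    (hgR : g ∈ (algebraMap R F).range) (hg' : g⁻¹ ∈ (algebraMap R F).range)
    (hm : (m : F) ≠ 0) (hm' : (m : F)⁻¹ ∈ (algebraMap R F).range) : g ∈ diffSubring N := by
  refine ⟨hgR, ?_⟩
  rcases eq_or_ne g 0 with rfl | h0
  · simp
  obtain ⟨a, ha⟩ := mul_mem hm' (pow_mem hg' (m - 1))
  have h1 : D k F g = algebraMap R F a • D k F (g ^ m) := by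
    rw [Derivation.leibniz_pow, ← Nat.cast_smul_eq_nsmul F, ha, smul_smul, smul_smul]
    have : (m : F)⁻¹ * g⁻¹ ^ (m - 1) * m * g ^ (m - 1) = 1 := by
      rw [inv_pow]
      field_simp
    rw [this, one_smul]
  rw [h1, algebraMap_smul]
  exact N.smul_mem _ hg.2

theorem mem_range_algebraMap_iff [IsDomain R] [IsDiscreteValuationRing R] [IsFractionRing R F]
    {g : F} : g ∈ (algebraMap R F).range ↔ g = 0 ∨ 0 ≤ dvrOrd R g := by
  rcases eq_or_ne g 0 with rfl | h0
  · simp [zero_mem]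
  · simp only [h0, false_or, ← exists_algebraMap_eq_iff (R := R) h0, RingHom.mem_range]

theorem mem_range_of_pow_mem_range [IsDomain R] [IsDiscreteValuationRing R] [IsFractionRing R F]
    {g : F} {q : ℕ} (hq : 0 < q) (h : g ^ q ∈ (algebraMap R F).range) :
    g ∈ (algebraMap R F).range := by
  rw [mem_range_algebraMap_iff] at h ⊢
  rcases h with h | h
  · exact .inl (pow_eq_zero_iff hq.ne' |>.mp h)
  · rw [dvrOrd_pow] at h
    exact .inr (nonneg_of_mul_nonneg_right h (by exact_mod_cast hq))

/-- Elements of k are q-th powers of constants, whose differentials vanish; so t is the only element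
of k(t) to be checked. -/
theorem algebraMap_ratFunc_mem_frobeniusAdjoin [IsAlgClosed k] [Algebra (RatFunc k) F]
    [IsScalarTower k (RatFunc k) F] (p : ℕ) [Fact p.Prime] [CharP F p] (r : ℕ) {θ : F}
    (hθ : θ ∈ diffSubring N)
    (hK : ∀ c : RatFunc k, algebraMap (RatFunc k) F c ∈ (algebraMap R F).range)
    (ht : algebraMap (RatFunc k) F RatFunc.X ∈ frobeniusAdjoin p r (diffSubring N) θ)
    (c : RatFunc k) :
    algebraMap (RatFunc k) F c ∈ frobeniusAdjoin p r (diffSubring N) θ := by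
  have hp : p.Prime := Fact.out
  have hle := frobeniusAdjoin_le p r hθ
  have hk : ∀ a : k, algebraMap k F a ∈ frobeniusAdjoin p r (diffSubring N) θ := by
    intro a
    obtain ⟨b, rfl⟩ := IsAlgClosed.exists_pow_nat_eq a (pow_pos hp.pos r)
    rw [map_pow]
    refine pow_mem_frobeniusAdjoin p r ⟨?_, by simp⟩
    rw [IsScalarTower.algebraMap_apply k (RatFunc k) F]
    exact hK _
  have hpoly : ∀ P : Polynomial k, algebraMap (RatFunc k) F (algebraMap _ _ P) ∈
      frobeniusAdjoin p r (diffSubring N) θ := by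
    intro P
    rw [algebraMap_ratFunc_polynomial, Polynomial.aeval_eq_sum_range]
    refine sum_mem fun i _ => ?_
    rw [Algebra.smul_def]
    exact mul_mem (hk _) (pow_mem ht _)
  induction c using RatFunc.induction_on with
  | f a b hb =>
    rw [map_div₀, div_eq_mul_inv]
    refine mul_mem (hpoly a) (inv_mem_frobeniusAdjoin p r (hpoly b) ?_)
    refine inv_mem_diffSubring (hle (hpoly b)) ?_
    rw [← map_inv₀]
    exact hK _

/-- Each element of R is b / d with d a unit in S and b ^ q ∈ S. From b ^ q ∈ B ^ q[θ] one gets b ∈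
B, because dθ ≠ 0 prevents θ from being a p-th power. If r = 0, then b ∈ S ⊆ B already. -/
theorem FanoCover.IsRootLocalization.D_mem [IsDomain R] [IsDiscreteValuationRing R]
    [IsFractionRing R F] (p : ℕ) [Fact p.Prime] [CharP F p] {r : ℕ} {S : Subring F}
    (hR : IsRootLocalization S (p ^ r) R) {θ : F} (hθ : θ ∈ diffSubring N)
    (hθ' : r = 0 ∨ D k F θ ≠ 0) (hS : S ≤ frobeniusAdjoin p r (diffSubring N) θ) (a : R) :
    D k F (algebraMap R F a) ∈ N := by
  have hle := frobeniusAdjoin_le p r hθ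
  obtain ⟨b, d, hd, hb, hd0, hdR, h⟩ := hR.exists_mul_eq a
  have hdB : d⁻¹ ∈ diffSubring N := by
    refine inv_mem_diffSubring (hle (hS hd)) (mem_range_algebraMap_iff.mpr (.inr ?_))
    rw [dvrOrd_inv, hdR, neg_zero]
  have hbB : b ∈ diffSubring N := by
    rcases hθ' with rfl | hθ'
    · rw [pow_zero, pow_one] at hb
      exact hle (hS hb)
    · refine mem_of_pow_mem_frobeniusAdjoin p r hθ (fun c hc => hθ' ?_) (hS hb)
      rw [← hc, Derivation.leibniz_pow, ← Nat.cast_smul_eq_nsmul F, CharP.cast_eq_zero, zero_smul]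
  have h1 : algebraMap R F a = b * d⁻¹ := by rw [← h, mul_inv_cancel_right₀ hd0]
  rw [h1]
  exact (mul_mem hbB hdB).2

end DiffSubring

/-! ### Differentials of monomials in xᵢ and uᵢ -/

namespace FanoCover.IsCurvePowerField

open KaehlerDifferential

section

variable {k F R : Type u} [Field k] [Field F] [Algebra (RatFunc k) F] {n m q : ℕ} {x u : Fin n → F}
  (hF : IsCurvePowerField k m q x u)
include hF

theorem transcendental_x (i : Fin n) : Transcendental (RatFunc k) (x i) :=
  hF.indep.transcendental i

theorem u_ne_zero (hm : 0 < m) (hq : 0 < q) (i : Fin n) : u i ≠ 0 := by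
  intro h
  have h1 := hF.rel i
  rw [h, zero_pow hq.ne'] at h1
  refine hF.transcendental_x i ⟨Polynomial.X ^ m + Polynomial.C RatFunc.X, ?_, by simp [← h1]⟩
  exact Polynomial.X_pow_add_C_ne_zero hm _

end

variable {k F R : Type u} [Field k] [Field F] [Algebra (RatFunc k) F] {n m q : ℕ} {x u : Fin n → F}
  [Algebra k F] [IsScalarTower k (RatFunc k) F] [CommRing R] [IsDomain R]
  [IsDiscreteValuationRing R] [Algebra R F] [IsFractionRing R F]

/-- The exponents make the monomial a q-th root of 1 / xᵢ up to a unit when xᵢ has a pole. The terms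
with factor q vanish in F unless q = 1; keeping them treats both cases at once. -/
theorem D_monomial (hF : IsCurvePowerField k m q x u) (hm0 : 0 < m) (hm : (m : F) ≠ 0) (hq : 0 < q)
    {a b : ℤ} (hab : q * a + m * b = -1) (i : Fin n) :
    D k F (x i ^ a * u i ^ b) =
      (x i ^ a * u i ^ b * ((-1 + q * a * tCoord k F * (x i ^ m)⁻¹) / m) / u i) • D k F (u i) -
      (x i ^ a * u i ^ b * a * (x i ^ m)⁻¹ / m) • D k F (tCoord k F) := by
  have hx0 := hF.x_ne_zero i
  have hu0 := hF.u_ne_zero hm0 hq i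
  have h0 : (m * x i ^ (m - 1) : F) ≠ 0 := mul_ne_zero hm (pow_ne_zero _ hx0)
  have h1 : D k F (x i) = (m * x i ^ (m - 1) : F)⁻¹ • ((q * u i ^ (q - 1) : F) • D k F (u i) -
      D k F (tCoord k F)) := by
    rw [hF.D_rel, add_sub_cancel_right, smul_smul, inv_mul_cancel₀ h0, one_smul]
  have hxm : x i ^ (m - 1) = x i ^ m / x i := by
    rw [eq_div_iff hx0, ← pow_succ, Nat.sub_add_cancel hm0]
  have huq : u i ^ (q - 1) = (x i ^ m + tCoord k F) / u i := by
    rw [eq_div_iff hu0, ← pow_succ, Nat.sub_add_cancel hq, hF.rel]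
  have hab' : (q * a + m * b : F) = -1 := by exact_mod_cast congrArg (Int.cast : ℤ → F) hab
  have hX0 : x i ^ m ≠ 0 := pow_ne_zero _ hx0
  rw [Derivation.leibniz, Derivation.leibniz_zpow, Derivation.leibniz_zpow, h1, hxm, huq,
    ← hab', ← Int.cast_smul_eq_zsmul F, ← Int.cast_smul_eq_zsmul F, zpow_sub_one₀ hx0,
    zpow_sub_one₀ hu0]
  generalize x i ^ m = X at *
  generalize x i ^ a = A at *
  generalize u i ^ b = B at *
  match_scalars
  · field_simp
    ring
  · field_simp

end FanoCover.IsCurvePowerField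


/-! ### A parameter along a divisor where xᵢ has no zero -/

namespace FanoCover.IsCurvePowerField

open KaehlerDifferential

variable {k F R : Type u} [Field k] [Field F] [Algebra (RatFunc k) F] {n m q : ℕ} {x u : Fin n → F}
  [CommRing R] [IsDomain R] [IsDiscreteValuationRing R] [Algebra R F] [IsFractionRing R F]

section

variable (hK : ∀ c : RatFunc k, algebraMap (RatFunc k) F c ∈ (algebraMap R F).range)
include hK

theorem dvrOrd_algebraMap_ratFunc {c : RatFunc k} (hc : c ≠ 0) :
    dvrOrd R (algebraMap (RatFunc k) F c) = 0 := by
  have h0 : algebraMap (RatFunc k) F c ≠ 0 := by simpa using hc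
  have h1 := (mem_range_algebraMap_iff.mp (hK c)).resolve_left h0
  have h2 := (mem_range_algebraMap_iff.mp (hK c⁻¹)).resolve_left (by simpa using hc)
  rw [map_inv₀, dvrOrd_inv] at h2
  lia

theorem dvrOrd_natCast {m : ℕ} (hm : (m : F) ≠ 0) : dvrOrd R (m : F) = 0 := by
  have h := dvrOrd_algebraMap_ratFunc (R := R) hK (c := (m : RatFunc k))
    (fun h => hm (by rw [← map_natCast (algebraMap (RatFunc k) F), h, map_zero]))
  rwa [map_natCast] at h

variable (hF : IsCurvePowerField k m q x u) (p : ℕ) [hp : Fact p.Prime] [CharP F p] {r : ℕ}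
  (hq : q = p ^ r) (hm : 0 < m) (hpm : ¬ p ∣ m)
include hF hq hm hpm

variable [Algebra k F] [IsScalarTower k (RatFunc k) F]

/-- A regular parameter along a divisor on which `xᵢ` has no zero. -/
theorem exists_parameter {i : Fin n} (hxi : dvrOrd R (x i) ≤ 0) :
    ∃ (ρ : R) (c e : F), c ≠ 0 ∧ q * dvrOrd R c = (m + 1) * dvrOrd R (x i) ∧
      D k F (u i) = c • D k F (algebraMap R F ρ) + e • D k F (tCoord k F) ∧
      ∀ N : Submodule R (Ω[F⁄k]), tCoord k F ∈ diffSubring N → algebraMap R F ρ ∈ diffSubring N →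
        (x i)⁻¹ ∈ frobeniusAdjoin p r (diffSubring N) (tCoord k F) := by
  have hq0 : 0 < q := hq ▸ pow_pos hp.out.pos r
  have hmF : (m : F) ≠ 0 := by rwa [Ne, CharP.cast_eq_zero_iff F p]
  have hcop : m.Coprime (p ^ r) :=
    Nat.Coprime.pow_right r ((hp.out.coprime_iff_not_dvd.mpr hpm).symm)
  have hx0 := hF.x_ne_zero i
  have hu0 := hF.u_ne_zero hm hq0 i
  have ht0 : tCoord k F ≠ 0 := by simpa using RatFunc.X_ne_zero
  have ht := dvrOrd_algebraMap_ratFunc (R := R) hK (c := RatFunc.X) RatFunc.X_ne_zero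
  have hmO := dvrOrd_natCast (R := R) hK hmF
  have hmR : (m : F)⁻¹ ∈ (algebraMap R F).range :=
    mem_range_algebraMap_iff.mpr (.inr (by rw [dvrOrd_inv, hmO, neg_zero]))
  rcases hxi.eq_or_lt with hxi | hxi
  -- If xᵢ is a unit, uᵢ itself is the parameter.
  · have hxR : x i ∈ (algebraMap R F).range := mem_range_algebraMap_iff.mpr (.inr hxi.ge)
    have hxR' : (x i)⁻¹ ∈ (algebraMap R F).range :=
      mem_range_algebraMap_iff.mpr (.inr (by rw [dvrOrd_inv, hxi, neg_zero]))
    have huR : u i ∈ (algebraMap R F).range :=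
      mem_range_of_pow_mem_range hq0 (by rw [hF.rel]; exact add_mem (pow_mem hxR m) (hK _))
    obtain ⟨ρ, hρ⟩ := huR
    refine ⟨ρ, 1, 0, one_ne_zero, by rw [dvrOrd_one, hxi]; simp, by simp [hρ], ?_⟩
    intro N htN hρN
    have hxm : x i ^ m ∈ frobeniusAdjoin p r (diffSubring N) (tCoord k F) := by
      have : x i ^ m = u i ^ p ^ r - tCoord k F := by rw [← hq, hF.rel, add_sub_cancel_right]
      rw [this, ← hρ]
      exact sub_mem (pow_mem_frobeniusAdjoin p r hρN) (self_mem_frobeniusAdjoin p r)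
    have hxN : x i ∈ diffSubring N :=
      mem_diffSubring_of_pow_mem (frobeniusAdjoin_le p r htN hxm) hxR hxR' hmF hmR
    have hxN' := inv_mem_diffSubring hxN hxR'
    exact inv_mem_frobeniusAdjoin p r (mem_frobeniusAdjoin_of_pow_mem p r hcop hxm hxN hxN') hxN'
  · set t := tCoord k F with ht_def
    -- If xᵢ has a pole, the parameter is s = xᵢ ^ a uᵢ ^ b. With uᵢ ^ q = xᵢ ^ m h and h = 1 + t xᵢ
    -- ^ (-m) a unit, s ^ q = xᵢ⁻¹ h ^ b.
    obtain ⟨a, b, hab⟩ : ∃ a b : ℤ, q * a + m * b = -1 := by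
      have h1 := Nat.gcd_eq_gcd_ab m (p ^ r)
      rw [hcop.gcd_eq_one, ← hq] at h1
      exact ⟨-m.gcdB q, -m.gcdA q, by push_cast at h1; linarith⟩
    have hX0 : x i ^ m ≠ 0 := pow_ne_zero _ hx0
    have htx : dvrOrd R (t * (x i ^ m)⁻¹) = -m * dvrOrd R (x i) := by
      rw [dvrOrd_mul ht0 (inv_ne_zero hX0), ht, dvrOrd_inv, dvrOrd_pow]
      ring
    have htx' : 0 < dvrOrd R (t * (x i ^ m)⁻¹) := by
      rw [htx]
      have : (0 : ℤ) < m := by exact_mod_cast hm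
      nlinarith
    obtain ⟨hh0, hh⟩ := dvrOrd_add_of_lt (R := R) (f := (1 : F)) one_ne_zero
      (g := t * (x i ^ m)⁻¹) (.inr (by rwa [dvrOrd_one]))
    rw [dvrOrd_one] at hh
    set h := 1 + t * (x i ^ m)⁻¹ with hh_def
    have hu : u i ^ q = x i ^ m * h := by
      rw [hF.rel, hh_def]
      field_simp
      rfl
    have huo : q * dvrOrd R (u i) = m * dvrOrd R (x i) := by
      rw [← dvrOrd_pow, hu, dvrOrd_mul hX0 hh0, hh, dvrOrd_pow, add_zero]
    set s := x i ^ a * u i ^ b with hs_def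
    have hs0 : s ≠ 0 := mul_ne_zero (zpow_ne_zero _ hx0) (zpow_ne_zero _ hu0)
    have hsq : s ^ q = (x i)⁻¹ * h ^ b := by
      have e1 : s ^ q = (x i ^ (q : ℤ)) ^ a * (u i ^ q) ^ b := by
        rw [hs_def, mul_pow, ← zpow_natCast, ← zpow_natCast, ← zpow_natCast, ← zpow_mul,
          ← zpow_mul, ← zpow_mul, ← zpow_mul, mul_comm a, mul_comm b]
      rw [e1, hu, mul_zpow, ← zpow_natCast (x i) m, ← zpow_mul, ← zpow_mul, ← mul_assoc,
        ← zpow_add₀ hx0, hab, zpow_neg_one]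
    have hso : q * dvrOrd R s = - dvrOrd R (x i) := by
      rw [← dvrOrd_pow, hsq, dvrOrd_mul (inv_ne_zero hx0) (zpow_ne_zero _ hh0), dvrOrd_zpow, hh,
        dvrOrd_inv, mul_zero, add_zero]
    have hqZ : (0 : ℤ) < q := by exact_mod_cast hq0
    have hsR : s ∈ (algebraMap R F).range := by
      refine mem_range_of_pow_mem_range hq0 (mem_range_algebraMap_iff.mpr (.inr ?_))
      rw [dvrOrd_pow, hso]
      lia
    -- A unit, because t xᵢ ^ (-m) has positive order; ds = (s ε / uᵢ) duᵢ modulo dt, so the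
    -- coefficient c has order ord uᵢ - ord s.
    set ε : F := (-1 + q * a * t * (x i ^ m)⁻¹) / m with hε_def
    have hε : ε ≠ 0 ∧ dvrOrd R ε = 0 := by
      obtain ⟨e1, e2⟩ := dvrOrd_add_of_lt (R := R) (f := (-1 : F)) (by simp)
        (g := q * a * t * (x i ^ m)⁻¹) (by
          by_cases hqa : (q * a : F) = 0
          · left
            rw [hqa, zero_mul, zero_mul]
          · right
            rw [dvrOrd_neg, dvrOrd_one, mul_assoc (q * a : F), dvrOrd_mul hqa
              (mul_ne_zero ht0 (inv_ne_zero hX0))]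
            have : 0 ≤ dvrOrd R (q * a : F) := by
              have := dvrOrd_algebraMap_nonneg (R := R) (F := F) (q * a)
              simpa using this
            lia)
      rw [dvrOrd_neg, dvrOrd_one] at e2
      refine ⟨div_ne_zero e1 hmF, ?_⟩
      rw [hε_def, dvrOrd_div e1 hmF, e2, hmO, sub_zero]
    have hDs : D k F s = (s * ε / u i) • D k F (u i) - (s * a * (x i ^ m)⁻¹ / m) • D k F t :=
      hF.D_monomial hm hmF hq0 hab i
    obtain ⟨ρ, hρ⟩ := hsR
    have hDu : D k F (u i) = (u i / (s * ε)) • D k F s +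
        (u i / ε * a * (x i ^ m)⁻¹ / m) • D k F t := by
      rw [hDs]
      have := hε.1
      match_scalars
      · field_simp
      · field_simp
        ring
    refine ⟨ρ, u i / (s * ε), u i / ε * a * (x i ^ m)⁻¹ / m, ?_, ?_, by rw [hρ]; exact hDu, ?_⟩
    · exact div_ne_zero hu0 (mul_ne_zero hs0 hε.1)
    · rw [dvrOrd_div hu0 (mul_ne_zero hs0 hε.1), dvrOrd_mul hs0 hε.1, hε.2]
      linarith
    · intro N htN hρN
      rw [hρ] at hρN
      -- The coefficients of ds and dt in d(uᵢ⁻¹) are regular because ord uᵢ⁻¹ ≥ ord s. Hence h⁻¹ =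
      -- 1 - t uᵢ ^ (-q) lies in B ^ q[t], and so does 1 / xᵢ = s ^ q h ^ (-b).
      have huinv : (u i)⁻¹ ∈ diffSubring N := by
        have hle : 0 ≤ dvrOrd R (u i)⁻¹ - dvrOrd R s := by
          rw [dvrOrd_inv]
          refine nonneg_of_mul_nonneg_right (a := (q : ℤ)) ?_ hqZ
          rw [mul_sub, mul_neg, huo, hso]
          have : (1 : ℤ) ≤ m := by exact_mod_cast hm
          nlinarith
        have hs' : 0 ≤ dvrOrd R s := by
          rw [← hρ]
          exact dvrOrd_algebraMap_nonneg ρ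
        refine ⟨mem_range_algebraMap_iff.mpr (.inr (by lia)), ?_⟩
        have e1 : D k F (u i)⁻¹ = -(((u i)⁻¹ / (s * ε)) • D k F s +
            (a * ((u i)⁻¹ / ε * (x i ^ m)⁻¹ / m)) • D k F t) := by
          rw [Derivation.leibniz_inv, hDu]
          have := hε.1
          match_scalars
          · field_simp
          · field_simp
        have hxm : 0 ≤ dvrOrd R (x i ^ m)⁻¹ := by
          rw [dvrOrd_inv, dvrOrd_pow]
          have : (1 : ℤ) ≤ m := by exact_mod_cast hm
          nlinarith
        obtain ⟨c₁, hc₁⟩ : (u i)⁻¹ / (s * ε) ∈ (algebraMap R F).range := by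
          refine mem_range_algebraMap_iff.mpr (.inr ?_)
          rw [dvrOrd_div (inv_ne_zero hu0) (mul_ne_zero hs0 hε.1), dvrOrd_mul hs0 hε.1, hε.2]
          lia
        obtain ⟨c₂, hc₂⟩ : a * ((u i)⁻¹ / ε * (x i ^ m)⁻¹ / m) ∈ (algebraMap R F).range := by
          refine mul_mem (intCast_mem _ _) (mem_range_algebraMap_iff.mpr (.inr ?_))
          rw [dvrOrd_div (mul_ne_zero (div_ne_zero (inv_ne_zero hu0) hε.1) (inv_ne_zero hX0)) hmF,
            dvrOrd_mul (div_ne_zero (inv_ne_zero hu0) hε.1) (inv_ne_zero hX0),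
            dvrOrd_div (inv_ne_zero hu0) hε.1, hε.2, hmO]
          lia
        rw [e1, ← hc₁, ← hc₂, algebraMap_smul, algebraMap_smul]
        exact N.neg_mem (N.add_mem (N.smul_mem _ hρN.2) (N.smul_mem _ htN.2))
      have hhinv : h⁻¹ = 1 - t * (u i)⁻¹ ^ p ^ r := by
        rw [← hq, inv_pow, hu, hh_def]
        have : x i ^ m + t ≠ 0 := by
          rw [← hF.rel]
          exact pow_ne_zero _ hu0
        field_simp
        ring
      have hhR : h ∈ (algebraMap R F).range := mem_range_algebraMap_iff.mpr (.inr hh.ge)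
      have hhW : h⁻¹ ∈ frobeniusAdjoin p r (diffSubring N) t := by
        rw [hhinv]
        exact sub_mem (one_mem _) (mul_mem (self_mem_frobeniusAdjoin p r)
          (pow_mem_frobeniusAdjoin p r huinv))
      have hhB : (h⁻¹)⁻¹ ∈ diffSubring N :=
        inv_mem_diffSubring (frobeniusAdjoin_le p r htN hhW) (by rwa [inv_inv])
      have hy : (x i)⁻¹ = s ^ p ^ r * h⁻¹ ^ b := by
        rw [← hq, hsq, inv_zpow, mul_assoc, mul_inv_cancel₀ (zpow_ne_zero _ hh0), mul_one]
      rw [hy]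
      exact mul_mem (pow_mem_frobeniusAdjoin p r hρN) (zpow_mem_frobeniusAdjoin p r hhW hhB b)

end

end FanoCover.IsCurvePowerField


/-! ### Order of the volume form where no xᵢ vanishes -/

namespace FanoCover.IsCurvePowerField

open KaehlerDifferential

variable {k F R : Type u} [Field k] [Field F] [Algebra (RatFunc k) F] {n m q : ℕ} {x u : Fin n → F}
  [Algebra k F]

/-- The rational canonical form `dt ∧ du₁ ∧ ⋯ ∧ duₙ`. -/
noncomputable def volForm (h : n + 1 = Cardinal.toNat (Algebra.trdeg k F)) (u : Fin n → F) :
    RatForm k F :=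
  wedge h (Fin.cons (D k F (tCoord k F)) fun i => D k F (u i))

variable [IsScalarTower k (RatFunc k) F]

theorem D_tCoord_ne_zero [PerfectField k] (hF : IsCurvePowerField k m q x u) (hm : (m : F) ≠ 0)
    (h : n + 1 = Cardinal.toNat (Algebra.trdeg k F)) : D k F (tCoord k F) ≠ 0 := by
  intro h0
  refine hF.wedge_ne_zero hm h (AlternatingMap.map_coord_zero _ 0 ?_)
  simpa using h0

variable [CommRing R] [IsDomain R] [IsDiscreteValuationRing R] [Algebra R F] [IsFractionRing R F]
  (hK : ∀ c : RatFunc k, algebraMap (RatFunc k) F c ∈ (algebraMap R F).range)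
  (hF : IsCurvePowerField k m q x u) (p : ℕ) [hp : Fact p.Prime] [CharP F p] {r : ℕ}
  (hq : q = p ^ r) (hm : 0 < m) (hpm : ¬ p ∣ m)
  (h : n + 1 = Cardinal.toNat (Algebra.trdeg k F))
include hK hF hq hm hpm

/-- The entry dt absorbs the dt-parts of the duᵢ, so only the product of the coefficients from
`exists_parameter` remains. -/
theorem exists_frame_of_nonpos (hx : ∀ i, dvrOrd R (x i) ≤ 0) :
    ∃ (a : Fin (n + 1) → R) (f : F), algebraMap R F (a 0) = tCoord k F ∧ f ≠ 0 ∧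
      q * dvrOrd R f = (m + 1) * ∑ i, dvrOrd R (x i) ∧
      volForm h u = f • wedge h (fun i => D k F (algebraMap R F (a i))) ∧
      ∀ N : Submodule R (Ω[F⁄k]), (∀ i, algebraMap R F (a i) ∈ diffSubring N) →
        ∀ i, (x i)⁻¹ ∈ frobeniusAdjoin p r (diffSubring N) (tCoord k F) := by
  choose ρ c e hc hco hD hN using fun i => exists_parameter hK hF p hq hm hpm (hx i)
  obtain ⟨t, ht⟩ := hK RatFunc.X
  refine ⟨Fin.cons t ρ, ∏ i, c i, ht, Finset.prod_ne_zero_iff.mpr fun i _ => hc i, ?_, ?_, ?_⟩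
  · rw [dvrOrd_prod _ _ fun i _ => hc i, Finset.mul_sum, Finset.mul_sum]
    exact Finset.sum_congr rfl fun i _ => hco i
  · have h1 := AlternatingMap.map_add_smul_pivot (wedge h) (fun i => (Fin.cons 1 c : _ → F) i •
      D k F (algebraMap R F ((Fin.cons t ρ : _ → R) i))) (Fin.cons 0 e) 0 rfl
    have h2 : (∏ i, (Fin.cons 1 c : Fin (n + 1) → F) i) = ∏ i, c i := by
      simp [Fin.prod_univ_succ]
    rw [wedge_smul, h2] at h1
    rw [← h1, volForm]
    congr 1
    ext i
    cases i using Fin.cases with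
    | zero => simp [ht]
    | succ i => simp [ht, hD]
  · intro N ha i
    exact hN i N (by simpa [ht] using ha 0) (by simpa using ha i.succ)

/-- For a divisor over Y the parameters are regular but need not generate the differentials, hence
only an inequality. -/
theorem exists_isFormEquation_of_nonpos [PerfectField k] [Algebra k R] [IsScalarTower k R F]
    [Algebra.EssFiniteType k R] (hx : ∀ i, dvrOrd R (x i) ≤ 0) :
    ∃ f, IsFormEquation k R (volForm h u) f ∧
      (m + 1) * ∑ i, dvrOrd R (x i) ≤ q * dvrOrd R f := by
  have hmF : (m : F) ≠ 0 := by rwa [Ne, CharP.cast_eq_zero_iff F p]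
  obtain ⟨a, f, -, hf0, hf, hw, -⟩ := exists_frame_of_nonpos hK hF p hq hm hpm h hx
  have hne := hF.wedge_ne_zero hmF h
  rw [← volForm] at hne
  have h2 : (∏ i, (Fin.cons f 1 : Fin (n + 1) → F) i) = f := by
    simp [Fin.prod_univ_succ]
  have hw' : volForm h u = wedge h (fun i => (Fin.cons f 1 : Fin (n + 1) → F) i •
      D k F (algebraMap R F (a i))) := by
    rw [wedge_smul, h2, hw]
  rw [hw'] at hne ⊢
  obtain ⟨g, b, hg, hgb⟩ := exists_isFormEquation_of_regular h
    (v := fun i => D k F (algebraMap R F (a i))) (fun i => D_mem_regularDiff (R := R) _) hne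
  refine ⟨g, hg, ?_⟩
  rw [h2] at hgb
  have hb : algebraMap R F b ≠ 0 := fun h0 => hg.1 (by rw [hgb, h0, mul_zero])
  rw [hgb, dvrOrd_mul hf0 hb, mul_add, hf]
  have : 0 ≤ (q : ℤ) * dvrOrd R (algebraMap R F b) :=
    mul_nonneg (by positivity) (dvrOrd_algebraMap_nonneg b)
  lia

/-- For a divisor on Y the parameters do generate: `IsRootLocalization.D_mem` with θ = t applies,
since all 1 / Xᵢ lie in B ^ q[t] and Xⱼ is a unit. -/
theorem isFormEquation_of_isRootLocalization_of_nonpos [IsAlgClosed k] {j : Fin (n + 1)}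
    (hR : IsRootLocalization (chartAlgebra (RatFunc k) x j).toSubring q R)
    (hx : ∀ i, dvrOrd R (x i) ≤ 0) (hj : dvrOrd R (homCoord x j) = 0) :
    ∃ f, IsFormEquation k R (volForm h u) f ∧
      q * dvrOrd R f = (m + 1) * ∑ i, dvrOrd R (x i) := by
  have hmF : (m : F) ≠ 0 := by rwa [Ne, CharP.cast_eq_zero_iff F p]
  obtain ⟨a, f, ha0, hf0, hf, hw, hN⟩ := exists_frame_of_nonpos hK hF p hq hm hpm h hx
  refine ⟨f, isFormEquation_of_generators h a (fun b => ?_) (hF.wedge_ne_zero hmF h) hw, hf⟩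
  rw [← mem_span_range_iff_exists_algebraMap_smul]
  set N := Submodule.span R (Set.range fun i => D k F (algebraMap R F (a i)))
  have haN : ∀ i, algebraMap R F (a i) ∈ diffSubring N := fun i =>
    ⟨⟨_, rfl⟩, Submodule.subset_span ⟨i, rfl⟩⟩
  have htN : tCoord k F ∈ diffSubring N := ha0 ▸ haN 0
  have hle := frobeniusAdjoin_le p r htN
  have hy := hN N haN
  rw [hq] at hR
  refine hR.D_mem p htN (.inr (hF.D_tCoord_ne_zero hmF h)) ?_ b
  have hKW := algebraMap_ratFunc_mem_frobeniusAdjoin p r htN hK (self_mem_frobeniusAdjoin p r)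
  have hy' : ∀ i, (homCoord x i)⁻¹ ∈ frobeniusAdjoin p r (diffSubring N) (tCoord k F) := by
    intro i
    cases i using Fin.cases with
    | zero => simp [one_mem]
    | succ i => exact hy i
  have hjW : homCoord x j ∈ frobeniusAdjoin p r (diffSubring N) (tCoord k F) := by
    rw [← inv_inv (homCoord x j)]
    refine inv_mem_frobeniusAdjoin p r (hy' j) (inv_mem_diffSubring (hle (hy' j)) ?_)
    rw [inv_inv]
    exact mem_range_algebraMap_iff.mpr (.inr hj.ge)
  intro s hs
  change s ∈ Algebra.adjoin _ _ at hs
  induction hs using Algebra.adjoin_induction with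
  | mem s hs =>
    obtain ⟨i, rfl⟩ := hs
    rw [chartCoord, div_eq_mul_inv]
    exact mul_mem hjW (hy' _)
  | algebraMap c => exact hKW c
  | add _ _ _ _ ha hb => exact add_mem ha hb
  | mul _ _ _ _ ha hb => exact mul_mem ha hb

end FanoCover.IsCurvePowerField


/-! ### Lower bound for the order where some xⱼ vanishes -/

namespace FanoCover.IsCurvePowerField

open KaehlerDifferential

variable {k F R : Type u} [Field k] [Field F] [Algebra (RatFunc k) F] {n m q : ℕ} {x u : Fin n → F}

theorem sub_pow_eq (hF : IsCurvePowerField k m q x u) (p : ℕ) [Fact p.Prime] [CharP F p] {r : ℕ}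
    (hq : q = p ^ r) (i j : Fin n) : (u i - u j) ^ q = x i ^ m - x j ^ m := by
  rw [hq, sub_pow_char_pow, ← hq, hF.rel, hF.rel, add_sub_add_right_eq_sub]

theorem sub_ne_zero_of_ne (hF : IsCurvePowerField k m q x u) (p : ℕ) [hp : Fact p.Prime] [CharP F p]
    {r : ℕ} (hq : q = p ^ r) (hm : 0 < m) {i j : Fin n} (hij : i ≠ j) : u i - u j ≠ 0 := by
  intro h0
  have h1 := hF.sub_pow_eq p hq i j
  rw [h0, zero_pow (hq ▸ pow_pos hp.out.pos r).ne'] at h1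
  exact hF.x_pow_ne hm hij (sub_eq_zero.mp h1.symm)

/-- Here aᵢ = ord xᵢ, wᵢ = ord (uᵢ - uⱼ), and -1 is the simple pole of the logarithmic form. After
cancellation the claim is q ≤ aⱼ + ∑ (q wᵢ - (m + 1) aᵢ + aⱼ) over i ≠ j, where every summand is at
least aⱼ - aᵢ ≥ 0. -/
theorem neg_dvrOrd_sum_le {n m q : ℕ} (hm : 2 ≤ m) (hmq : m.Coprime q) (hq : 0 < q)
    (hn : m * (q - 1) ≤ n) {a w : Fin n → ℤ} {j : Fin n} (hj : 0 < a j)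
    (ha : ∀ i, a i ≤ a j) (hw : ∀ i, i ≠ j → m * a i ≤ q * w i) :
    (m + 1) * ∑ i, a i - (n + 1 - m * (q - 1)) * a j ≤
      q * (m * a j + ∑ i ∈ Finset.univ.erase j, w i - 1) := by
  have h1 : (m + 1) * ∑ i, a i = (m + 1) * a j + ∑ i ∈ Finset.univ.erase j, (m + 1) * a i := by
    rw [← Finset.add_sum_erase _ _ (Finset.mem_univ j), mul_add, Finset.mul_sum]
  have hn0 : 0 < n := Fin.pos j
  have hcard : ∑ i ∈ Finset.univ.erase j, (a j : ℤ) = (n - 1) * a j := by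
    rw [Finset.sum_const, Finset.card_erase_of_mem (Finset.mem_univ j), Finset.card_univ,
      Fintype.card_fin, nsmul_eq_mul, Nat.cast_pred hn0]
  have key : (q : ℤ) ≤ a j + ∑ i ∈ Finset.univ.erase j, (q * w i - (m + 1) * a i + a j) := by
    by_cases hdvd : (q : ℤ) ∣ a j
    · have h2 := Int.le_of_dvd hj hdvd
      have h3 : 0 ≤ ∑ i ∈ Finset.univ.erase j, (q * w i - (m + 1) * a i + a j) := by
        refine Finset.sum_nonneg fun i hi => ?_
        have := hw i (Finset.ne_of_mem_erase hi)
        have := ha i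
        lia
      lia
    -- A summand that is not positive forces aᵢ = aⱼ and m aⱼ = q wᵢ, hence q ∣ aⱼ. Otherwise the n
    -- - 1 summands and aⱼ add up to at least n ≥ m (q - 1) ≥ q.
    · have h3 : ∑ i ∈ Finset.univ.erase j, (1 : ℤ) ≤
          ∑ i ∈ Finset.univ.erase j, (q * w i - (m + 1) * a i + a j) := by
        refine Finset.sum_le_sum fun i hi => ?_
        have h4 := hw i (Finset.ne_of_mem_erase hi)
        have h5 := ha i
        by_contra hlt
        have h6 : a i = a j := by lia
        have h7 : (m : ℤ) * a j = q * w i := by rw [h6] at h4 hlt; lia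
        refine hdvd ?_
        have : (q : ℤ) ∣ m * a j := ⟨_, h7⟩
        exact (Nat.Coprime.isCoprime hmq.symm).dvd_of_dvd_mul_left this
      rw [Finset.sum_const, Finset.card_erase_of_mem (Finset.mem_univ j), Finset.card_univ,
        Fintype.card_fin, nsmul_eq_mul, Nat.cast_pred hn0, mul_one] at h3
      have h4 : q ≠ 1 := by
        rintro rfl
        exact hdvd (by simp)
      have h5 : q ≤ n := by
        refine le_trans ?_ hn
        obtain ⟨e, rfl⟩ : ∃ e, q = e + 2 := ⟨q - 2, by lia⟩
        calc e + 2 ≤ 2 * (e + 2 - 1) := by lia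
          _ ≤ _ := Nat.mul_le_mul_right _ hm
      lia
  rw [Finset.sum_add_distrib, Finset.sum_sub_distrib, hcard, ← Finset.mul_sum] at key
  rw [h1]
  linarith

variable [Algebra k F] [IsScalarTower k (RatFunc k) F]
  [CommRing R] [IsDomain R] [IsDiscreteValuationRing R] [Algebra R F] [IsFractionRing R F]
  (hK : ∀ c : RatFunc k, algebraMap (RatFunc k) F c ∈ (algebraMap R F).range)
  (hF : IsCurvePowerField k m q x u) (p : ℕ) [hp : Fact p.Prime] [CharP F p] {r : ℕ}
  (hq : q = p ^ r) (hm : 2 ≤ m) (hpm : ¬ p ∣ m) (hn : m * (q - 1) ≤ n)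
  (h : n + 1 = Cardinal.toNat (Algebra.trdeg k F))
include hK hF hq hm hpm hn

/-- Modulo duⱼ, dt is -m xⱼ ^ m dlog xⱼ and duᵢ is (uᵢ - uⱼ) dlog (uᵢ - uⱼ). As ord xⱼ is maximal,
(uᵢ - uⱼ) ^ q = xᵢ ^ m - xⱼ ^ m has order at least m · ord xᵢ. -/
theorem exists_isFormEquation_of_pos [PerfectField k] [Algebra k R] [IsScalarTower k R F]
    [Algebra.EssFiniteType k R] {j : Fin n} (hj : 0 < dvrOrd R (x j))
    (hx : ∀ i, dvrOrd R (x i) ≤ dvrOrd R (x j)) :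
    ∃ f, IsFormEquation k R (volForm h u) f ∧
      (m + 1) * ∑ i, dvrOrd R (x i) - (n + 1 - m * (q - 1)) * dvrOrd R (x j) ≤
        q * dvrOrd R f := by
  have hm0 : 0 < m := by lia
  have hq0 : 0 < q := hq ▸ pow_pos hp.out.pos r
  have hmF : (m : F) ≠ 0 := by rwa [Ne, CharP.cast_eq_zero_iff F p]
  have hmO := dvrOrd_natCast (R := R) hK hmF
  have hcop : m.Coprime q :=
    hq ▸ Nat.Coprime.pow_right r ((hp.out.coprime_iff_not_dvd.mpr hpm).symm)
  have hx0 := hF.x_ne_zero j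
  have hw0 : ∀ i, i ≠ j → u i - u j ≠ 0 := fun i hij => hF.sub_ne_zero_of_ne p hq hm0 hij
  obtain ⟨ϖ, hϖ⟩ := IsDiscreteValuationRing.exists_irreducible R
  obtain ⟨uj, huj⟩ : u j ∈ (algebraMap R F).range := by
    refine mem_range_of_pow_mem_range hq0 ?_
    rw [hF.rel]
    exact add_mem (pow_mem (mem_range_algebraMap_iff.mpr (.inr hj.le)) m) (hK _)
  let c : Fin (n + 1) → F := Fin.cons (-(m * x j ^ m)) fun i => if i = j then 1 else u i - u j
  let v : Fin (n + 1) → Ω[F⁄k] := Fin.cons ((x j)⁻¹ • D k F (x j)) fun i =>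
    if i = j then D k F (u j) else (u i - u j)⁻¹ • D k F (u i - u j)
  have hne := hF.wedge_ne_zero hmF h
  have hform : volForm h u = wedge h fun i => c i • v i := by
    rw [volForm, ← AlternatingMap.map_add_smul_pivot (wedge h) (fun i => c i • v i)
      (Fin.cons (q * u j ^ (q - 1)) fun i => if i = j then 0 else 1) j.succ (by simp)]
    congr 1
    ext i
    cases i using Fin.cases with
    | zero =>
      simp only [Fin.cons_zero, Fin.cons_succ, c, v, if_true, one_smul, hF.D_rel]
      have : x j ^ m = x j ^ (m - 1) * x j := by rw [← pow_succ, Nat.sub_add_cancel hm0]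
      rw [this]
      match_scalars
      · simp
      · field_simp
        ring
    | succ i =>
      by_cases hij : i = j
      · subst hij
        simp [c, v]
      · have := hw0 i hij
        simp only [Fin.cons_succ, c, v, if_true, one_smul, hij, if_false, smul_smul,
          mul_inv_cancel₀ this, ← map_add, sub_add_cancel]
  rw [← volForm, hform] at hne
  rw [hform]
  obtain ⟨f, b, hf, hfb⟩ := exists_isFormEquation_of_log h hϖ (c := c) (v := v) (fun i => by
    cases i using Fin.cases with
    | zero => exact dlog_mem hϖ hx0
    | succ i =>
      by_cases hij : i = j
      · simp only [v, Fin.cons_succ, hij, if_true]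
        refine Submodule.mem_sup_left ?_
        rw [← huj]
        exact D_mem_regularDiff uj
      · simp only [v, Fin.cons_succ, hij, if_false]
        exact dlog_mem hϖ (hw0 i hij)) hne
  refine ⟨f, hf, ?_⟩
  have hprod : ∏ i, c i = -(m * x j ^ m) * ∏ i ∈ Finset.univ.erase j, (u i - u j) := by
    rw [Fin.prod_univ_succ, ← Finset.mul_prod_erase _ _ (Finset.mem_univ j)]
    simp only [c, Fin.cons_zero, Fin.cons_succ, if_true, one_mul]
    congr 1
    exact Finset.prod_congr rfl fun i hi => by rw [if_neg (Finset.ne_of_mem_erase hi)]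
  have hmx : (m * x j ^ m : F) ≠ 0 := mul_ne_zero hmF (pow_ne_zero _ hx0)
  have hprod0 : ∏ i ∈ Finset.univ.erase j, (u i - u j) ≠ 0 :=
    Finset.prod_ne_zero_iff.mpr fun i hi => hw0 i (Finset.ne_of_mem_erase hi)
  have hϖ0 : algebraMap R F ϖ ≠ 0 := by simpa using hϖ.ne_zero
  have hb : algebraMap R F b ≠ 0 := fun h0 => hf.1 (by rw [hfb, h0, mul_zero])
  have hord : dvrOrd R f = m * dvrOrd R (x j) +
      ∑ i ∈ Finset.univ.erase j, dvrOrd R (u i - u j) - 1 + dvrOrd R (algebraMap R F b) := by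
    rw [hfb, hprod, dvrOrd_mul (mul_ne_zero (mul_ne_zero (neg_ne_zero.mpr hmx) hprod0)
      (inv_ne_zero hϖ0)) hb, dvrOrd_mul (mul_ne_zero (neg_ne_zero.mpr hmx) hprod0)
      (inv_ne_zero hϖ0), dvrOrd_mul (neg_ne_zero.mpr hmx) hprod0, dvrOrd_neg,
      dvrOrd_mul hmF (pow_ne_zero _ hx0), hmO, dvrOrd_pow, dvrOrd_inv, dvrOrd_irreducible hϖ,
      dvrOrd_prod _ _ fun i hi => hw0 i (Finset.ne_of_mem_erase hi)]
    ring
  have hmain := neg_dvrOrd_sum_le hm hcop hq0 hn (a := fun i => dvrOrd R (x i))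
    (w := fun i => dvrOrd R (u i - u j)) (j := j) hj hx (fun i hij => by
      rw [← dvrOrd_pow (u i - u j), hF.sub_pow_eq p hq, sub_eq_add_neg]
      refine le_dvrOrd_add ?_ (.inr (by rw [dvrOrd_pow])) (.inr ?_)
      · rw [← sub_eq_add_neg]
        exact sub_ne_zero.mpr (hF.x_pow_ne hm0 hij)
      · rw [dvrOrd_neg, dvrOrd_pow]
        exact mul_le_mul_of_nonneg_left (hx i) (by positivity))
  rw [hord]
  have := dvrOrd_algebraMap_nonneg (F := F) b
  nlinarith

end FanoCover.IsCurvePowerField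


/-! ### Prime divisors of Y over the hyperplane Y₀ = 0 -/

namespace FanoCover

theorem chartAlgebra_le {K F : Type*} [Field K] [Field F] [Algebra K F] {n : ℕ} {x : Fin n → F} {j : Fin n} {W : Subring F}
    (hK : ∀ c, algebraMap K F c ∈ W) (hj : x j ∈ W) (hW : ∀ i, i ≠ j → x j / x i ∈ W) :
    (chartAlgebra K x j.succ).toSubring ≤ W := by
  intro s hs
  change s ∈ Algebra.adjoin _ _ at hs
  induction hs using Algebra.adjoin_induction with
  | mem s hs =>
    obtain ⟨l, rfl⟩ := hs
    rw [chartCoord, homCoord_succ]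
    rcases Fin.eq_zero_or_eq_succ (j.succ.succAbove l) with hl | ⟨i, hl⟩
    · simpa [hl] using hj
    · rw [hl, homCoord_succ]
      refine hW i ?_
      rintro rfl
      exact Fin.succAbove_ne _ _ hl
  | algebraMap c => exact hK c
  | add _ _ _ _ ha hb => exact add_mem ha hb
  | mul _ _ _ _ ha hb => exact mul_mem ha hb

end FanoCover

namespace FanoCover.IsCurvePowerField

open KaehlerDifferential

variable {k F R : Type u} [Field k] [Field F] [Algebra (RatFunc k) F] {n m q : ℕ} {x u : Fin n → F}
  [CommRing R] [IsDomain R] [IsDiscreteValuationRing R] [Algebra R F] [IsFractionRing R F]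
  (hF : IsCurvePowerField k m q x u) (p : ℕ) [hp : Fact p.Prime] [CharP F p] {r : ℕ}
  (hq : q = p ^ r) (hm : 0 < m)
include hF hq hm

/-- On the j-th chart xⱼ = Y₀ / Yⱼ is a coordinate. The divisor lies over xⱼ = 0, and the prime xⱼ
divides neither another coordinate xⱼ / xᵢ nor 1 - (xⱼ / xᵢ) ^ m. -/
theorem dvrOrd_eq_of_isRootLocalization {j : Fin n}
    (hR : IsRootLocalization (chartAlgebra (RatFunc k) x j.succ).toSubring q R)
    (hj : 0 < dvrOrd R (x j)) {i : Fin n} (hij : i ≠ j) :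
    dvrOrd R (x i) = dvrOrd R (x j) ∧ 1 - (x j / x i) ^ m ≠ 0 ∧
      dvrOrd R (1 - (x j / x i) ^ m) = 0 := by
  have hq0 : 0 < q := hq ▸ pow_pos hp.out.pos r
  obtain ⟨l₀, hl₀⟩ := Fin.exists_succAbove_eq (Fin.succ_ne_zero j).symm
  obtain ⟨l, hl⟩ := Fin.exists_succAbove_eq (x := i.succ) (y := j.succ) (by simpa using hij)
  have hll : l ≠ l₀ := by
    rintro rfl
    rw [hl₀] at hl
    exact (Fin.succ_ne_zero i) hl.symm
  have e0 : chartCoord x j.succ l₀ = x j := by simp [chartCoord, hl₀]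
  have e1 : chartCoord x j.succ l = x j / x i := by simp [chartCoord, hl]
  have hmem : ∀ l, chartCoord x j.succ l ∈ chartAlgebra (RatFunc k) x j.succ := fun l =>
    Algebra.subset_adjoin ⟨l, rfl⟩
  have key := fun {a : F} => hR.dvrOrd_eq_zero (a := a) hq0 (z := x j) (hF.x_ne_zero j)
    (e0 ▸ hmem l₀) (fun a ha b hb c hc h => by
      rw [← e0] at h ⊢
      exact hF.chartCoord_dvd_or_dvd p hq j.succ l₀ ha hb hc h) hj
  have h1 : dvrOrd R (x j / x i) = 0 := by
    refine key (e1 ▸ hmem l) fun d hd => ?_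
    rw [← e1, ← e0]
    exact hF.not_chartCoord_dvd_chartCoord p hq j.succ hll hd
  have h2 : ∀ d ∈ chartAlgebra (RatFunc k) x j.succ, 1 - (x j / x i) ^ m ≠ x j * d := by
    intro d hd
    rw [← e1]
    rw [← e0]
    exact hF.not_chartCoord_dvd_one_sub p hq hm j.succ l₀ l hd
  refine ⟨?_, fun h0 => h2 0 (zero_mem _) (by rw [h0, mul_zero]), key ?_ h2⟩
  · rw [dvrOrd_div (hF.x_ne_zero j) (hF.x_ne_zero i)] at h1
    lia
  · rw [← e1]
    exact sub_mem (one_mem _) (pow_mem (hmem l) m)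

end FanoCover.IsCurvePowerField

/-! ### A frame over Y₀ = 0 for q > 1 -/

namespace FanoCover.IsCurvePowerField

open KaehlerDifferential

variable {k F R : Type u} [Field k] [Field F] [Algebra (RatFunc k) F] {n m q : ℕ} {x u : Fin n → F}
  [Algebra k F] [IsScalarTower k (RatFunc k) F]
  [CommRing R] [IsDomain R] [IsDiscreteValuationRing R] [Algebra R F] [IsFractionRing R F]
  (hF : IsCurvePowerField k m q x u) (p : ℕ) [hp : Fact p.Prime] [CharP F p] {r : ℕ}
  (hq : q = p ^ r) (hm : 0 < m) (hpm : ¬ p ∣ m)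
  (h : n + 1 = Cardinal.toNat (Algebra.trdeg k F))
include hF hq hm hpm

section Forms

omit hm hpm in
theorem D_tCoord_eq (hr : r ≠ 0) (j : Fin n) :
    D k F (tCoord k F) = -(m * x j ^ (m - 1) : F) • D k F (x j) := by
  have hq0 : (q : F) = 0 := by rw [hq]; simp [hr]
  have h1 := hF.D_rel j
  rw [hq0, zero_mul, zero_smul] at h1
  rw [neg_smul, eq_neg_iff_add_eq_zero, add_comm, ← h1]

/-- Since q = 0 in F, every dxᵢ is a multiple of dt. Thus dt may be replaced by the differential of
the unit xⱼ / xₗ, which is a coordinate on the divisor. -/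
theorem D_tCoord_eq_smul_D_div (hr : r ≠ 0) {j l : Fin n} (hlj : l ≠ j) :
    D k F (tCoord k F) =
      (-(m * x j ^ m / (x j / x l) / (1 - (x j / x l) ^ m)) : F) • D k F (x j / x l) := by
  have hmF : (m : F) ≠ 0 := by rwa [Ne, CharP.cast_eq_zero_iff F p]
  have hx := hF.x_ne_zero
  have hj := hx j
  have hl := hx l
  have h1 : x l ^ (m - 1) = x l ^ m / x l := by
    rw [eq_div_iff hl, ← pow_succ, Nat.sub_add_cancel hm]
  have h2 : x j ^ (m - 1) = x j ^ m / x j := by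
    rw [eq_div_iff hj, ← pow_succ, Nat.sub_add_cancel hm]
  have h3 : x l ^ m - x j ^ m ≠ 0 := sub_ne_zero.mpr (hF.x_pow_ne hm hlj)
  have h4 : 1 - (x j / x l) ^ m = (x l ^ m - x j ^ m) / x l ^ m := by
    rw [div_pow, sub_div, div_self (pow_ne_zero _ hl)]
  have hDl : D k F (x l) = -((m : F) * x l ^ (m - 1))⁻¹ • D k F (tCoord k F) := by
    rw [hF.D_tCoord_eq p hq hr l]
    match_scalars
    field_simp
  have hDj : D k F (x j) = -((m : F) * x j ^ (m - 1))⁻¹ • D k F (tCoord k F) := by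
    rw [hF.D_tCoord_eq p hq hr j]
    match_scalars
    field_simp
  rw [Derivation.leibniz_div, hDl, hDj, h4, h1, h2]
  have hJ : x j ^ m ≠ 0 := pow_ne_zero _ hj
  have hL : x l ^ m ≠ 0 := pow_ne_zero _ hl
  generalize x j ^ m = J at *
  generalize x l ^ m = L at *
  match_scalars
  field_simp
  ring

omit hpm in
-- The monomial xⱼ ^ α (uₗ - uⱼ) ^ β is a q-th root of xⱼ up to a unit along Y₀ = 0; since m β = 1
-- in F, its differential determines d(uₗ - uⱼ) modulo dt.
theorem D_sub_eq (hr : r ≠ 0) {j l : Fin n} (hlj : l ≠ j) {α β : ℤ} (hαβ : q * α + m * β = 1) :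
    D k F (u l - u j) =
      (m * (u l - u j) / (x j ^ α * (u l - u j) ^ β)) • D k F (x j ^ α * (u l - u j) ^ β) +
      (α * (u l - u j) / x j ^ m) • D k F (tCoord k F) := by
  have hj := hF.x_ne_zero j
  have hw := hF.sub_ne_zero_of_ne p hq hm hlj
  have hq0 : (q : F) = 0 := by rw [hq]; simp [hr]
  have hmβ : (m * β : F) = 1 := by
    have := congrArg (Int.cast : ℤ → F) hαβ
    push_cast at this
    rwa [hq0, zero_mul, zero_add] at this
  have h2 : x j ^ (m - 1) = x j ^ m / x j := by
    rw [eq_div_iff hj, ← pow_succ, Nat.sub_add_cancel hm]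
  have hJ : x j ^ m ≠ 0 := pow_ne_zero _ hj
  have hA : x j ^ α ≠ 0 := zpow_ne_zero _ hj
  have hB : (u l - u j) ^ β ≠ 0 := zpow_ne_zero _ hw
  rw [hF.D_tCoord_eq p hq hr j, Derivation.leibniz (D k F) (x j ^ α), Derivation.leibniz_zpow,
    Derivation.leibniz_zpow, h2, ← Int.cast_smul_eq_zsmul F, ← Int.cast_smul_eq_zsmul F,
    zpow_sub_one₀ hj, zpow_sub_one₀ hw]
  generalize x j ^ m = J at *
  generalize x j ^ α = A at *
  generalize (u l - u j) ^ β = B at *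
  generalize D k F (u l - u j) = ω
  generalize u l - u j = w at *
  match_scalars
  · field_simp
    rw [hmβ]
  · field_simp
    ring

/-- A frame of the differentials along a divisor on which `xⱼ` vanishes, if `r ≠ 0`. -/
theorem volForm_eq_smul_wedge (hr : r ≠ 0) {j l : Fin n} (hlj : l ≠ j) {α β : ℤ}
    (hαβ : q * α + m * β = 1) :
    volForm h u = (∏ i, (Fin.cons (-(m * x j ^ m / (x j / x l) / (1 - (x j / x l) ^ m)))
        (fun i => if i = j then 1 else if i = l then
          m * (u l - u j) / (x j ^ α * (u l - u j) ^ β) else u l - u j) : Fin (n + 1) → F) i) •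
      wedge h (fun i => D k F ((Fin.cons (x j / x l) (fun i => if i = j then u j else
        if i = l then x j ^ α * (u l - u j) ^ β else (u i - u j) / (u l - u j)) :
          Fin (n + 1) → F) i)) := by
  have hw := hF.sub_ne_zero_of_ne p hq hm hlj
  -- Three pivots restore the duᵢ: dt corrects the entry at l to d(uₗ - uⱼ), this corrects the other
  -- entries to d(uᵢ - uⱼ), and duⱼ is added to all of them.
  rw [← wedge_smul, ← AlternatingMap.map_add_smul_pivot (wedge h) _
      (Fin.cons 0 fun i => if i = l then α * (u l - u j) / x j ^ m else 0) 0 (by simp),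
    ← AlternatingMap.map_add_smul_pivot (wedge h) _
      (Fin.cons 0 fun i => if i = j then 0 else if i = l then 0 else (u i - u j) / (u l - u j))
      l.succ (by simp [hlj]),
    ← AlternatingMap.map_add_smul_pivot (wedge h) _
      (Fin.cons 0 fun i => if i = j then 0 else 1) j.succ (by simp), volForm]
  congr 1
  ext i
  have h1 := hF.D_tCoord_eq_smul_D_div (k := k) p hq hm hpm hr hlj
  have h2 := hF.D_sub_eq (k := k) p hq hm hr hlj hαβ
  cases i using Fin.cases with
  | zero => simp [h1]
  | succ i =>
    by_cases hij : i = j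
    · subst hij
      simp [hlj.symm]
    · by_cases hil : i = l
      · subst hil
        simp only [Fin.cons_succ, Fin.cons_zero, hij, hlj.symm, if_true, if_false, one_smul,
          zero_smul, add_zero, ← h1, ← h2, ← map_add, sub_add_cancel]
      · simp only [Fin.cons_succ, Fin.cons_zero, hij, hil, hlj, hlj.symm, if_true, if_false,
          one_smul, zero_smul, add_zero, ← h1, ← h2]
        have h3 : u i = (u l - u j) * ((u i - u j) / (u l - u j)) + u j := by
          rw [mul_div_cancel₀ _ hw, sub_add_cancel]
        conv_lhs => rw [h3, map_add, Derivation.leibniz]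

end Forms

end FanoCover.IsCurvePowerField


/-! ### Order of the volume form over Y₀ = 0 for q > 1 -/

namespace FanoCover.IsCurvePowerField

open KaehlerDifferential

variable {k F R : Type u} [Field k] [Field F] [Algebra (RatFunc k) F] {n m q : ℕ} {x u : Fin n → F}
  [Algebra k F] [IsScalarTower k (RatFunc k) F]
  [CommRing R] [IsDomain R] [IsDiscreteValuationRing R] [Algebra R F] [IsFractionRing R F]
  (hK : ∀ c : RatFunc k, algebraMap (RatFunc k) F c ∈ (algebraMap R F).range)
  (hF : IsCurvePowerField k m q x u) (p : ℕ) [hp : Fact p.Prime] [CharP F p] {r : ℕ}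
  (hq : q = p ^ r) (hm : 0 < m) (hpm : ¬ p ∣ m)
  (h : n + 1 = Cardinal.toNat (Algebra.trdeg k F))
include hK hF hq hm hpm

/-- The frame is xⱼ / xₗ, uⱼ, s = xⱼ ^ α (uₗ - uⱼ) ^ β and the units (uᵢ - uⱼ) / (uₗ - uⱼ). It
generates by `IsRootLocalization.D_mem` with θ = xⱼ / xₗ. -/
theorem isFormEquation_of_isRootLocalization_of_pos_of_ne_zero [IsAlgClosed k] (hr : r ≠ 0)
    {j l : Fin n} (hlj : l ≠ j)
    (hR : IsRootLocalization (chartAlgebra (RatFunc k) x j.succ).toSubring q R)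
    (hj : 0 < dvrOrd R (x j)) :
    ∃ f, IsFormEquation k R (volForm h u) f ∧
      q * dvrOrd R f = (m + 1) * ∑ i, dvrOrd R (x i) -
        (n + 1 - m * (q - 1)) * dvrOrd R (x j) := by
  have hq0 : 0 < q := hq ▸ pow_pos hp.out.pos r
  have hqZ : (0 : ℤ) < q := by exact_mod_cast hq0
  have hmF : (m : F) ≠ 0 := by rwa [Ne, CharP.cast_eq_zero_iff F p]
  have hmO := dvrOrd_natCast (R := R) hK hmF
  have hmR : (m : F)⁻¹ ∈ (algebraMap R F).range :=
    mem_range_algebraMap_iff.mpr (.inr (by rw [dvrOrd_inv, hmO, neg_zero]))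
  have hcop : m.Coprime (p ^ r) :=
    Nat.Coprime.pow_right r ((hp.out.coprime_iff_not_dvd.mpr hpm).symm)
  obtain ⟨α, β, hαβ⟩ : ∃ α β : ℤ, q * α + m * β = 1 := by
    have h1 := Nat.gcd_eq_gcd_ab m (p ^ r)
    rw [hcop.gcd_eq_one, ← hq] at h1
    exact ⟨m.gcdB q, m.gcdA q, by push_cast at h1; linarith⟩
  have hx0 := hF.x_ne_zero
  have hxm0 : ∀ i, x i ^ m ≠ 0 := fun i => pow_ne_zero _ (hx0 i)
  have hunit := fun {i : Fin n} (hij : i ≠ j) =>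
    hF.dvrOrd_eq_of_isRootLocalization p hq hm hR hj hij
  have hx : ∀ i, dvrOrd R (x i) = dvrOrd R (x j) := by
    intro i
    by_cases hij : i = j
    · rw [hij]
    · exact (hunit hij).1
  set M := dvrOrd R (x j) with hM
  have hw0 : ∀ i, i ≠ j → u i - u j ≠ 0 := fun i hij => hF.sub_ne_zero_of_ne p hq hm hij
  have hwq : ∀ i, (u i - u j) ^ q = x i ^ m * (1 - (x j / x i) ^ m) := by
    intro i
    have := hxm0 i
    rw [hF.sub_pow_eq p hq, div_pow]
    field_simp
  have hwo : ∀ i, i ≠ j → q * dvrOrd R (u i - u j) = m * M := by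
    intro i hij
    rw [← dvrOrd_pow, hwq, dvrOrd_mul (hxm0 i) (hunit hij).2.1, (hunit hij).2.2, dvrOrd_pow, hx,
      add_zero]
  have hwo' : ∀ i, i ≠ j → dvrOrd R (u i - u j) = dvrOrd R (u l - u j) := fun i hij =>
    mul_left_cancel₀ hqZ.ne' ((hwo i hij).trans (hwo l hlj).symm)
  have hwl := hw0 l hlj
  set s := x j ^ α * (u l - u j) ^ β with hs_def
  have hs0 : s ≠ 0 := mul_ne_zero (zpow_ne_zero _ (hx0 j)) (zpow_ne_zero _ hwl)
  have hso : q * dvrOrd R s = M := by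
    rw [hs_def, dvrOrd_mul (zpow_ne_zero _ (hx0 j)) (zpow_ne_zero _ hwl), dvrOrd_zpow,
      dvrOrd_zpow, ← hM]
    have h1 := hwo l hlj
    have h2 : q * (α * M + β * dvrOrd R (u l - u j)) =
      q * α * M + β * (q * dvrOrd R (u l - u j)) := by ring
    rw [h2, h1]
    have h3 : q * α * M + β * (m * M) = (q * α + m * β) * M := by ring
    rw [h3, hαβ, one_mul]
  let g : Fin (n + 1) → F := Fin.cons (x j / x l) fun i => if i = j then u j else
        if i = l then s else (u i - u j) / (u l - u j)
  have hzR : ∀ i, x j / x i ∈ (algebraMap R F).range := fun i =>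
    mem_range_algebraMap_iff.mpr (.inr (by rw [dvrOrd_div (hx0 j) (hx0 i), hx i, ← hM, sub_self]))
  have hzR' : ∀ i, (x j / x i)⁻¹ ∈ (algebraMap R F).range := fun i =>
    mem_range_algebraMap_iff.mpr (.inr (by
      rw [dvrOrd_inv, dvrOrd_div (hx0 j) (hx0 i), hx i, ← hM, sub_self, neg_zero]))
  have hgR : ∀ i, g i ∈ (algebraMap R F).range := by
    intro i
    cases i using Fin.cases with
    | zero => exact hzR l
    | succ i =>
      simp only [g, Fin.cons_succ]
      split_ifs with hij hil
      · refine mem_range_of_pow_mem_range hq0 ?_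
        rw [hF.rel]
        exact add_mem (pow_mem (mem_range_algebraMap_iff.mpr (.inr hj.le)) m) (hK _)
      · exact mem_range_algebraMap_iff.mpr (.inr (nonneg_of_mul_nonneg_right (hso ▸ hj.le) hqZ))
      · refine mem_range_algebraMap_iff.mpr (.inr ?_)
        rw [dvrOrd_div (hw0 i hij) hwl, hwo' i hij, sub_self]
  choose a ha using hgR
  have hform := hF.volForm_eq_smul_wedge p hq hm hpm h hr hlj hαβ
  have hg : (fun i => D k F (g i)) = fun i => D k F (algebraMap R F (a i)) := by
    simp only [ha]
  change volForm h u = _ • wedge h (fun i => D k F (g i)) at hform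
  rw [hg] at hform
  refine ⟨_, isFormEquation_of_generators h a (fun b => ?_) (hF.wedge_ne_zero hmF h) hform, ?_⟩
  · rw [← mem_span_range_iff_exists_algebraMap_smul]
    set N := Submodule.span R (Set.range fun i => D k F (algebraMap R F (a i)))
    have hgN : ∀ i, g i ∈ diffSubring N := fun i =>
      ⟨⟨_, ha i⟩, Submodule.subset_span ⟨i, by simp [ha]⟩⟩
    have hz : x j / x l ∈ diffSubring N := hgN 0
    have huN : u j ∈ diffSubring N := by simpa [g] using hgN j.succ
    have hsN : s ∈ diffSubring N := by simpa [g, hlj] using hgN l.succ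
    have hwN : ∀ i, i ≠ j → i ≠ l → (u i - u j) / (u l - u j) ∈ diffSubring N := by
      intro i hij hil
      simpa [g, hij, hil] using hgN i.succ
    have hle := frobeniusAdjoin_le p r hz
    have hDz : D k F (x j / x l) ≠ 0 := by
      intro h0
      have h1 := hF.D_tCoord_eq_smul_D_div (k := k) p hq hm hpm hr hlj
      rw [h0, smul_zero] at h1
      exact hF.D_tCoord_ne_zero hmF h h1
    rw [hq] at hR
    refine hR.D_mem p hz (.inr hDz) ?_ b
    set W := frobeniusAdjoin p r (diffSubring N) (x j / x l)
    have hzW : x j / x l ∈ W := self_mem_frobeniusAdjoin p r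
    have hzW' : (x j / x l)⁻¹ ∈ W :=
      inv_mem_frobeniusAdjoin p r hzW (inv_mem_diffSubring hz (hzR' l))
    -- This unit equals (xₗ / xⱼ) ^ m - 1, so it lies in W; s ^ q = xⱼ c ^ β then puts xⱼ into W,
    -- and t = uⱼ ^ q - xⱼ ^ m follows.
    set c := (u l - u j) ^ q / x j ^ m with hc_def
    have hc0 : c ≠ 0 := div_ne_zero (pow_ne_zero _ hwl) (hxm0 j)
    have hcW : c ∈ W := by
      have : c = (x j / x l)⁻¹ ^ m - 1 := by
        rw [hc_def, hF.sub_pow_eq p hq, sub_div, div_self (hxm0 j), inv_div, div_pow]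
      rw [this]
      exact sub_mem (pow_mem hzW' m) (one_mem _)
    have hcB : c⁻¹ ∈ diffSubring N := by
      refine inv_mem_diffSubring (hle hcW) (mem_range_algebraMap_iff.mpr (.inr ?_))
      rw [dvrOrd_inv, dvrOrd_div (pow_ne_zero _ hwl) (hxm0 j), dvrOrd_pow, dvrOrd_pow, hwo l hlj,
        ← hM, sub_self, neg_zero]
    have hsq : s ^ p ^ r = x j * c ^ β := by
      rw [← hq, hs_def, mul_pow, hc_def, div_zpow, ← zpow_natCast, ← zpow_natCast, ← zpow_natCast,
        ← zpow_natCast, ← zpow_mul, ← zpow_mul, ← zpow_mul, ← zpow_mul, mul_comm β]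
      have h1 : x j ^ (α * q) = x j / x j ^ (m * β) := by
        rw [eq_div_iff (zpow_ne_zero _ (hx0 j)), ← zpow_add₀ (hx0 j), mul_comm α, hαβ, zpow_one]
      rw [h1]
      field_simp
    have hxW : x j ∈ W := by
      have : x j = s ^ p ^ r * c ^ (-β) := by
        rw [hsq, mul_assoc, ← zpow_add₀ hc0, add_neg_cancel, zpow_zero, mul_one]
      rw [this]
      exact mul_mem (pow_mem_frobeniusAdjoin p r hsN) (zpow_mem_frobeniusAdjoin p r hcW hcB _)
    have htW : tCoord k F ∈ W := by
      have : tCoord k F = u j ^ p ^ r - x j ^ m := by rw [← hq, hF.rel, add_sub_cancel_left]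
      rw [this]
      exact sub_mem (pow_mem_frobeniusAdjoin p r huN) (pow_mem hxW m)
    have hKW := algebraMap_ratFunc_mem_frobeniusAdjoin p r hz hK htW
    refine chartAlgebra_le hKW hxW fun i hij => ?_
    by_cases hil : i = l
    · rw [hil]
      exact hzW
    -- Only the m-th power of the unit xᵢ / xⱼ is visible in W; m being invertible puts the element
    -- into B, and Bézout then into W.
    · have h1 : (x j / x i)⁻¹ ^ m ∈ W := by
        have : (x j / x i)⁻¹ ^ m = 1 + c * ((u i - u j) / (u l - u j)) ^ p ^ r := by
          have := pow_ne_zero q hwl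
          have := hxm0 j
          rw [← hq, inv_div, div_pow, div_pow, hc_def, hF.sub_pow_eq p hq i j]
          field_simp
          ring
        rw [this]
        exact add_mem (one_mem _) (mul_mem hcW (pow_mem_frobeniusAdjoin p r (hwN i hij hil)))
      have h2 : (x j / x i)⁻¹ ∈ diffSubring N :=
        mem_diffSubring_of_pow_mem (hle h1) (hzR' i) (by rw [inv_inv]; exact hzR i) hmF hmR
      have h3 : ((x j / x i)⁻¹)⁻¹ ∈ diffSubring N :=
        inv_mem_diffSubring h2 (by rw [inv_inv]; exact hzR i)
      have h4 := inv_mem_frobeniusAdjoin p r (mem_frobeniusAdjoin_of_pow_mem p r hcop h1 h2 h3) h3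
      rwa [inv_inv] at h4
  · have hzl : x j / x l ≠ 0 := div_ne_zero (hx0 j) (hx0 l)
    have hzo : dvrOrd R (x j / x l) = 0 := by rw [dvrOrd_div (hx0 j) (hx0 l), hx l, ← hM, sub_self]
    have hmx : (m * x j ^ m : F) ≠ 0 := mul_ne_zero hmF (hxm0 j)
    have hprod : ∀ i ∈ Finset.univ, (if i = j then 1 else if i = l then
          m * (u l - u j) / s else u l - u j) ≠ 0 := by
      intro i _
      split_ifs
      exacts [one_ne_zero, div_ne_zero (mul_ne_zero hmF hwl) hs0, hwl]
    rw [Fin.prod_univ_succ]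
    simp only [Fin.cons_zero, Fin.cons_succ]
    rw [dvrOrd_mul (neg_ne_zero.mpr (div_ne_zero (div_ne_zero hmx hzl) (hunit hlj).2.1))
      (Finset.prod_ne_zero_iff.mpr hprod), dvrOrd_neg,
      dvrOrd_div (div_ne_zero hmx hzl) (hunit hlj).2.1, dvrOrd_div hmx hzl,
      dvrOrd_mul hmF (hxm0 j), (hunit hlj).2.2, hzo, hmO, dvrOrd_pow, dvrOrd_prod _ _ hprod,
      mul_add, Finset.mul_sum]
    -- Every i ≠ j contributes m M; the index l gives M less, because s replaces uₗ - uⱼ and q · ord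
    -- s = M.
    have hterm : ∀ i, q * dvrOrd R (if i = j then 1 else if i = l then
          m * (u l - u j) / s else u l - u j) =
        m * M - (if i = j then m * M else 0) - if i = l then M else 0 := by
      intro i
      by_cases hij : i = j
      · simp [hij, hlj.symm, dvrOrd_one]
      · by_cases hil : i = l
        · simp only [hil, hlj, if_true, if_false]
          rw [dvrOrd_div (mul_ne_zero hmF hwl) hs0, dvrOrd_mul hmF hwl, hmO, mul_sub, mul_add,
            hwo l hlj, hso]
          ring
        · simp only [hij, hil, if_false]
          rw [hwo l hlj]
          ring
    simp only [hterm, hx, Finset.sum_sub_distrib, Finset.sum_ite_eq', Finset.mem_univ, if_true,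
      Finset.sum_const, Finset.card_univ, Fintype.card_fin, nsmul_eq_mul]
    ring

end FanoCover.IsCurvePowerField


/-! ### The case q = 1 over Y₀ = 0, and the order formulas on all charts -/

namespace FanoCover.IsCurvePowerField

open KaehlerDifferential

variable {k F R : Type u} [Field k] [Field F] [Algebra (RatFunc k) F] {n m q : ℕ} {x u : Fin n → F}
  [Algebra k F] [IsScalarTower k (RatFunc k) F]
  [CommRing R] [IsDomain R] [IsDiscreteValuationRing R] [Algebra R F] [IsFractionRing R F]

/-- A frame of the differentials along a divisor on which `xⱼ` vanishes, if `q = 1`. -/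
theorem volForm_eq_smul_wedge_of_eq_one (hF : IsCurvePowerField k m 1 x u) (hm : 0 < m)
    (hmF : (m : F) ≠ 0) (h : n + 1 = Cardinal.toNat (Algebra.trdeg k F)) (j : Fin n) :
    volForm h u = (∏ i, (Fin.cons (-(m * x j ^ m / x j))
        (fun i => if i = j then 1 else -(m * x i ^ m / (x j / x i))) : Fin (n + 1) → F) i) •
      wedge h (fun i => D k F ((Fin.cons (x j) (fun i => if i = j then u j else x j / x i) :
          Fin (n + 1) → F) i)) := by
  have hx0 := hF.x_ne_zero
  have hxm0 : ∀ i, x i ^ m ≠ 0 := fun i => pow_ne_zero _ (hx0 i)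
  have hpred : ∀ i, x i ^ (m - 1) = x i ^ m / x i := fun i => by
    rw [eq_div_iff (hx0 i), ← pow_succ, Nat.sub_add_cancel hm]
  have hj0 := hx0 j
  have hjm0 := hxm0 j
  rw [← wedge_smul, ← AlternatingMap.map_add_smul_pivot (wedge h) _
      (Fin.cons 0 fun i => if i = j then 0 else -((x i ^ m - x j ^ m) / x j ^ m)) 0 (by simp),
    ← AlternatingMap.map_add_smul_pivot (wedge h) _
      (Fin.cons 1 fun i => if i = j then 0 else 1) j.succ (by simp), volForm]
  congr 1
  ext i
  have hrel : ∀ i, D k F (u i) = (m * x i ^ (m - 1)) • D k F (x i) + D k F (tCoord k F) := by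
    intro i
    simpa using hF.D_rel i
  cases i using Fin.cases with
  | zero =>
    simp only [Fin.cons_zero, Fin.cons_succ, if_true, zero_smul, add_zero, one_smul, hrel, hpred]
    match_scalars
    · simp
    · simp only [mul_one]
      ring
  | succ i =>
    by_cases hij : i = j
    · subst hij
      simp
    · have hi0 := hx0 i
      have him0 := hxm0 i
      simp only [Fin.cons_zero, Fin.cons_succ, if_true, hij, if_false, zero_smul, add_zero,
        one_smul, hrel, hpred, Derivation.leibniz_div]
      generalize x i ^ m = I at *
      generalize x j ^ m = J at *
      match_scalars
      · field_simp
      · simp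
      · field_simp
        ring

/-- Here R is a localization of the chart ring itself, so the differentials of the chart coordinates
and of t = uⱼ - xⱼ ^ m generate; `frobeniusAdjoin` with r = 0 contains all of B. -/
theorem isFormEquation_of_isRootLocalization_of_pos_of_eq_one
    (hK : ∀ c : RatFunc k, algebraMap (RatFunc k) F c ∈ (algebraMap R F).range)
    (hF : IsCurvePowerField k m 1 x u) (p : ℕ) [hp : Fact p.Prime] [CharP F p]
    (hm : 0 < m) (hpm : ¬ p ∣ m)
    (h : n + 1 = Cardinal.toNat (Algebra.trdeg k F)) [IsAlgClosed k] {j : Fin n}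
    (hR : IsRootLocalization (chartAlgebra (RatFunc k) x j.succ).toSubring 1 R)
    (hj : 0 < dvrOrd R (x j)) :
    ∃ f, IsFormEquation k R (volForm h u) f ∧
      dvrOrd R f = (m + 1) * ∑ i, dvrOrd R (x i) - (n + 1) * dvrOrd R (x j) := by
  have hmF : (m : F) ≠ 0 := by rwa [Ne, CharP.cast_eq_zero_iff F p]
  have hmO := dvrOrd_natCast (R := R) hK hmF
  have hq : 1 = p ^ 0 := (pow_zero p).symm
  have hx0 := hF.x_ne_zero
  have hxm0 : ∀ i, x i ^ m ≠ 0 := fun i => pow_ne_zero _ (hx0 i)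
  have hx : ∀ i, dvrOrd R (x i) = dvrOrd R (x j) := by
    intro i
    by_cases hij : i = j
    · rw [hij]
    · exact (hF.dvrOrd_eq_of_isRootLocalization p hq hm hR hj hij).1
  set M := dvrOrd R (x j) with hM
  have hxR : x j ∈ (algebraMap R F).range := mem_range_algebraMap_iff.mpr (.inr hj.le)
  let g : Fin (n + 1) → F := Fin.cons (x j) fun i => if i = j then u j else x j / x i
  have hgR : ∀ i, g i ∈ (algebraMap R F).range := by
    intro i
    cases i using Fin.cases with
    | zero => exact hxR
    | succ i =>
      simp only [g, Fin.cons_succ]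
      split_ifs with hij
      · have := hF.rel j
        rw [pow_one] at this
        rw [this]
        exact add_mem (pow_mem hxR m) (hK _)
      · refine mem_range_algebraMap_iff.mpr (.inr ?_)
        rw [dvrOrd_div (hx0 j) (hx0 i), hx i, ← hM, sub_self]
  choose a ha using hgR
  have hform := hF.volForm_eq_smul_wedge_of_eq_one hm hmF h j
  have hg : (fun i => D k F (g i)) = fun i => D k F (algebraMap R F (a i)) := by
    simp only [ha]
  change volForm h u = _ • wedge h (fun i => D k F (g i)) at hform
  rw [hg] at hform
  refine ⟨_, isFormEquation_of_generators h a (fun b => ?_) (hF.wedge_ne_zero hmF h) hform, ?_⟩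
  · rw [← mem_span_range_iff_exists_algebraMap_smul]
    set N := Submodule.span R (Set.range fun i => D k F (algebraMap R F (a i)))
    have hgN : ∀ i, g i ∈ diffSubring N := fun i =>
      ⟨⟨_, ha i⟩, Submodule.subset_span ⟨i, by simp [ha]⟩⟩
    have hW : ∀ {g}, g ∈ diffSubring N → g ∈ frobeniusAdjoin p 0 (diffSubring N) (x j) := by
      intro g hg
      simpa using pow_mem_frobeniusAdjoin p 0 (θ := x j) hg
    have hxN : x j ∈ diffSubring N := hgN 0
    have huN : u j ∈ diffSubring N := by simpa [g] using hgN j.succ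
    have htN : tCoord k F ∈ diffSubring N := by
      have : tCoord k F = u j ^ 1 - x j ^ m := by rw [hF.rel, add_sub_cancel_left]
      rw [this, pow_one]
      exact sub_mem huN (pow_mem hxN m)
    rw [hq] at hR
    refine hR.D_mem p hxN (.inl rfl) ?_ b
    refine chartAlgebra_le (algebraMap_ratFunc_mem_frobeniusAdjoin p 0 hxN hK (hW htN)) (hW hxN)
      fun i hij => hW ?_
    simpa [g, hij] using hgN i.succ
  · have hz : ∀ i, x j / x i ≠ 0 := fun i => div_ne_zero (hx0 j) (hx0 i)
    have hmx : ∀ i, (m * x i ^ m : F) ≠ 0 := fun i => mul_ne_zero hmF (hxm0 i)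
    have hmxo : ∀ i, dvrOrd R (m * x i ^ m : F) = m * M := by
      intro i
      rw [dvrOrd_mul hmF (hxm0 i), hmO, dvrOrd_pow, hx, zero_add]
    have hprod : ∀ i ∈ Finset.univ, (if i = j then 1 else -(m * x i ^ m / (x j / x i))) ≠ 0 := by
      intro i _
      split_ifs
      exacts [one_ne_zero, neg_ne_zero.mpr (div_ne_zero (hmx i) (hz i))]
    rw [Fin.prod_univ_succ]
    simp only [Fin.cons_zero, Fin.cons_succ]
    rw [dvrOrd_mul (neg_ne_zero.mpr (div_ne_zero (hmx j) (hx0 j)))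
      (Finset.prod_ne_zero_iff.mpr hprod), dvrOrd_neg, dvrOrd_div (hmx j) (hx0 j), hmxo,
      dvrOrd_prod _ _ hprod]
    have hterm : ∀ i, dvrOrd R (if i = j then 1 else -(m * x i ^ m / (x j / x i))) =
        m * M - if i = j then m * M else 0 := by
      intro i
      by_cases hij : i = j
      · simp [hij, dvrOrd_one]
      · simp only [hij, if_false]
        rw [dvrOrd_neg, dvrOrd_div (hmx i) (hz i), hmxo, dvrOrd_div (hx0 j) (hx0 i), hx i, ← hM]
        ring
    simp only [hterm, hx, Finset.sum_sub_distrib, Finset.sum_ite_eq', Finset.mem_univ, if_true,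
      Finset.sum_const, Finset.card_univ, Fintype.card_fin, nsmul_eq_mul]
    ring

section Main

variable (hF : IsCurvePowerField k m q x u) (p : ℕ) [hp : Fact p.Prime] [CharP F p] {r : ℕ}
  (hq : q = p ^ r) (hm : 2 ≤ m) (hpm : ¬ p ∣ m) (hn : m * (q - 1) ≤ n)
  (h : n + 1 = Cardinal.toNat (Algebra.trdeg k F))
include hF hq hm hpm hn

/-- A lower bound for the order of the form `dt ∧ du₁ ∧ ⋯ ∧ duₙ` along a divisor with centre on
the `j`-th chart. -/
theorem exists_isFormEquation_of_le [PerfectField k] [Algebra k R] [IsScalarTower k R F]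
    [Algebra.EssFiniteType k R]
    (hK : ∀ c : RatFunc k, algebraMap (RatFunc k) F c ∈ (algebraMap R F).range)
    {j : Fin (n + 1)} (hx : ∀ i, dvrOrd R (homCoord x i) ≤ dvrOrd R (homCoord x j)) :
    ∃ f, IsFormEquation k R (volForm h u) f ∧
      (m + 1) * ∑ i, dvrOrd R (x i) - (n + 1 - m * (q - 1)) * dvrOrd R (homCoord x j) ≤
        q * dvrOrd R f := by
  have h0 := hx 0
  rw [homCoord_zero, dvrOrd_one] at h0
  rcases h0.eq_or_lt with h0 | h0
  · rw [← h0] at hx ⊢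
    rw [mul_zero, sub_zero]
    exact exists_isFormEquation_of_nonpos hK hF p hq (by lia) hpm h fun i => hx i.succ
  · cases j using Fin.cases with
    | zero =>
      rw [homCoord_zero, dvrOrd_one] at h0
      exact absurd h0 (lt_irrefl _)
    | succ j => exact exists_isFormEquation_of_pos hK hF p hq hm hpm hn h h0 fun i => hx i.succ

/-- The order of the form `dt ∧ du₁ ∧ ⋯ ∧ duₙ` along a divisor on the `j`-th chart. -/
theorem exists_isFormEquation_of_isRootLocalization [IsAlgClosed k] {j : Fin (n + 1)}
    (hR : IsRootLocalization (chartAlgebra (RatFunc k) x j).toSubring q R) :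
    ∃ f, IsFormEquation k R (volForm h u) f ∧
      q * dvrOrd R f = (m + 1) * ∑ i, dvrOrd R (x i) -
        (n + 1 - m * (q - 1)) * dvrOrd R (homCoord x j) := by
  have hm0 : 0 < m := by lia
  have hK : ∀ c : RatFunc k, algebraMap (RatFunc k) F c ∈ (algebraMap R F).range := fun c =>
    hR.mem _ (Subalgebra.algebraMap_mem _ c)
  have hx : ∀ i, dvrOrd R (homCoord x i) ≤ dvrOrd R (homCoord x j) := by
    intro i
    have hi := homCoord_ne_zero hF.x_ne_zero i
    have hj := homCoord_ne_zero hF.x_ne_zero j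
    have h1 := (mem_range_algebraMap_iff.mp (hR.mem _
      (homCoord_div_mem_chartAlgebra (K := RatFunc k) hF.x_ne_zero j i))).resolve_left
      (div_ne_zero hj hi)
    rw [dvrOrd_div hj hi] at h1
    lia
  have h0 := hx 0
  rw [homCoord_zero, dvrOrd_one] at h0
  rcases h0.eq_or_lt with h0 | h0
  · rw [← h0, mul_zero, sub_zero]
    exact isFormEquation_of_isRootLocalization_of_nonpos hK hF p hq hm0 hpm h hR
      (fun i => h0 ▸ hx i.succ) h0.symm
  · cases j using Fin.cases with
    | zero =>
      rw [homCoord_zero, dvrOrd_one] at h0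
      exact absurd h0 (lt_irrefl _)
    | succ j =>
      by_cases hr : r = 0
      · obtain rfl : q = 1 := by rw [hq, hr, pow_zero]
        obtain ⟨f, hf, hfo⟩ :=
          isFormEquation_of_isRootLocalization_of_pos_of_eq_one hK hF p hm0 hpm h hR h0
        refine ⟨f, hf, ?_⟩
        rw [hfo, homCoord_succ]
        push_cast
        ring
      · have hq2 : 2 ≤ q := by
          rw [hq]
          exact hp.out.two_le.trans (Nat.le_self_pow hr p)
        -- A second index l exists because n ≥ m (q - 1) ≥ 2.
        have hn2 : 2 ≤ n := by
          refine le_trans ?_ hn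
          calc 2 ≤ m * 1 := by lia
            _ ≤ _ := Nat.mul_le_mul_left m (by lia)
        have : Nontrivial (Fin n) := Fin.nontrivial_iff_two_le.mpr hn2
        obtain ⟨l, hl⟩ := exists_ne j
        exact isFormEquation_of_isRootLocalization_of_pos_of_ne_zero hK hF p hq hm0 hpm h hr hl
          hR h0

end Main

end FanoCover.IsCurvePowerField


/-! ### Codimension one points of normal schemes -/

section NormalDomain

/-- A rational function on a normal noetherian domain with no pole in codimension one is regular. -/
theorem exists_height_eq_one_forall_mul_mem {A F : Type*} [CommRing A] [IsDomain A]
    [IsNoetherianRing A] [IsIntegrallyClosed A] [Field F] [Algebra A F] [IsFractionRing A F] {f : F}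
    (hf : f ∉ (algebraMap A F).range) :
    ∃ p : Ideal A, p.IsPrime ∧ p.height = 1 ∧
      ∀ a : A, algebraMap A F a * f ∈ (algebraMap A F).range → a ∈ p := by
  obtain ⟨a, b, hb, rfl⟩ := IsFractionRing.div_surjective (A := A) f
  have hb0 : b ≠ 0 := nonZeroDivisors.ne_zero hb
  have hbF : algebraMap A F b ≠ 0 := by simpa using hb0
  have hinj := IsFractionRing.injective A F
  have hiff : ∀ a d : A, algebraMap A F d * (algebraMap A F a / algebraMap A F b) ∈
      (algebraMap A F).range ↔ d * a ∈ Ideal.span {b} := by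
    intro a d
    rw [Ideal.mem_span_singleton, RingHom.mem_range]
    refine exists_congr fun c => ?_
    rw [← mul_div_assoc, eq_div_iff hbF, ← map_mul, ← map_mul, hinj.eq_iff, mul_comm c, eq_comm]
  have ha : Ideal.Quotient.mk (Ideal.span {b}) a ≠ 0 := by
    rw [Ne, Ideal.Quotient.eq_zero_iff_mem]
    have := (hiff a 1).not
    rw [map_one, one_mul, one_mul] at this
    exact this.mp hf
  -- An associated prime of A / (b) that contains all denominators of f; it is the denominator ideal
  -- of some g = c / b.
  obtain ⟨p, hp, hap⟩ := exists_le_isAssociatedPrime_of_isNoetherianRing A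
    (Ideal.Quotient.mk (Ideal.span {b}) a) ha
  obtain ⟨hprime, c, hc⟩ := (isAssociatedPrime_iff).mp hp
  obtain ⟨c, rfl⟩ := Ideal.Quotient.mk_surjective c
  have hmem : ∀ c d : A, d ∈ (⊥ : Submodule A (A ⧸ Ideal.span {b})).colon
      {Ideal.Quotient.mk (Ideal.span {b}) c} ↔ algebraMap A F d *
        (algebraMap A F c / algebraMap A F b) ∈ (algebraMap A F).range := by
    intro c d
    rw [hiff, Submodule.mem_colon_singleton, Submodule.mem_bot, Algebra.smul_def,
      Ideal.Quotient.algebraMap_eq, ← map_mul, Ideal.Quotient.eq_zero_iff_mem]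
  set g := algebraMap A F c / algebraMap A F b with hg
  have hpg : ∀ d, d ∈ p ↔ algebraMap A F d * g ∈ (algebraMap A F).range := by
    intro d
    rw [hc]
    exact hmem c d
  have hgA : g ∉ (algebraMap A F).range := by
    have := (hpg 1).not.mp (by rw [← Ideal.eq_top_iff_one]; exact hprime.ne_top)
    rwa [map_one, one_mul] at this
  have hbp : b ∈ p := (hpg b).mpr ⟨c, by rw [hg, mul_div_cancel₀ _ hbF]⟩
  -- If g mapped the finitely generated module p into itself, g would be integral over A, hence in A
  -- by normality.
  obtain ⟨π, hπ, e, he, heg⟩ : ∃ π ∈ p, ∃ e ∉ p, algebraMap A F e = algebraMap A F π * g := by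
    by_contra! hcon
    refine hgA ((IsIntegrallyClosed.isIntegral_iff (R := A)).mp
      (isIntegral_of_smul_mem_submodule (Submodule.map (Algebra.linearMap A F) p) ?_ ?_ g ?_))
    · intro h0
      rw [Submodule.eq_bot_iff] at h0
      exact hbF (h0 _ ⟨b, hbp, rfl⟩)
    · exact Submodule.FG.map _ (IsNoetherian.noetherian p)
    · rintro _ ⟨d, hd, rfl⟩
      obtain ⟨e, he⟩ := (hpg d).mp hd
      refine ⟨e, ?_, ?_⟩
      · by_contra hep
        exact hcon d hd e hep he
      · simp [he, mul_comm]
  refine ⟨p, hprime, le_antisymm ?_ ?_, fun d hd => hap ((hmem a d).mpr hd)⟩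
  -- Since π g = e is outside p, the prime p is minimal over (π), and Krull's principal ideal
  -- theorem applies.
  · refine Ideal.height_le_one_of_isPrincipal_of_mem_minimalPrimes (Ideal.span {π}) p
      ⟨⟨hprime, by rwa [Ideal.span_singleton_le_iff_mem]⟩, ?_⟩
    rintro Q ⟨hQ, hπQ⟩ hQp d hd
    rw [Ideal.span_singleton_le_iff_mem] at hπQ
    obtain ⟨h, hh⟩ := (hpg d).mp hd
    have h1 : d * e = π * h := by
      apply hinj
      rw [map_mul, map_mul, heg, hh]
      ring
    exact (hQ.mem_or_mem (h1 ▸ Q.mul_mem_right h hπQ : d * e ∈ Q)).resolve_right fun h => he (hQp h)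
  · rw [Order.one_le_iff_pos, pos_iff_ne_zero]
    intro h0
    rw [Ideal.height_eq_zero_iff_eq_bot] at h0
    rw [h0] at hbp
    exact hb0 hbp

end NormalDomain

section NormalScheme

variable {X : Scheme.{u}} [IsIntegral X]

/-- The point P is the image in an affine neighbourhood of y of the contraction of p. A fraction
regular at P has a denominator outside p. -/
theorem exists_coheight_eq_one_of_height_eq_one {y : X} {p : Ideal (X.presheaf.stalk y)}
    (hp : p.IsPrime) (hp1 : p.height = 1) : ∃ P : X, P ⤳ y ∧ Order.coheight P = 1 ∧
      ∀ f ∈ (algebraMap (X.presheaf.stalk P) X.functionField).range, ∃ b ∉ p,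
        algebraMap _ X.functionField b * f ∈
          (algebraMap (X.presheaf.stalk y) X.functionField).range := by
  obtain ⟨_, ⟨U, hU, rfl⟩, hyU, -⟩ := X.isBasis_affineOpens.exists_subset_of_mem_open
    (Set.mem_univ y) isOpen_univ
  replace hU : IsAffineOpen U := hU
  replace hyU : y ∈ U := hyU
  have : Nonempty U := ⟨⟨y, hyU⟩⟩
  let _ := TopCat.Presheaf.algebra_section_stalk X.presheaf (⟨y, hyU⟩ : U)
  have hloc := hU.isLocalization_stalk ⟨y, hyU⟩
  have htow := functionField_isScalarTower X U ⟨y, hyU⟩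
  let p' : PrimeSpectrum Γ(X, U) := ⟨p.comap (algebraMap _ _), hp.comap _⟩
  have hPU : hU.fromSpec p' ∈ U := by
    have : hU.fromSpec p' ∈ Set.range hU.fromSpec := ⟨p', rfl⟩
    rwa [hU.range_fromSpec] at this
  have hpr : hU.primeIdealOf ⟨hU.fromSpec p', hPU⟩ = p' :=
    hU.fromSpec.isOpenEmbedding.injective (hU.fromSpec_primeIdealOf _)
  have hloc' := hU.isLocalization_stalk ⟨hU.fromSpec p', hPU⟩
  rw [hpr] at hloc'
  let _ := TopCat.Presheaf.algebra_section_stalk X.presheaf (⟨hU.fromSpec p', hPU⟩ : U)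
  have htow' := functionField_isScalarTower X U ⟨hU.fromSpec p', hPU⟩
  refine ⟨hU.fromSpec p', ?_, ?_, ?_⟩
  · have h1 : p' ⤳ hU.primeIdealOf ⟨y, hyU⟩ := by
      have hd := (IsLocalization.disjoint_under_iff (hU.primeIdealOf ⟨y, hyU⟩).asIdeal.primeCompl
        (X.presheaf.stalk y) p).mpr hp.ne_top
      rw [← PrimeSpectrum.le_iff_specializes]
      change p'.asIdeal ≤ _
      intro a ha
      by_contra hna
      exact Set.disjoint_left.mp hd hna ha
    have h2 := h1.map hU.fromSpec.continuous
    rwa [hU.fromSpec_primeIdealOf] at h2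
  · have h1 := IsLocalization.AtPrime.ringKrullDim_eq_height p'.asIdeal
      (X.presheaf.stalk (hU.fromSpec p'))
    have h2 := IsLocalization.height_under (hU.primeIdealOf ⟨y, hyU⟩).asIdeal.primeCompl p
    rw [ringKrullDim_stalk_eq_coheight] at h1
    change _ = ((p.comap _).height : WithBot ℕ∞) at h1
    rw [h2, hp1] at h1
    exact_mod_cast h1
  · rintro _ ⟨f, rfl⟩
    obtain ⟨a, b, rfl⟩ := IsLocalization.exists_mk'_eq p'.asIdeal.primeCompl f
    refine ⟨algebraMap _ _ b.1, b.2, algebraMap _ _ a, ?_⟩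
    rw [← IsScalarTower.algebraMap_apply, ← IsScalarTower.algebraMap_apply,
      IsScalarTower.algebraMap_apply _ (X.presheaf.stalk (hU.fromSpec p')) X.functionField a,
      IsScalarTower.algebraMap_apply _ (X.presheaf.stalk (hU.fromSpec p')) X.functionField b.1,
      ← map_mul, mul_comm, IsLocalization.mk'_spec]

variable [IsLocallyNoetherian X]

theorem isDiscreteValuationRing_stalk {P : X} [IsIntegrallyClosed (X.presheaf.stalk P)]
    (hP : Order.coheight P = 1) : IsDiscreteValuationRing (X.presheaf.stalk P) := by
  have : Ring.KrullDimLE 1 (X.presheaf.stalk P) := krullDimLE_of_coheight_le hP.le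
  have hdim := ringKrullDim_stalk_eq_coheight P
  rw [hP] at hdim
  have hnf : ¬ IsField (X.presheaf.stalk P) := by
    intro h
    rw [ringKrullDim_eq_zero_of_isField h] at hdim
    exact absurd hdim (by decide)
  have h1 : IsPrincipalIdealRing (X.presheaf.stalk P) := by
    have h2 : IsIntegrallyClosed (X.presheaf.stalk P) ∧ ∀ Q : Ideal (X.presheaf.stalk P), Q ≠ ⊥ →
        Q.IsPrime → Q = IsLocalRing.maximalIdeal (X.presheaf.stalk P) :=
      ⟨inferInstance, fun Q hQ hQ' => IsLocalRing.eq_maximalIdeal (hQ'.isMaximal_of_ne_bot hQ)⟩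
    exact ((tfae_of_isNoetherianRing_of_isLocalRing_of_isDomain (X.presheaf.stalk P)).out 3 0).mp h2
  exact { toIsPrincipalIdealRing := h1, toIsLocalRing := inferInstance,
          not_a_field' := fun h => hnf (IsLocalRing.isField_iff_maximalIdeal_eq.mpr h) }

theorem ord_eq_dvrOrd {P : X} [IsDiscreteValuationRing (X.presheaf.stalk P)]
    (hP : Order.coheight P = 1) {f : X.functionField} (hf : f ≠ 0) :
    X.ord f P = dvrOrd (X.presheaf.stalk P) f := by
  rw [Scheme.ord_eq_iff hP hf]
  exact (WithZero.exp_log (ordFrac_ne_zero hf)).symm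

/-- A rational function on a normal scheme that has no pole along the prime divisors through `y`
is regular at `y`. -/
theorem mem_range_stalk_of_forall_ord_nonneg (hX : ∀ x : X, IsIntegrallyClosed (X.presheaf.stalk x))
    {y : X} {f : X.functionField} (hf : f ≠ 0)
    (h : ∀ P : X, P ⤳ y → Order.coheight P = 1 → 0 ≤ X.ord f P) :
    f ∈ (algebraMap (X.presheaf.stalk y) X.functionField).range := by
  by_contra hfy
  have := hX y
  obtain ⟨p, hp, hp1, hpf⟩ := exists_height_eq_one_forall_mul_mem hfy
  obtain ⟨P, hPy, hP1, hP⟩ := exists_coheight_eq_one_of_height_eq_one hp hp1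
  have := hX P
  have := isDiscreteValuationRing_stalk hP1
  have h1 := h P hPy hP1
  rw [ord_eq_dvrOrd hP1 hf, ← exists_algebraMap_eq_iff hf] at h1
  obtain ⟨b, hb, hbf⟩ := hP f h1
  exact hb (hpf b hbf)

end NormalScheme


/-! ### The canonical divisor of the normalization -/

namespace FanoCover

section Equation

variable {F : Type u} [Field F] {n : ℕ}

/-- The equation on the `j`-th chart of the divisor that is `q` times the canonical divisor; `δ` is
the degree of the corresponding anticanonical form. -/
noncomputable def chartEquation (m : ℕ) (δ : ℤ) (x : Fin n → F) (j : Fin (n + 1)) : F :=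
  (∏ i, x i) ^ (m + 1) * homCoord x j ^ (-δ)

variable {m : ℕ} {δ : ℤ} {x : Fin n → F} (hx : ∀ i, x i ≠ 0) (j : Fin (n + 1))

include hx

theorem chartEquation_ne_zero : chartEquation m δ x j ≠ 0 :=
  mul_ne_zero (pow_ne_zero _ (Finset.prod_ne_zero_iff.mpr fun i _ => hx i))
    (zpow_ne_zero _ (homCoord_ne_zero hx j))

theorem dvrOrd_chartEquation {R : Type u} [CommRing R] [IsDomain R] [IsDiscreteValuationRing R]
    [Algebra R F] [IsFractionRing R F] : dvrOrd R (chartEquation m δ x j) =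
      (m + 1) * ∑ i, dvrOrd R (x i) - δ * dvrOrd R (homCoord x j) := by
  rw [chartEquation, dvrOrd_mul (pow_ne_zero _ (Finset.prod_ne_zero_iff.mpr fun i _ => hx i))
    (zpow_ne_zero _ (homCoord_ne_zero hx j)), dvrOrd_pow, dvrOrd_zpow,
    dvrOrd_prod _ _ fun i _ => hx i]
  push_cast
  ring

end Equation

/-- An affine open cover `V` of `X` like the cover of the normalization of projective space by the
preimages of its standard charts. -/
structure IsNormalizationCover (K : Type u) [Field K] {X : Scheme.{u}} [IsIntegral X]
    [Algebra K X.functionField] {n : ℕ} (x : Fin n → X.functionField)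
    (V : Fin (n + 1) → X.Opens) [∀ j, Nonempty (V j)] : Prop where
  isAffineOpen : ∀ j, IsAffineOpen (V j)
  exists_mem : ∀ y : X, ∃ j, y ∈ V j
  mem_range_iff : ∀ j f, f ∈ (algebraMap Γ(X, V j) X.functionField).range ↔
    IsIntegral (chartAlgebra K x j) f
  mem_of_mem_range : ∀ i j, ∀ y ∈ V i, homCoord x j / homCoord x i ∈
    (algebraMap (X.presheaf.stalk y) X.functionField).range → y ∈ V j

namespace IsNormalizationCover

section Stalks

variable {K : Type u} [Field K] {X : Scheme.{u}} [IsIntegral X] [Algebra K X.functionField] {n : ℕ}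
  {x : Fin n → X.functionField} {V : Fin (n + 1) → X.Opens} [∀ j, Nonempty (V j)]
  (hV : IsNormalizationCover K x V) {j : Fin (n + 1)} {y : X} (hy : y ∈ V j)

include hV hy

theorem mem_range_stalk {f : X.functionField} (hf : IsIntegral (chartAlgebra K x j) f) :
    f ∈ (algebraMap (X.presheaf.stalk y) X.functionField).range := by
  obtain ⟨a, rfl⟩ := (hV.mem_range_iff j f).mpr hf
  let _ := TopCat.Presheaf.algebra_section_stalk X.presheaf (⟨y, hy⟩ : V j)
  have := functionField_isScalarTower X (V j) ⟨y, hy⟩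
  exact ⟨algebraMap _ _ a, (IsScalarTower.algebraMap_apply _ _ _ a).symm⟩

theorem div_mem_range_stalk (hx : ∀ i, x i ≠ 0) (i : Fin (n + 1)) :
    homCoord x j / homCoord x i ∈ (algebraMap (X.presheaf.stalk y) X.functionField).range :=
  hV.mem_range_stalk hy <| isIntegral_algebraMap (R := chartAlgebra K x j)
    (x := (⟨_, homCoord_div_mem_chartAlgebra hx j i⟩ : chartAlgebra K x j))

theorem exists_isIntegral_mul_eq (r : X.presheaf.stalk y) : ∃ (a : X.functionField)
    (s : X.presheaf.stalk y), IsIntegral (chartAlgebra K x j) a ∧ IsUnit s ∧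
      IsIntegral (chartAlgebra K x j) (algebraMap _ X.functionField s) ∧
      algebraMap _ X.functionField r * algebraMap _ X.functionField s = a := by
  let _ := TopCat.Presheaf.algebra_section_stalk X.presheaf (⟨y, hy⟩ : V j)
  have := functionField_isScalarTower X (V j) ⟨y, hy⟩
  have := (hV.isAffineOpen j).isLocalization_stalk ⟨y, hy⟩
  obtain ⟨a, s, rfl⟩ := IsLocalization.exists_mk'_eq
    ((hV.isAffineOpen j).primeIdealOf ⟨y, hy⟩).asIdeal.primeCompl r
  refine ⟨algebraMap _ _ a, algebraMap _ _ s.1, (hV.mem_range_iff j _).mp ⟨_, rfl⟩,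
    IsLocalization.map_units _ s, (hV.mem_range_iff j _).mp
      ⟨_, IsScalarTower.algebraMap_apply _ (X.presheaf.stalk y) _ s.1⟩, ?_⟩
  rw [← map_mul, IsLocalization.mk'_spec]
  exact (IsScalarTower.algebraMap_apply _ _ _ a).symm

end Stalks

variable {k : Type u} [Field k] {X : Scheme.{u}} [IsIntegral X]
  [Algebra (RatFunc k) X.functionField] {n m q : ℕ}
  {x u : Fin n → X.functionField} {V : Fin (n + 1) → X.Opens} [∀ j, Nonempty (V j)]
  (hV : IsNormalizationCover (RatFunc k) x V)

include hV

/-- A fraction a / s of integral elements is rewritten as a s ^ (q - 1) / s ^ q, with denominator in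
the chart ring. -/
theorem isRootLocalization (hF : IsCurvePowerField k m q x u) (p : ℕ) [Fact p.Prime]
    [CharP X.functionField p] {r : ℕ} (hq : q = p ^ r) {j : Fin (n + 1)} {P : X} (hP : P ∈ V j)
    [IsDiscreteValuationRing (X.presheaf.stalk P)] :
    IsRootLocalization (chartAlgebra (RatFunc k) x j).toSubring q (X.presheaf.stalk P) where
  mem s hs := hV.mem_range_stalk hP <| isIntegral_algebraMap (R := chartAlgebra (RatFunc k) x j)
    (x := (⟨s, hs⟩ : chartAlgebra (RatFunc k) x j))
  exists_mul_eq c := by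
    obtain ⟨a, s, ha, hs, hs', hcs⟩ := hV.exists_isIntegral_mul_eq hP c
    have hq0 : 0 < q := hq ▸ pow_pos (Fact.out : p.Prime).pos r
    have h1 := hF.pow_mem_chartAlgebra p hq j ha
    have h2 := hF.pow_mem_chartAlgebra p hq j hs'
    refine ⟨a * algebraMap _ X.functionField s ^ (q - 1), algebraMap _ X.functionField s ^ q, h2, ?_,
      pow_ne_zero _ (by simpa using hs.ne_zero), ?_, ?_⟩
    · rw [mul_pow, ← pow_mul, mul_comm (q - 1), pow_mul]
      exact mul_mem h1 (pow_mem h2 _)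
    · rw [dvrOrd_pow, (isUnit_iff_dvrOrd_eq_zero hs.ne_zero).mp hs, mul_zero]
    · rw [← hcs, mul_assoc, ← pow_succ', Nat.sub_add_cancel hq0]

end IsNormalizationCover

end FanoCover


/-! ### Ampleness and discrepancies from the chart equations -/

namespace FanoCover.IsNormalizationCover

variable {k : Type u} [Field k] {X : Scheme.{u}} [IsIntegral X] [IsLocallyNoetherian X]
  [Algebra (RatFunc k) X.functionField] {n m q : ℕ}
  {x u : Fin n → X.functionField} {V : Fin (n + 1) → X.Opens} [∀ j, Nonempty (V j)]
  (hV : IsNormalizationCover (RatFunc k) x V)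
  (hX : ∀ y : X, IsIntegrallyClosed (X.presheaf.stalk y))

open IsCurvePowerField

include hX in
theorem ord_chartEquation (hx : ∀ i, x i ≠ 0) {δ : ℤ} {P : X} (hP : Order.coheight P = 1)
    (j : Fin (n + 1)) : X.ord (chartEquation m δ x j) P =
      (m + 1) * ∑ i, X.ord (x i) P - δ * X.ord (homCoord x j) P := by
  have := hX P
  have := isDiscreteValuationRing_stalk hP
  simp only [ord_eq_dvrOrd hP, chartEquation_ne_zero hx, homCoord_ne_zero hx, hx, ne_eq,
    not_false_eq_true, dvrOrd_chartEquation hx]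

include hV hX in
theorem ord_homCoord_le (hx : ∀ i, x i ≠ 0) {P : X} (hP : Order.coheight P = 1) {j : Fin (n + 1)}
    (hPj : P ∈ V j) (i : Fin (n + 1)) : X.ord (homCoord x i) P ≤ X.ord (homCoord x j) P := by
  have := hX P
  have := isDiscreteValuationRing_stalk hP
  have h1 := (exists_algebraMap_eq_iff (div_ne_zero (homCoord_ne_zero hx j)
    (homCoord_ne_zero hx i))).mp (hV.div_mem_range_stalk hPj hx i)
  rw [dvrOrd_div (homCoord_ne_zero hx j) (homCoord_ne_zero hx i)] at h1
  rw [ord_eq_dvrOrd hP (homCoord_ne_zero hx j), ord_eq_dvrOrd hP (homCoord_ne_zero hx i)]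
  linarith

-- The j-th chart equation is a section of 𝒪(-qD) whose divisor on the i-th chart is δ · div(Xᵢ /
-- Xⱼ), that is, δ · div(Yⱼ / Yᵢ). As δ > 0, it is effective and its support is the complement of
-- the affine open set Vⱼ.
include hV hX in
theorem isQAmpleDivisor (hx : ∀ i, x i ≠ 0) {D : X → ℤ} {δ : ℤ} (hδ : 0 < δ) (hq0 : 0 < q)
    (hD : ∀ j, ∀ P ∈ V j, Order.coheight P = 1 → q * D P = X.ord (chartEquation m δ x j) P) :
    IsQAmpleDivisor X (fun P => -D P) := by
  have key : ∀ (P : X) (i j), P ∈ V i → Order.coheight P = 1 →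
      X.ord (chartEquation m δ x j) P + (1 : ℕ) * (q * -D P) =
        δ * (X.ord (homCoord x i) P - X.ord (homCoord x j) P) := by
    intro P i j hPi hP
    have h1 := hD i P hPi hP
    rw [ord_chartEquation hX hx hP] at h1 ⊢
    push_cast
    linarith
  refine ⟨q, hq0, fun y => ?_, fun y => ?_⟩ <;> obtain ⟨j, hj⟩ := hV.exists_mem y
  · refine ⟨V j, (chartEquation m δ x j)⁻¹, hj, inv_ne_zero (chartEquation_ne_zero hx j),
      fun P hPj hP => ?_⟩
    have := hX P
    have := isDiscreteValuationRing_stalk hP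
    have h1 := hD j P hPj hP
    rw [ord_eq_dvrOrd hP (chartEquation_ne_zero hx j)] at h1
    rw [ord_eq_dvrOrd hP (inv_ne_zero (chartEquation_ne_zero hx j)), dvrOrd_inv, ← h1]
    ring
  · refine ⟨1, chartEquation m δ x j, V j, one_pos, chartEquation_ne_zero hx j, fun P hP => ?_,
      fun z => ⟨fun hz P hP hPz => ?_, fun hz => ?_⟩, hV.isAffineOpen j, hj⟩
    · obtain ⟨i, hi⟩ := hV.exists_mem P
      rw [key P i j hi hP]
      exact mul_nonneg hδ.le (sub_nonneg.mpr (hV.ord_homCoord_le hX hx hP hi j))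
    · rw [key P j j (hPz.mem_open (V j).isOpen hz) hP, sub_self, mul_zero]
    · obtain ⟨i, hi⟩ := hV.exists_mem z
      -- Off the support, Xⱼ / Xᵢ has no pole in codimension one, so it is regular at z by
      -- normality.
      refine hV.mem_of_mem_range i j z hi (mem_range_stalk_of_forall_ord_nonneg hX
        (div_ne_zero (homCoord_ne_zero hx j) (homCoord_ne_zero hx i)) fun P hPz hP => ?_)
      have := hX P
      have := isDiscreteValuationRing_stalk hP
      have h1 := hz P hP hPz
      rw [key P i j (hPz.mem_open (V i).isOpen hi) hP, ord_eq_dvrOrd hP (homCoord_ne_zero hx i),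
        ord_eq_dvrOrd hP (homCoord_ne_zero hx j)] at h1
      have h2 := (mul_eq_zero.mp h1).resolve_left hδ.ne'
      rw [ord_eq_dvrOrd hP (div_ne_zero (homCoord_ne_zero hx j) (homCoord_ne_zero hx i)),
        dvrOrd_div (homCoord_ne_zero hx j) (homCoord_ne_zero hx i)]
      linarith

include hX in
/-- Rational functions with the same divisor near the centre of `R` have the same order in `R`. -/
theorem _root_.dvrOrd_eq_of_hasCentre {R : Type u} [CommRing R] [IsDomain R]
    [IsDiscreteValuationRing R] [Algebra R X.functionField] [IsFractionRing R X.functionField]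
    {y : X} (hy : HasCentre X R y) {f g : X.functionField} (hf : f ≠ 0) (hg : g ≠ 0)
    (hfg : ∀ P : X, P ⤳ y → Order.coheight P = 1 → X.ord f P = X.ord g P) :
    dvrOrd R f = dvrOrd R g := by
  obtain ⟨φ, -, hφ⟩ := hy
  have key : ∀ f g : X.functionField, f ≠ 0 → g ≠ 0 →
      (∀ P : X, P ⤳ y → Order.coheight P = 1 → X.ord f P = X.ord g P) →
      dvrOrd R g ≤ dvrOrd R f := by
    intro f g hf hg hfg
    obtain ⟨a, ha⟩ := mem_range_stalk_of_forall_ord_nonneg hX (y := y) (div_ne_zero hf hg)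
      fun P hPy hP => by
        have := hX P
        have := isDiscreteValuationRing_stalk hP
        have h1 := hfg P hPy hP
        rw [ord_eq_dvrOrd hP hf, ord_eq_dvrOrd hP hg] at h1
        rw [ord_eq_dvrOrd hP (div_ne_zero hf hg), dvrOrd_div hf hg, h1, sub_self]
    have h2 := (exists_algebraMap_eq_iff (R := R) (div_ne_zero hf hg)).mp
      ⟨φ a, by rw [← ha, ← hφ]; rfl⟩
    rw [dvrOrd_div hf hg] at h2
    linarith
  exact le_antisymm (key g f hg hf fun P hPy hP => (hfg P hPy hP).symm) (key f g hf hg hfg)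

variable [Algebra k X.functionField] [IsScalarTower k (RatFunc k) X.functionField]
  (hF : IsCurvePowerField k m q x u) (p : ℕ) [Fact p.Prime]
  [CharP X.functionField p] {r : ℕ} (hq : q = p ^ r) (hm : 2 ≤ m) (hpm : ¬ p ∣ m)
  (hn : m * (q - 1) ≤ n) (h : n + 1 = Cardinal.toNat (Algebra.trdeg k X.functionField))

-- A chart is chosen at each P to define D; the formula holds on every chart through P because local
-- equations of a form differ by units.
include hV hX hF hq hm hpm hn in
theorem exists_isCanonicalDivisor [IsAlgClosed k] (hη : volForm h u ≠ 0) :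
    ∃ D : X → ℤ, IsCanonicalDivisor X k (volForm h u) D ∧
      ∀ j, ∀ P ∈ V j, Order.coheight P = 1 →
        q * D P = X.ord (chartEquation m (n + 1 - m * (q - 1)) x j) P := by
  have key : ∀ (P : X) (j), P ∈ V j → Order.coheight P = 1 →
      ∃ f, IsFormEquation k (X.presheaf.stalk P) (volForm h u) f ∧
        q * X.ord f P = X.ord (chartEquation m (n + 1 - m * (q - 1)) x j) P := by
    intro P j hPj hP
    have := hX P
    have := isDiscreteValuationRing_stalk hP
    obtain ⟨f, hf, hf'⟩ := hF.exists_isFormEquation_of_isRootLocalization p hq hm hpm hn h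
      (hV.isRootLocalization hF p hq hPj)
    refine ⟨f, hf, ?_⟩
    rw [ord_eq_dvrOrd hP hf.1, ord_eq_dvrOrd hP (chartEquation_ne_zero hF.x_ne_zero j),
      dvrOrd_chartEquation hF.x_ne_zero, hf']
  choose f hf hf' using fun P : X => fun hP : Order.coheight P = 1 =>
    key P (hV.exists_mem P).choose (hV.exists_mem P).choose_spec hP
  classical
  refine ⟨fun P => if hP : Order.coheight P = 1 then X.ord (f P hP) P else 0,
    ⟨hη, fun P hP => ⟨f P hP, hf P hP, dif_pos hP⟩⟩, fun j P hPj hP => ?_⟩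
  simp only [dif_pos hP]
  have := hX P
  have := isDiscreteValuationRing_stalk hP
  obtain ⟨g, hg, hg'⟩ := key P j hPj hP
  rw [← hg', ord_eq_dvrOrd hP hg.1, ord_eq_dvrOrd hP (hf P hP).1, (hf P hP).dvrOrd_eq hη hg]

include hV hX hF hq hm hpm hn in
theorem isAntiCanonicalAmple [IsAlgClosed k] : IsAntiCanonicalAmple X k := by
  have h := hF.trdeg_eq p hq
  have hmF : (m : X.functionField) ≠ 0 := by rwa [Ne, CharP.cast_eq_zero_iff X.functionField p]
  have hq0 : 0 < q := hq ▸ pow_pos (Fact.out : p.Prime).pos r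
  obtain ⟨D, hD, hD'⟩ := hV.exists_isCanonicalDivisor hX hF p hq hm hpm hn h
    (hF.wedge_ne_zero hmF h)
  refine ⟨_, D, hD, hV.isQAmpleDivisor hX hF.x_ne_zero ?_ hq0 hD'⟩
  zify [hq0] at hn
  linarith

-- Multiplied by q, the discrepancy becomes q · ord_E η minus the order of the chart equation, so
-- `exists_isFormEquation_of_le` is exactly what is needed.
include hV hX hF hq hm hpm hn in
theorem hasCanonicalSing [IsAlgClosed k] : HasCanonicalSing X k (RatFunc k) := by
  have h := hF.trdeg_eq p hq
  have hmF : (m : X.functionField) ≠ 0 := by rwa [Ne, CharP.cast_eq_zero_iff X.functionField p]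
  have hq0 : 0 < q := hq ▸ pow_pos (Fact.out : p.Prime).pos r
  obtain ⟨D, hD, hD'⟩ := hV.exists_isCanonicalDivisor hX hF p hq hm hpm hn h
    (hF.wedge_ne_zero hmF h)
  have hx := hF.x_ne_zero
  refine ⟨volForm h u, D, hD, ⟨q, hq0, fun y => ?_⟩, ?_⟩
  · obtain ⟨j, hj⟩ := hV.exists_mem y
    exact ⟨V j, _, hj, chartEquation_ne_zero hx j, hD' j⟩
  intro R _ _ _ _ _ _ _ _ y hy _
  obtain ⟨j, hj⟩ := hV.exists_mem y
  let _ : Algebra k R := ((algebraMap (RatFunc k) R).comp (algebraMap k (RatFunc k))).toAlgebra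
  have : IsScalarTower k (RatFunc k) R := .of_algebraMap_eq fun _ => rfl
  have : IsScalarTower k R X.functionField := .of_algebraMap_eq fun c => by
    rw [IsScalarTower.algebraMap_apply k (RatFunc k) R, ← IsScalarTower.algebraMap_apply,
      ← IsScalarTower.algebraMap_apply]
  have : Algebra.EssFiniteType k R := .comp k (RatFunc k) R
  obtain ⟨f, hf, hf'⟩ := hF.exists_isFormEquation_of_le (R := R) p hq hm hpm hn h
    (fun c => ⟨algebraMap _ R c, (IsScalarTower.algebraMap_apply _ R _ c).symm⟩)
    (j := j) fun i => by
      obtain ⟨a, ha⟩ := hV.div_mem_range_stalk hj hx i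
      obtain ⟨φ, -, hφ⟩ := hy
      have h2 := (exists_algebraMap_eq_iff (R := R) (div_ne_zero (homCoord_ne_zero hx j)
        (homCoord_ne_zero hx i))).mp ⟨φ a, by rw [← ha, ← hφ]; rfl⟩
      rw [dvrOrd_div (homCoord_ne_zero hx j) (homCoord_ne_zero hx i)] at h2
      linarith
  refine ⟨f, hf, fun s g U hs hyU hg => ?_⟩
  rw [← dvrOrd_chartEquation (δ := n + 1 - m * (q - 1)) hx] at hf'
  set e := chartEquation m (n + 1 - m * (q - 1)) x j with he
  have he0 : e ≠ 0 := chartEquation_ne_zero hx j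
  -- Both are equations of qs K near the centre, so their quotient is a unit there.
  have h1 : dvrOrd R (g ^ q) = dvrOrd R (e ^ s) := by
    refine dvrOrd_eq_of_hasCentre hX hy (pow_ne_zero _ hg.1) (pow_ne_zero _ he0)
      fun P hPy hP => ?_
    have := hX P
    have := isDiscreteValuationRing_stalk hP
    have h2 := hg.2 P (hPy.mem_open U.isOpen hyU) hP
    have h3 := hD' j P (hPy.mem_open (V j).isOpen hj) hP
    rw [← he, ord_eq_dvrOrd hP he0] at h3
    rw [ord_eq_dvrOrd hP hg.1] at h2
    rw [ord_eq_dvrOrd hP (pow_ne_zero _ hg.1), ord_eq_dvrOrd hP (pow_ne_zero _ he0), dvrOrd_pow,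
      dvrOrd_pow, ← h2, ← h3]
    ring
  rw [dvrOrd_pow, dvrOrd_pow] at h1
  change (0 : ℚ) ≤ (dvrOrd R f : ℚ) - 1 / s * (dvrOrd R g : ℚ)
  have hq' : (0 : ℚ) < q := by exact_mod_cast hq0
  have hs' : (0 : ℚ) < s := by exact_mod_cast hs
  have h2 : (q : ℚ) * dvrOrd R g = s * dvrOrd R e := by exact_mod_cast h1
  have h3 : (dvrOrd R e : ℚ) ≤ q * dvrOrd R f := by exact_mod_cast hf'
  have h4 : (q : ℚ) * (dvrOrd R f - 1 / s * dvrOrd R g) = q * dvrOrd R f - dvrOrd R e := by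
    have : (1 / s : ℚ) * (q * dvrOrd R g) = dvrOrd R e := by
      rw [h2]
      field_simp
    linear_combination -this
  exact nonneg_of_mul_nonneg_right (by rw [h4]; linarith) hq'

end FanoCover.IsNormalizationCover


/-! ### Finiteness of the normalization -/

section Frobenius

theorem RingHom.Finite.of_comp_injective {A B C : Type*} [CommRing A] [CommRing B] [CommRing C]
    [IsNoetherianRing A] {f : A →+* B} {g : B →+* C} (hg : Function.Injective g)
    (h : (g.comp f).Finite) : f.Finite := by
  algebraize [f, g, g.comp f]
  exact Module.Finite.of_injective (IsScalarTower.toAlgHom A B C).toLinearMap hg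

theorem iterateFrobenius_isIntegral (A : Type*) [CommRing A] (p : ℕ) [Fact p.Prime] [CharP A p]
    (r : ℕ) : (iterateFrobenius A p r).IsIntegral := by
  intro a
  have hq : 0 < p ^ r := pow_pos (Fact.out : p.Prime).pos r
  refine ⟨Polynomial.X ^ (p ^ r) - Polynomial.C a, Polynomial.monic_X_pow_sub_C a hq.ne', ?_⟩
  simp [iterateFrobenius_def]

/-- K is generated by t over its q-th powers: k is perfect, and a / b = a b ^ (q - 1) · (1 / b) ^ q.
-/
theorem RatFunc.iterateFrobenius_finiteType (k : Type u) [Field k] (p : ℕ) [Fact p.Prime]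
    [CharP k p] [PerfectRing k p] (r : ℕ) :
    (iterateFrobenius (RatFunc k) p r).FiniteType := by
  have hq : 0 < p ^ r := pow_pos (Fact.out : p.Prime).pos r
  have h1 : (Polynomial.eval₂RingHom (iterateFrobenius (RatFunc k) p r) RatFunc.X).FiniteType := by
    apply RingHom.FiniteType.of_surjective
    have hpoly : ∀ P : Polynomial k, ∃ Q, Polynomial.eval₂RingHom
        (iterateFrobenius (RatFunc k) p r) RatFunc.X Q = algebraMap _ (RatFunc k) P := by
      intro P
      refine ⟨P.map ((algebraMap k (RatFunc k)).comp (iterateFrobeniusEquiv k p r).symm), ?_⟩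
      rw [Polynomial.coe_eval₂RingHom, Polynomial.eval₂_map]
      have h2 : (iterateFrobenius (RatFunc k) p r).comp
          ((algebraMap k (RatFunc k)).comp ((iterateFrobeniusEquiv k p r).symm : k →+* k)) =
            algebraMap k (RatFunc k) := by
        ext c
        simp only [RingHom.comp_apply]
        rw [← RingHom.map_iterateFrobenius]
        congr 1
        exact (iterateFrobeniusEquiv k p r).apply_symm_apply c
      rw [h2, ← Polynomial.aeval_def, ← RatFunc.algebraMap_X, Polynomial.aeval_algebraMap_apply,
        Polynomial.aeval_X_left_apply]
    intro z
    obtain ⟨a, b, hb, rfl⟩ := IsFractionRing.div_surjective (A := Polynomial k) z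
    have hb' : algebraMap _ (RatFunc k) b ≠ 0 := by simpa using nonZeroDivisors.ne_zero hb
    obtain ⟨Q, hQ⟩ := hpoly (a * b ^ (p ^ r - 1))
    refine ⟨Polynomial.C (algebraMap _ (RatFunc k) b)⁻¹ * Q, ?_⟩
    rw [map_mul, hQ, Polynomial.coe_eval₂RingHom, Polynomial.eval₂_C, iterateFrobenius_def,
      map_mul, map_pow]
    obtain ⟨e, he⟩ : ∃ e, p ^ r = e + 1 := ⟨p ^ r - 1, by omega⟩
    rw [he, Nat.add_sub_cancel, inv_pow, pow_succ]
    field_simp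
  have h2 : (Polynomial.C : RatFunc k →+* Polynomial (RatFunc k)).FiniteType :=
    RingHom.finiteType_algebraMap.mpr
      (inferInstance : Algebra.FiniteType (RatFunc k) (Polynomial (RatFunc k)))
  have h3 := h1.comp h2
  have h4 : (Polynomial.eval₂RingHom (iterateFrobenius (RatFunc k) p r) RatFunc.X).comp
      Polynomial.C = iterateFrobenius (RatFunc k) p r := by ext; simp
  rwa [h4] at h3

/-- The Frobenius map is always integral, so finite type suffices, and that is inherited from K. -/
theorem iterateFrobenius_finite_of_finiteType {K A : Type*} [CommRing K] [CommRing A] [Algebra K A]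
    [Algebra.FiniteType K A] (p : ℕ) [Fact p.Prime] [CharP K p] [CharP A p] {r : ℕ}
    (h : (iterateFrobenius K p r).FiniteType) : (iterateFrobenius A p r).Finite := by
  refine (iterateFrobenius_isIntegral A p r).to_finite ?_
  have h1 : (algebraMap K A).FiniteType := RingHom.finiteType_algebraMap.mpr inferInstance
  have h2 := h1.comp h
  have h3 : (algebraMap K A).comp (iterateFrobenius K p r) =
      (iterateFrobenius A p r).comp (algebraMap K A) := by
    ext c
    exact (algebraMap K A).map_iterateFrobenius p c r
  rw [h3] at h2
  exact h2.of_comp_finiteType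

end Frobenius

theorem germToFunctionField_appLE {X : Scheme.{u}} [IsIntegral X] {K : Type u} [Field K]
    (s : X ⟶ Spec (CommRingCat.of K)) (U : X.Opens) [Nonempty U] (c : Γ(Spec (.of K), ⊤)) :
    algebraMap Γ(X, U) X.functionField (s.appLE ⊤ U le_top c) =
      baseToFunctionField s ((Scheme.ΓSpecIso (CommRingCat.of K)).hom c) := by
  have h : s.appLE ⊤ U le_top ≫ X.germToFunctionField U =
      (Scheme.ΓSpecIso (CommRingCat.of K)).hom ≫ (Scheme.ΓSpecIso (CommRingCat.of K)).inv ≫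
        s.appTop ≫ X.presheaf.germ ⊤ (genericPoint X) trivial := by
    rw [Iso.hom_inv_id_assoc]
    change (s.app ⊤ ≫ X.presheaf.map _) ≫ X.presheaf.germ U (genericPoint X) _ = _
    rw [Category.assoc, TopCat.Presheaf.germ_res]
    rfl
  exact congr($h c)

/-! ### Finiteness of the integral closure, normality and finite type -/

namespace FanoCover

/-- The q-th power map embeds the integral closure in the noetherian ring S, and S is finite over
itself through this map. Thus inseparability of the field extension does no harm. -/
theorem IsCurvePowerField.finite_integralClosure {k F : Type u} [Field k] [Field F]
    [Algebra (RatFunc k) F] {n m q : ℕ} {x u : Fin n → F} (hF : IsCurvePowerField k m q x u)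
    (p : ℕ) [Fact p.Prime] [CharP k p] [PerfectRing k p] [CharP F p] {r : ℕ} (hq : q = p ^ r)
    (j : Fin (n + 1)) : Module.Finite (chartAlgebra (RatFunc k) x j)
      (integralClosure (chartAlgebra (RatFunc k) x j) F) := by
  subst hq
  set S := chartAlgebra (RatFunc k) x j with hS
  have : Algebra.FiniteType (RatFunc k) S :=
    Algebra.FiniteType.adjoin_of_finite (Set.finite_range _)
  have : IsNoetherianRing S := Algebra.FiniteType.isNoetherianRing (RatFunc k) S
  have : CharP S p := (algebraMap S F).charP (FaithfulSMul.algebraMap_injective S F) p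
  have h1 := iterateFrobenius_finite_of_finiteType (A := S) p
    (RatFunc.iterateFrobenius_finiteType k p r)
  let g : integralClosure S F →+* S :=
    ((iterateFrobenius F p r).comp (integralClosure S F).val.toRingHom).codRestrict S
      fun b => hF.pow_mem_chartAlgebra p rfl j b.2
  have hg : Function.Injective g := by
    intro a b hab
    exact Subtype.ext (iterateFrobenius_inj F p r (congrArg Subtype.val hab))
  have h2 : g.comp (algebraMap S (integralClosure S F)) = iterateFrobenius S p r := by
    ext c
    rfl
  rw [← h2] at h1
  exact RingHom.finite_algebraMap.mp (RingHom.Finite.of_comp_injective hg h1)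

namespace IsNormalizationCover

section

variable {K : Type u} [Field K] {X : Scheme.{u}} [IsIntegral X] [Algebra K X.functionField] {n : ℕ}
  {x : Fin n → X.functionField} {V : Fin (n + 1) → X.Opens} [∀ j, Nonempty (V j)]
  (hV : IsNormalizationCover K x V)

include hV

theorem isIntegrallyClosed_section (j : Fin (n + 1)) : IsIntegrallyClosed Γ(X, V j) := by
  have := functionField_isFractionRing_of_isAffineOpen X (V j) (hV.isAffineOpen j)
  refine (isIntegrallyClosed_iff X.functionField).mpr fun {f} hf => ?_
  refine (hV.mem_range_iff j f).mpr (isIntegral_trans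
    (A := integralClosure (chartAlgebra K x j) X.functionField) f ?_)
  let φ : Γ(X, V j) →+* integralClosure (chartAlgebra K x j) X.functionField :=
    (algebraMap Γ(X, V j) X.functionField).codRestrict _
      fun a => (hV.mem_range_iff j _).mp ⟨a, rfl⟩
  exact IsIntegral.map_of_comp_eq φ (RingHom.id _) (by ext; rfl) hf

theorem isIntegrallyClosed_stalk (y : X) : IsIntegrallyClosed (X.presheaf.stalk y) := by
  obtain ⟨j, hj⟩ := hV.exists_mem y
  have := hV.isIntegrallyClosed_section j
  let _ := TopCat.Presheaf.algebra_section_stalk X.presheaf (⟨y, hj⟩ : V j)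
  have := (hV.isAffineOpen j).isLocalization_stalk ⟨y, hj⟩
  exact isIntegrallyClosed_of_isLocalization _
    ((hV.isAffineOpen j).primeIdealOf ⟨y, hj⟩).asIdeal.primeCompl
    (Ideal.primeCompl_le_nonZeroDivisors _)

end

theorem locallyOfFiniteType {k : Type u} [Field k] {X : Scheme.{u}} [IsIntegral X]
    {s : X ⟶ Spec (CommRingCat.of (RatFunc k))} {n m q : ℕ} {x u : Fin n → X.functionField}
    {V : Fin (n + 1) → X.Opens} [∀ j, Nonempty (V j)]
    (hV : letI := functionFieldAlgebra s; IsNormalizationCover (RatFunc k) x V)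
    (hF : letI := functionFieldAlgebra s; IsCurvePowerField k m q x u)
    (p : ℕ) [Fact p.Prime] [CharP k p] [PerfectRing k p] [CharP X.functionField p] {r : ℕ}
    (hq : q = p ^ r) : LocallyOfFiniteType s := by
  let _ := functionFieldAlgebra s
  rw [HasRingHomProperty.iff_of_iSup_eq_top (P := @LocallyOfFiniteType)
    (fun j => (⟨V j, hV.isAffineOpen j⟩ : X.affineOpens)) (by
      rw [eq_top_iff]
      intro y _
      obtain ⟨j, hj⟩ := hV.exists_mem y
      exact TopologicalSpace.Opens.mem_iSup.mpr ⟨j, hj⟩)]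
  intro j
  have hinj : Function.Injective (algebraMap Γ(X, V j) X.functionField) :=
    X.germToFunctionField_injective (V j)
  set S := chartAlgebra (RatFunc k) x j with hS
  have h0 : Algebra.FiniteType (RatFunc k) S :=
    Algebra.FiniteType.adjoin_of_finite (Set.finite_range _)
  have h1 := hF.finite_integralClosure p hq j
  have h2 : Algebra.FiniteType S (integralClosure S X.functionField) := inferInstance
  let φ : Γ(X, V j) →+* integralClosure S X.functionField :=
    (algebraMap Γ(X, V j) X.functionField).codRestrict _
      fun a => (hV.mem_range_iff j _).mp ⟨a, rfl⟩
  have hφ : Function.Bijective φ := ⟨fun a b hab => hinj (congrArg Subtype.val hab), fun b => by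
    obtain ⟨a, ha⟩ := (hV.mem_range_iff j _).mpr b.2
    exact ⟨a, Subtype.ext ha⟩⟩
  let e := RingEquiv.ofBijective φ hφ
  have h3 : ((algebraMap S (integralClosure S X.functionField)).comp
      (algebraMap (RatFunc k) S)).FiniteType :=
    (RingHom.finiteType_algebraMap.mpr h2).comp (RingHom.finiteType_algebraMap.mpr h0)
  have h4 := (RingHom.FiniteType.of_surjective e.symm.toRingHom e.symm.surjective).comp h3
  have h5 := h4.comp (RingHom.FiniteType.of_surjective
    (Scheme.ΓSpecIso (CommRingCat.of (RatFunc k))).hom.hom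
    (Scheme.ΓSpecIso (CommRingCat.of (RatFunc k))).commRingCatIsoToRingEquiv.surjective)
  convert h5
  ext c
  apply hφ.1
  refine Subtype.ext ((germToFunctionField_appLE s (V j) c).trans ?_)
  exact congrArg Subtype.val (e.apply_symm_apply
    (algebraMap S (integralClosure S X.functionField) (algebraMap (RatFunc k) S
      ((Scheme.ΓSpecIso (CommRingCat.of (RatFunc k))).hom c)))).symm

end IsNormalizationCover

end FanoCover


/-! ### Field-valued points -/

section FieldPoint

variable {L : Type u} [Field L] {Z W : Scheme.{u}}

/-- The value of a section on an open set at a field-valued point of that set. -/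
noncomputable def fieldPtEval (g : Spec (.of L) ⟶ Z) (U : Z.Opens) (h : ⊤ ≤ g ⁻¹ᵁ U) :
    Γ(Z, U) →+* L :=
  (g.appLE U ⊤ h ≫ (Scheme.ΓSpecIso (.of L)).hom).hom

theorem fieldPtEval_comp (g : Spec (.of L) ⟶ Z) (f : Z ⟶ W) (U : W.Opens)
    (h : ⊤ ≤ (g ≫ f) ⁻¹ᵁ U) (a : Γ(W, U)) :
    fieldPtEval (g ≫ f) U h a = fieldPtEval g (f ⁻¹ᵁ U) h (f.app U a) := by
  have : (g ≫ f).appLE U ⊤ h = f.app U ≫ g.appLE (f ⁻¹ᵁ U) ⊤ h :=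
    Scheme.Hom.comp_appLE g f U ⊤ h
  simp only [fieldPtEval, this, CommRingCat.hom_comp, RingHom.comp_apply]

theorem fieldPtEval_congr {g g' : Spec (.of L) ⟶ Z} (hg : g = g') (U : Z.Opens)
    (h : ⊤ ≤ g ⁻¹ᵁ U) (h' : ⊤ ≤ g' ⁻¹ᵁ U) : fieldPtEval g U h = fieldPtEval g' U h' := by
  subst hg
  rfl

theorem fieldPtEval_SpecMap {R : CommRingCat.{u}} (φ : R ⟶ .of L) (a : R) :
    fieldPtEval (Spec.map φ) ⊤ le_top ((Scheme.ΓSpecIso R).inv a) = φ a := by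
  have : (Spec.map φ).appLE ⊤ ⊤ le_top = (Spec.map φ).appTop :=
    Scheme.Hom.appLE_eq_app (Spec.map φ)
  have h : (Scheme.ΓSpecIso R).inv ≫ (Spec.map φ).appLE ⊤ ⊤ le_top ≫
      (Scheme.ΓSpecIso (.of L)).hom = φ := by
    rw [this, Scheme.ΓSpecIso_naturality, Iso.inv_hom_id_assoc]
  exact congr($h a)

variable [IsIntegral Z]

theorem closedPoint_specializes_genericPoint (g : Spec (.of L) ⟶ Z) [IsDominant g] :
    g (IsLocalRing.closedPoint L) ⤳ genericPoint Z := by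
  have h : ∀ y : Spec (.of L), y = IsLocalRing.closedPoint L := fun y =>
    Subsingleton.elim (α := PrimeSpectrum L) _ _
  have h1 : Set.range g ⊆ {g (IsLocalRing.closedPoint L)} := by
    rintro _ ⟨y, rfl⟩
    rw [h y]
    rfl
  exact specializes_iff_mem_closure.mpr (closure_mono h1 (g.denseRange _))

/-- The embedding of the function field in `L` given by a dominant `L`-valued point. -/
noncomputable def functionFieldEval (g : Spec (.of L) ⟶ Z) [IsDominant g] :
    Z.functionField →+* L :=
  (Z.presheaf.stalkSpecializes (closedPoint_specializes_genericPoint g) ≫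
    Scheme.stalkClosedPointTo g).hom

theorem functionFieldEval_algebraMap (g : Spec (.of L) ⟶ Z) [IsDominant g] (U : Z.Opens)
    [Nonempty U] (h : ⊤ ≤ g ⁻¹ᵁ U) (a : Γ(Z, U)) :
    functionFieldEval g (algebraMap Γ(Z, U) Z.functionField a) = fieldPtEval g U h a := by
  have hU : g (IsLocalRing.closedPoint L) ∈ U := h trivial
  have h1 := Scheme.germ_stalkClosedPointTo g U hU
  have h2 : Z.germToFunctionField U ≫
      Z.presheaf.stalkSpecializes (closedPoint_specializes_genericPoint g) ≫
        Scheme.stalkClosedPointTo g = g.appLE U ⊤ h ≫ (Scheme.ΓSpecIso (.of L)).hom := by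
    rw [Scheme.germToFunctionField, TopCat.Presheaf.germ_stalkSpecializes_assoc, h1]
    simp [Scheme.Hom.appLE]
    rfl
  exact congr($h2 a)

end FieldPoint

section Normalization

variable {L : Type u} [Field L] {P : Scheme.{u}} (f : Spec (.of L) ⟶ P) [QuasiCompact f]
  [QuasiSeparated f]

/-- Over an affine open set the relative normalization is the spectrum of the integral closure; here
its sections are identified with elements of L. -/
theorem range_fieldPtEval_toNormalization {W : P.Opens} (hW : IsAffineOpen W) (h : ⊤ ≤ f ⁻¹ᵁ W)
    (h' : ⊤ ≤ f.toNormalization ⁻¹ᵁ f.fromNormalization ⁻¹ᵁ W) (b : L) :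
    b ∈ (fieldPtEval f.toNormalization (f.fromNormalization ⁻¹ᵁ W) h').range ↔
      (fieldPtEval f W h).IsIntegralElem b := by
  let _ := (f.app W).hom.toAlgebra
  have h1 := f.normalizationObjIso_hom_val hW
  let ψ : Γ(Spec (.of L), f ⁻¹ᵁ W) →+* L :=
    ((Spec (.of L)).presheaf.map (homOfLE h).op ≫ (Scheme.ΓSpecIso (.of L)).hom).hom
  have hψ : Function.Bijective ψ := by
    have : IsIso (homOfLE h) :=
      ⟨homOfLE (show f ⁻¹ᵁ W ≤ ⊤ from le_top), Subsingleton.elim _ _, Subsingleton.elim _ _⟩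
    exact ConcreteCategory.bijective_of_isIso
      ((Spec (.of L)).presheaf.map (homOfLE h).op ≫ (Scheme.ΓSpecIso (.of L)).hom)
  have h2 : fieldPtEval f.toNormalization (f.fromNormalization ⁻¹ᵁ W) h' =
      ψ.comp ((integralClosure Γ(P, W) Γ(Spec (.of L), f ⁻¹ᵁ W)).val.toRingHom.comp
        (f.normalizationObjIso hW).hom.hom) := by
    have h4 : f.toNormalization.appLE (f.fromNormalization ⁻¹ᵁ W) ⊤ h' ≫
        (Scheme.ΓSpecIso (.of L)).hom = ((f.normalizationObjIso hW).hom ≫ CommRingCat.ofHom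
          (integralClosure Γ(P, W) Γ(Spec (.of L), f ⁻¹ᵁ W)).val.toRingHom) ≫
            (Spec (.of L)).presheaf.map (homOfLE h).op ≫ (Scheme.ΓSpecIso (.of L)).hom := by
      rw [h1, Scheme.Hom.appLE_map_assoc]
    exact congr(($h4).hom)
  have h3 : fieldPtEval f W h = ψ.comp (f.app W).hom := rfl
  rw [h2, h3, RingHom.mem_range]
  constructor
  · rintro ⟨a, rfl⟩
    obtain ⟨Q, hQ, hQ'⟩ := ((f.normalizationObjIso hW).hom a).2
    refine ⟨Q, hQ, ?_⟩
    exact (Polynomial.hom_eval₂ _ _ ψ _).symm.trans ((congrArg ψ hQ').trans (map_zero ψ))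
  · rintro ⟨Q, hQ, hQ'⟩
    obtain ⟨b, rfl⟩ := hψ.2 b
    rw [← Polynomial.hom_eval₂, map_eq_zero_iff ψ hψ.1] at hQ'
    refine ⟨(f.normalizationObjIso hW).inv ⟨b, Q, hQ, hQ'⟩, ?_⟩
    simp only [RingHom.comp_apply]
    congr 1
    exact congrArg Subtype.val ((f.normalizationObjIso hW).commRingCatIsoToRingEquiv.apply_symm_apply
      (⟨b, Q, hQ, hQ'⟩ : integralClosure Γ(P, W) Γ(Spec (.of L), f ⁻¹ᵁ W)))

end Normalization


/-! ### Points of projective space with values in a field -/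

namespace FanoCover

open HomogeneousLocalization

section

variable (K : Type u) [Field K] (n : ℕ)

variable {n} in
theorem X_mem_grading (j : Fin (n + 1)) : MvPolynomial.X j ∈ grading K n 1 :=
  MvPolynomial.isHomogeneous_X K j

theorem adjoin_range_X_grading :
    Algebra.adjoin (grading K n 0)
      (Set.range (MvPolynomial.X : Fin (n + 1) → MvPolynomial (Fin (n + 1)) K)) = ⊤ := by
  rw [eq_top_iff]
  intro a _
  induction a using MvPolynomial.induction_on with
  | C c =>
    exact Subalgebra.algebraMap_mem (Algebra.adjoin (grading K n 0)
      (Set.range (MvPolynomial.X : Fin (n + 1) → MvPolynomial (Fin (n + 1)) K)))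
      (⟨MvPolynomial.C c, MvPolynomial.isHomogeneous_C _ c⟩ : grading K n 0)
  | add a b ha hb => exact add_mem (ha trivial) (hb trivial)
  | mul_X a i ha => exact mul_mem (ha trivial) (Algebra.subset_adjoin ⟨i, rfl⟩)

theorem exists_mem_basicOpen_X (z : projSpace K n) :
    ∃ j, z ∈ Proj.basicOpen (grading K n) (MvPolynomial.X j) := by
  have h := Proj.iSup_basicOpen_eq_top' (grading K n) MvPolynomial.X
    (fun i => ⟨1, X_mem_grading K i⟩) (adjoin_range_X_grading K n)
  exact TopologicalSpace.Opens.mem_iSup.mp (h ▸ trivial : z ∈ ⨆ i, _)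

instance isProper_projSpaceToSpec : IsProper (projSpaceToSpec K n) := by
  have : Algebra.FiniteType (grading K n 0) (MvPolynomial (Fin (n + 1)) K) :=
    ⟨(Set.finite_range MvPolynomial.X).toFinset, by
      simpa using adjoin_range_X_grading K n⟩
  have h : Function.Bijective (algebraMap K (grading K n 0)) := by
    refine ⟨fun a b hab => MvPolynomial.C_injective (Fin (n + 1)) K (congrArg Subtype.val hab),
      fun a => ?_⟩
    have h1 := MvPolynomial.totalDegree_eq_zero_iff_eq_C.mp
      (Nat.le_zero.mp (MvPolynomial.IsHomogeneous.totalDegree_le a.2))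
    exact ⟨MvPolynomial.coeff 0 a.1, Subtype.ext h1.symm⟩
  have : IsIso (CommRingCat.ofHom (algebraMap K (grading K n 0))) :=
    (ConcreteCategory.isIso_iff_bijective _).mpr h
  rw [projSpaceToSpec]
  infer_instance

variable {K n} {L : Type u} [Field L] [Algebra K L]

/-- Evaluation at the point `y` of quotients of forms with denominator a power of `f`. -/
noncomputable def projEval (y : Fin (n + 1) → L) (f : MvPolynomial (Fin (n + 1)) K)
    (hf : IsUnit (MvPolynomial.eval₂Hom (algebraMap K L) y f)) : Away (grading K n) f →+* L :=
  (Localization.awayLift (MvPolynomial.eval₂Hom (algebraMap K L) y) f hf).comp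
    (algebraMap (Away (grading K n) f) (Localization.Away f))

theorem projEval_mk (y : Fin (n + 1) → L) {f : MvPolynomial (Fin (n + 1)) K} {d : ℕ}
    (hd : f ∈ grading K n d) (hf : IsUnit (MvPolynomial.eval₂Hom (algebraMap K L) y f)) (i : ℕ)
    (a : MvPolynomial (Fin (n + 1)) K) (ha : a ∈ grading K n (i • d)) :
    projEval y f hf (Away.mk _ hd i a ha) =
      MvPolynomial.eval₂ (algebraMap K L) y a / MvPolynomial.eval₂ (algebraMap K L) y f ^ i := by
  rw [projEval, RingHom.comp_apply, HomogeneousLocalization.algebraMap_apply, Away.val_mk,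
    Localization.awayLift_mk _ _ _ (MvPolynomial.eval₂ (algebraMap K L) y f)⁻¹
      (mul_inv_cancel₀ hf.ne_zero)]
  rw [inv_pow, div_eq_mul_inv, MvPolynomial.coe_eval₂Hom]

theorem projEval_awayMap (y : Fin (n + 1) → L) {f g e : MvPolynomial (Fin (n + 1)) K} {d d' : ℕ}
    (hd : f ∈ grading K n d) (hd' : g ∈ grading K n d') (he : e = f * g)
    (hf : IsUnit (MvPolynomial.eval₂Hom (algebraMap K L) y f))
    (h : IsUnit (MvPolynomial.eval₂Hom (algebraMap K L) y e)) :
    (projEval y e h).comp (awayMap (grading K n) hd' he) = projEval y f hf := by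
  ext a
  obtain ⟨i, a, ha, rfl⟩ := Away.mk_surjective (grading K n) hd a
  have h' : MvPolynomial.eval₂ (algebraMap K L) y g ≠ 0 := by
    have := h.ne_zero
    rw [he, map_mul] at this
    exact right_ne_zero_of_mul this
  have hf' : MvPolynomial.eval₂ (algebraMap K L) y f ≠ 0 := hf.ne_zero
  rw [RingHom.comp_apply, awayMap_mk, projEval_mk, projEval_mk]
  subst he
  simp only [MvPolynomial.eval₂_mul, MvPolynomial.eval₂_pow]
  field_simp
  ring

theorem eval₂_div_pow (y : Fin (n + 1) → L) (c : L) {d : ℕ}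
    {a : MvPolynomial (Fin (n + 1)) K} (ha : a ∈ grading K n d) :
    MvPolynomial.eval₂ (algebraMap K L) y a / c ^ d =
      MvPolynomial.eval₂ (algebraMap K L) (fun i => y i / c) a := by
  rw [MvPolynomial.eval₂_eq', MvPolynomial.eval₂_eq', Finset.sum_div]
  refine Finset.sum_congr rfl fun s hs => ?_
  have h : ∑ i, s i = d := by
    have := ha (MvPolynomial.mem_support_iff.mp hs)
    rw [← this, Finsupp.weight_apply, Finsupp.sum_fintype _ _ (by simp)]
    simp
  simp_rw [div_pow, Finset.prod_div_distrib, Finset.prod_pow_eq_pow_sum, h]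
  ring

section Chart

variable {x : Fin n → L} (hx : ∀ i, x i ≠ 0)

include hx in
theorem isUnit_eval₂_X (j : Fin (n + 1)) : IsUnit (MvPolynomial.eval₂Hom (algebraMap K L)
    (fun i => (homCoord x i)⁻¹) (MvPolynomial.X j)) := by
  simpa using homCoord_ne_zero hx j

theorem projEval_X_div (i j : Fin (n + 1)) :
    projEval (K := K) (fun i => (homCoord x i)⁻¹) (MvPolynomial.X j) (isUnit_eval₂_X hx j)
      (Away.mk _ (X_mem_grading K j) 1 (MvPolynomial.X i)
        (by simpa using X_mem_grading K i)) = homCoord x j / homCoord x i := by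
  rw [projEval_mk]
  simp [div_eq_mul_inv, mul_comm]

theorem mem_range_projEval_iff (j : Fin (n + 1)) (b : L) :
    b ∈ (projEval (K := K) (fun i => (homCoord x i)⁻¹) (MvPolynomial.X j)
      (isUnit_eval₂_X hx j)).range ↔ b ∈ chartAlgebra K x j := by
  constructor
  · rintro ⟨a, rfl⟩
    obtain ⟨i, a, ha, rfl⟩ := Away.mk_surjective (grading K n) (X_mem_grading K j) a
    rw [projEval_mk, MvPolynomial.eval₂_X, eval₂_div_pow _ _ (by simpa using ha), ← MvPolynomial.aeval_def]
    have h : Algebra.adjoin K (Set.range fun i => (homCoord x i)⁻¹ / (homCoord x j)⁻¹) ≤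
        chartAlgebra K x j := Algebra.adjoin_le ?_
    · refine h ?_
      rw [Algebra.adjoin_range_eq_range_aeval]
      exact ⟨a, rfl⟩
    rintro _ ⟨i, rfl⟩
    simpa [div_eq_mul_inv, mul_comm] using homCoord_div_mem_chartAlgebra (K := K) hx j i
  · let S : Subalgebra K L :=
      { (projEval (K := K) (fun i => (homCoord x i)⁻¹) (MvPolynomial.X j)
          (isUnit_eval₂_X hx j)).range with
        algebraMap_mem' := fun c => ⟨Away.mk _ (X_mem_grading K j) 0
          (MvPolynomial.C c) (by simp), by
            rw [projEval_mk]
            simp⟩ }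
    intro hb
    refine Algebra.adjoin_le (S := S) ?_ hb
    rintro _ ⟨i, rfl⟩
    exact ⟨_, projEval_X_div hx (j.succAbove i) j⟩

/-- Both points factor through the overlap of the two charts, where the product of the two
coordinates is invertible. So the point defined on chart 0 can be read on any chart. -/
theorem SpecMap_projEval_awayι (i j : Fin (n + 1)) :
    Spec.map (CommRingCat.ofHom (projEval (K := K) (fun i => (homCoord x i)⁻¹) (MvPolynomial.X i)
        (isUnit_eval₂_X hx i))) ≫ Proj.awayι (grading K n) (MvPolynomial.X i)
          (X_mem_grading K i) Nat.one_pos =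
      Spec.map (CommRingCat.ofHom (projEval (K := K) (fun i => (homCoord x i)⁻¹) (MvPolynomial.X j)
        (isUnit_eval₂_X hx j))) ≫ Proj.awayι (grading K n) (MvPolynomial.X j)
          (X_mem_grading K j) Nat.one_pos := by
  have h : IsUnit (MvPolynomial.eval₂Hom (algebraMap K L) (fun i => (homCoord x i)⁻¹)
      (MvPolynomial.X i * MvPolynomial.X j)) := by
    rw [map_mul]
    exact (isUnit_eval₂_X hx i).mul (isUnit_eval₂_X hx j)
  rw [← projEval_awayMap _ (X_mem_grading K i) (X_mem_grading K j)
    rfl (isUnit_eval₂_X hx i) h, ← projEval_awayMap _ (X_mem_grading K j)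
    (X_mem_grading K i) (mul_comm _ _) (isUnit_eval₂_X hx j) h,
    CommRingCat.ofHom_comp, CommRingCat.ofHom_comp, Spec.map_comp, Spec.map_comp, Category.assoc,
    Category.assoc, Proj.SpecMap_awayMap_awayι, Proj.SpecMap_awayMap_awayι]

end Chart

end

end FanoCover


/-! ### The normalization of projective space in a field -/

section

variable {A A' B C : Type*} [CommRing A] [CommRing A'] [CommRing B] [CommRing C]

theorem RingHom.IsIntegralElem.of_range_le [Nontrivial B] {g : A →+* B} {g' : A' →+* B}
    (h : g.range ≤ g'.range) {b : B} (hb : g.IsIntegralElem b) : g'.IsIntegralElem b := by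
  obtain ⟨P, hP, hPb⟩ := hb
  have h1 : P.map g ∈ Polynomial.lifts g' :=
    (Polynomial.lifts_iff_coeff_lifts _).mpr fun i => by
      rw [Polynomial.coeff_map]
      exact h ⟨_, rfl⟩
  obtain ⟨Q, hQ, -, hQ'⟩ := Polynomial.lifts_and_natDegree_eq_and_monic h1 (hP.map g)
  refine ⟨Q, hQ', ?_⟩
  rw [← Polynomial.eval_map, hQ, Polynomial.eval_map, hPb]

theorem RingHom.isIntegralElem_comp_iff {g : A →+* B} {θ : B →+* C} (hθ : Function.Injective θ)
    {b : B} : (θ.comp g).IsIntegralElem (θ b) ↔ g.IsIntegralElem b :=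
  exists_congr fun P => and_congr_right fun _ => by
    rw [← Polynomial.hom_eval₂, map_eq_zero_iff θ hθ]

end

namespace FanoCover

open HomogeneousLocalization

variable {K L : Type u} [Field K] [Field L] {n : ℕ}

theorem top_le_awayι_preimage {f : MvPolynomial (Fin (n + 1)) K} {d : ℕ}
    (hf : f ∈ grading K n d) (hd : 0 < d) :
    ⊤ ≤ Proj.awayι (grading K n) f hf hd ⁻¹ᵁ Proj.basicOpen (grading K n) f := by
  intro y _
  rw [← Proj.opensRange_awayι (grading K n) f hf hd]
  exact ⟨y, rfl⟩

theorem awayToSection_awayι_appLE {f : MvPolynomial (Fin (n + 1)) K} {d : ℕ}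
    (hf : f ∈ grading K n d) (hd : 0 < d) :
    Proj.awayToSection (grading K n) f ≫ (Proj.awayι (grading K n) f hf hd).appLE
      (Proj.basicOpen (grading K n) f) ⊤ (top_le_awayι_preimage hf hd) =
        (Scheme.ΓSpecIso _).inv := by
  have h := Proj.basicOpenToSpec_app_top (grading K n) f
  rw [← Proj.basicOpenIsoSpec_hom (grading K n) f hf hd] at h
  have h1 : (Proj.basicOpenIsoSpec (grading K n) f hf hd).hom.appTop ≫
      (Proj.basicOpenIsoSpec (grading K n) f hf hd).inv.appTop = 𝟙 _ := by
    rw [← Scheme.Hom.comp_appTop, Iso.inv_hom_id, Scheme.Hom.id_appTop]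
  have h2 : (Proj.awayι (grading K n) f hf hd).appLE (Proj.basicOpen (grading K n) f) ⊤
      (top_le_awayι_preimage hf hd) = (Proj.basicOpen (grading K n) f).topIso.inv ≫
        (Proj.basicOpenIsoSpec (grading K n) f hf hd).inv.appTop := by
    have h3 : (Proj.basicOpen (grading K n) f).topIso.inv =
        (Proj.basicOpen (grading K n) f).ι.appLE (Proj.basicOpen (grading K n) f) ⊤ (by simp) := by
      simp
      rfl
    rw [h3, Scheme.Hom.appTop, ← Scheme.Hom.appLE_eq_app]
    exact (Scheme.Hom.appLE_comp_appLE _ _ _ _ _ _ _).symm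
  rw [h2, ← cancel_epi (Scheme.ΓSpecIso _).hom, Iso.hom_inv_id, ← h1]
  exact congr($h.symm ≫ (Proj.basicOpenIsoSpec (grading K n) f hf hd).inv.appTop)

theorem top_le_preimage_basicOpen {f : MvPolynomial (Fin (n + 1)) K} {d : ℕ}
    (hf : f ∈ grading K n d) (hd : 0 < d) (φ : Away (grading K n) f →+* L) :
    ⊤ ≤ (Spec.map (CommRingCat.ofHom φ) ≫ Proj.awayι (grading K n) f hf hd) ⁻¹ᵁ
      Proj.basicOpen (grading K n) f := by
  intro y _
  rw [← Proj.opensRange_awayι (grading K n) f hf hd]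
  exact ⟨Spec.map (CommRingCat.ofHom φ) y, rfl⟩

theorem fieldPtEval_awayToSection {f : MvPolynomial (Fin (n + 1)) K} {d : ℕ}
    (hf : f ∈ grading K n d) (hd : 0 < d) (φ : Away (grading K n) f →+* L)
    (a : Away (grading K n) f) :
    fieldPtEval (Spec.map (CommRingCat.ofHom φ) ≫ Proj.awayι (grading K n) f hf hd)
      (Proj.basicOpen (grading K n) f) (top_le_preimage_basicOpen hf hd φ)
      (Proj.awayToSection (grading K n) f a) = φ a := by
  have h1 := awayToSection_awayι_appLE hf hd
  have h2 : (Spec.map (CommRingCat.ofHom φ) ≫ Proj.awayι (grading K n) f hf hd).appLE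
      (Proj.basicOpen (grading K n) f) ⊤ (top_le_preimage_basicOpen hf hd φ) =
        (Proj.awayι (grading K n) f hf hd).appLE (Proj.basicOpen (grading K n) f) ⊤
          (top_le_awayι_preimage hf hd) ≫ (Spec.map (CommRingCat.ofHom φ)).appLE ⊤ ⊤ le_top :=
    (Scheme.Hom.appLE_comp_appLE _ _ _ _ _ _ _).symm
  rw [fieldPtEval, h2]
  refine Eq.trans ?_ (fieldPtEval_SpecMap (CommRingCat.ofHom φ) a)
  rw [← h1]
  rfl

/-- Where the function g / f is invertible, its value in the homogeneous localization is a unit, so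
g is outside the prime. -/
theorem mem_basicOpen_of_mem_basicOpen_awayToSection {f g : MvPolynomial (Fin (n + 1)) K} {d : ℕ}
    (hf : f ∈ grading K n d) (hg : g ∈ grading K n (1 • d)) {z : projSpace K n}
    (hz : z ∈ (projSpace K n).basicOpen (U := Proj.basicOpen (grading K n) f)
      (Proj.awayToSection (grading K n) f (Away.mk _ hf 1 g hg))) :
    z ∈ Proj.basicOpen (grading K n) g := by
  have hzf : z ∈ Proj.basicOpen (grading K n) f := (projSpace K n).basicOpen_le _ hz
  rw [Scheme.mem_basicOpen _ _ _ hzf] at hz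
  let z' : ProjectiveSpectrum (grading K n) := z
  have h1 := hz.map (stalkToFiberRingHom (grading K n) z').hom
  erw [stalkToFiberRingHom_germ] at h1
  have hprime : z'.asHomogeneousIdeal.toIdeal.IsPrime := z'.isPrime
  have h2 := (isUnit_iff_isUnit_val (grading K n) z'.asHomogeneousIdeal.toIdeal _).mpr h1
  erw [ProjectiveSpectrum.Proj.awayToSection_apply] at h2
  rw [Away.val_mk, Localization.mk_eq_mk', IsLocalization.map_mk',
    IsLocalization.AtPrime.isUnit_mk'_iff] at h2
  exact h2

section Eval

variable [Algebra K L]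

variable {x : Fin n → L} (hx : ∀ i, x i ≠ 0) {f : Spec (.of L) ⟶ projSpace K n}

/-- `f` is the point of projective space with coordinates `1, x₁⁻¹, …, xₙ⁻¹`. -/
def IsInversePoint (K : Type u) [Field K] [Algebra K L] (hx : ∀ i, x i ≠ 0)
    (f : Spec (.of L) ⟶ projSpace K n) : Prop :=
  f = Spec.map (CommRingCat.ofHom (projEval (K := K) (fun i => (homCoord x i)⁻¹)
    (MvPolynomial.X 0) (isUnit_eval₂_X hx 0))) ≫ Proj.awayι (grading K n) (MvPolynomial.X 0)
      (X_mem_grading K 0) Nat.one_pos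

variable {hx} (hf : IsInversePoint K hx f)

include hf

theorem IsInversePoint.eq (j : Fin (n + 1)) :
    f = Spec.map (CommRingCat.ofHom (projEval (K := K) (fun i => (homCoord x i)⁻¹)
      (MvPolynomial.X j) (isUnit_eval₂_X hx j))) ≫ Proj.awayι (grading K n) (MvPolynomial.X j)
        (X_mem_grading K j) Nat.one_pos :=
  Eq.trans hf (SpecMap_projEval_awayι hx 0 j)

theorem IsInversePoint.top_le (j : Fin (n + 1)) :
    ⊤ ≤ f ⁻¹ᵁ Proj.basicOpen (grading K n) (MvPolynomial.X j) := by
  rw [hf.eq j]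
  exact top_le_preimage_basicOpen _ _ _

theorem IsInversePoint.fieldPtEval_awayToSection (j : Fin (n + 1))
    (a : Away (grading K n) (MvPolynomial.X j)) :
    fieldPtEval f (Proj.basicOpen (grading K n) (MvPolynomial.X j)) (hf.top_le j)
      (Proj.awayToSection (grading K n) (MvPolynomial.X j) a) =
        projEval (K := K) (fun i => (homCoord x i)⁻¹) (MvPolynomial.X j) (isUnit_eval₂_X hx j) a := by
  have h := hf.eq j
  subst h
  exact FanoCover.fieldPtEval_awayToSection (X_mem_grading K j) Nat.one_pos _ a

theorem IsInversePoint.range_fieldPtEval (j : Fin (n + 1)) :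
    (fieldPtEval f (Proj.basicOpen (grading K n) (MvPolynomial.X j)) (hf.top_le j)).range =
      (chartAlgebra K x j).toSubring := by
  ext b
  rw [Subalgebra.mem_toSubring, ← mem_range_projEval_iff hx j]
  constructor
  · rintro ⟨a, rfl⟩
    obtain ⟨a, rfl⟩ := (Proj.basicOpenIsoAway (grading K n) (MvPolynomial.X j) (X_mem_grading K j)
      Nat.one_pos).commRingCatIsoToRingEquiv.surjective a
    exact ⟨a, (hf.fieldPtEval_awayToSection j a).symm⟩
  · rintro ⟨a, rfl⟩
    exact ⟨_, hf.fieldPtEval_awayToSection j a⟩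

theorem IsInversePoint.comp_projSpaceToSpec :
    f ≫ projSpaceToSpec K n = Spec.map (CommRingCat.ofHom (algebraMap K L)) := by
  rw [hf.eq 0, projSpaceToSpec, Category.assoc, Proj.awayι_toSpecZero_assoc, ← Spec.map_comp,
    ← Spec.map_comp, ← CommRingCat.ofHom_comp, ← CommRingCat.ofHom_comp]
  congr 2
  ext c
  have h : fromZeroRingHom (grading K n) (Submonoid.powers (MvPolynomial.X 0))
      (algebraMap K (grading K n 0) c) = Away.mk _ (X_mem_grading K 0) 0 (MvPolynomial.C c)
        (by simp) := by
    apply val_injective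
    rw [Away.val_mk, fromZeroRingHom]
    simp
    rfl
  simp only [RingHom.comp_apply, h, projEval_mk]
  simp

end Eval

end FanoCover


/-! ### Function field and affine cover of the normalization -/

namespace FanoCover

open HomogeneousLocalization

variable {K L : Type u} [Field K] [Field L] [Algebra K L] {n : ℕ}

section Transport

variable {F : Type u} [Field F] [Algebra K F] (θ : F →ₐ[K] L)

theorem map_homCoord (x : Fin n → F) (i : Fin (n + 1)) :
    θ (homCoord x i) = homCoord (fun i => θ (x i)) i := by
  cases i using Fin.cases <;> simp

theorem map_chartAlgebra (x : Fin n → F) (j : Fin (n + 1)) :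
    (chartAlgebra K x j).map θ = chartAlgebra K (fun i => θ (x i)) j := by
  rw [chartAlgebra, AlgHom.map_adjoin, ← Set.range_comp, chartAlgebra]
  congr 2
  ext i
  simp [chartCoord, map_homCoord]

theorem IsCurvePowerField.of_algEquiv {k : Type u} [Field k] [Algebra (RatFunc k) L]
    [Algebra (RatFunc k) F] (θ : F ≃ₐ[RatFunc k] L) {m q : ℕ} {x u : Fin n → L}
    (h : IsCurvePowerField k m q x u) :
    IsCurvePowerField k m q (fun i => θ.symm (x i)) fun i => θ.symm (u i) where
  rel i := by
    rw [← map_pow, h.rel, map_add, map_pow, AlgEquiv.commutes]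
  indep := (AlgHom.algebraicIndependent_iff θ.symm.toAlgHom θ.symm.injective).mpr h.indep
  gen := by
    have h1 := congr(($h.gen).map θ.symm.toAlgHom)
    rw [IntermediateField.adjoin_map, Set.image_union, ← Set.range_comp, ← Set.range_comp] at h1
    refine Eq.trans h1 ?_
    rw [eq_top_iff]
    intro a _
    exact ⟨θ a, trivial, θ.symm_apply_apply a⟩

end Transport

namespace IsInversePoint

variable {x : Fin n → L} {hx : ∀ i, x i ≠ 0} {f : Spec (.of L) ⟶ projSpace K n}
  (hf : IsInversePoint K hx f)

include hf

theorem functionFieldEval_baseToFunctionField (c : K) :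
    functionFieldEval f.toNormalization
      (baseToFunctionField (f.fromNormalization ≫ projSpaceToSpec K n) c) = algebraMap K L c := by
  have : Nonempty (⊤ : f.normalization.Opens) := ⟨⟨genericPoint _, trivial⟩⟩
  have h1 := functionFieldEval_algebraMap f.toNormalization ⊤ le_top
    ((f.fromNormalization ≫ projSpaceToSpec K n).appTop ((Scheme.ΓSpecIso (.of K)).inv c))
  have h2 := fieldPtEval_comp f.toNormalization (f.fromNormalization ≫ projSpaceToSpec K n) ⊤
    le_top ((Scheme.ΓSpecIso (.of K)).inv c)
  have h3 : f.toNormalization ≫ f.fromNormalization ≫ projSpaceToSpec K n =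
      Spec.map (CommRingCat.ofHom (algebraMap K L)) := by
    rw [Scheme.Hom.toNormalization_fromNormalization_assoc, hf.comp_projSpaceToSpec]
  refine h1.trans (h2.symm.trans ?_)
  refine Eq.trans ?_ (fieldPtEval_SpecMap (CommRingCat.ofHom (algebraMap K L)) c)
  rw [fieldPtEval_congr h3 ⊤ le_top le_top]

theorem top_le_toNormalization (j : Fin (n + 1)) : ⊤ ≤ f.toNormalization ⁻¹ᵁ
    f.fromNormalization ⁻¹ᵁ Proj.basicOpen (grading K n) (MvPolynomial.X j) := by
  rw [← Scheme.Hom.comp_preimage, Scheme.Hom.toNormalization_fromNormalization]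
  exact hf.top_le j

theorem nonempty_chart (j : Fin (n + 1)) :
    Nonempty (f.fromNormalization ⁻¹ᵁ Proj.basicOpen (grading K n) (MvPolynomial.X j)) :=
  ⟨⟨_, hf.top_le_toNormalization j (show IsLocalRing.closedPoint L ∈ _ from trivial)⟩⟩

theorem isNormalizationCover {x' : Fin n → f.normalization.functionField}
    (hx' : ∀ i, functionFieldEval f.toNormalization (x' i) = x i) :
    letI := functionFieldAlgebra (f.fromNormalization ≫ projSpaceToSpec K n)
    haveI := hf.nonempty_chart
    IsNormalizationCover K x' fun j =>
      f.fromNormalization ⁻¹ᵁ Proj.basicOpen (grading K n) (MvPolynomial.X j) := by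
  let _ := functionFieldAlgebra (f.fromNormalization ≫ projSpaceToSpec K n)
  have := hf.nonempty_chart
  let θ : f.normalization.functionField →ₐ[K] L :=
    { functionFieldEval f.toNormalization with
      commutes' := hf.functionFieldEval_baseToFunctionField }
  have hθ : Function.Injective θ := θ.toRingHom.injective
  have hθx : (fun i => θ (x' i)) = x := funext hx'
  have hθc : ∀ i, θ (homCoord x' i) = homCoord x i := fun i => by rw [map_homCoord, hθx]
  have haff : ∀ j, IsAffineOpen (Proj.basicOpen (grading K n) (MvPolynomial.X j)) := fun j =>
    Proj.isAffineOpen_basicOpen _ _ (X_mem_grading K j) Nat.one_pos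
  have hev : ∀ j (a : Γ(f.normalization, f.fromNormalization ⁻¹ᵁ
      Proj.basicOpen (grading K n) (MvPolynomial.X j))),
      θ (algebraMap _ f.normalization.functionField a) =
        fieldPtEval f.toNormalization _ (hf.top_le_toNormalization j) a := fun j a =>
    functionFieldEval_algebraMap f.toNormalization _ (hf.top_le_toNormalization j) a
  refine ⟨fun j => (haff j).preimage _, fun y => ?_, fun j b => ?_, fun i j y hy h => ?_⟩
  · exact exists_mem_basicOpen_X K n (f.fromNormalization y)
  · have h1 := range_fieldPtEval_toNormalization f (haff j) (hf.top_le j)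
      (hf.top_le_toNormalization j) (θ b)
    have h2 : b ∈ (algebraMap Γ(f.normalization, f.fromNormalization ⁻¹ᵁ
        Proj.basicOpen (grading K n) (MvPolynomial.X j)) f.normalization.functionField).range ↔
        θ b ∈ (fieldPtEval f.toNormalization _ (hf.top_le_toNormalization j)).range := by
      constructor
      · rintro ⟨a, rfl⟩
        exact ⟨a, (hev j a).symm⟩
      · rintro ⟨a, ha⟩
        exact ⟨a, hθ ((hev j a).trans ha)⟩
    have h3 : (θ.toRingHom.comp (algebraMap (chartAlgebra K x' j)
        f.normalization.functionField)).range =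
          (fieldPtEval f _ (hf.top_le j)).range := by
      rw [hf.range_fieldPtEval, ← hθx, ← map_chartAlgebra θ]
      ext b
      constructor
      · rintro ⟨a, rfl⟩
        exact ⟨a.1, a.2, rfl⟩
      · rintro ⟨a, ha, rfl⟩
        exact ⟨⟨a, ha⟩, rfl⟩
    rw [h2, h1, _root_.IsIntegral, ← RingHom.isIntegralElem_comp_iff (θ := θ.toRingHom) hθ]
    exact ⟨fun h => h.of_range_le h3.ge, fun h => h.of_range_le h3.le⟩
  · let s := Proj.awayToSection (grading K n) (MvPolynomial.X i)
      (Away.mk _ (X_mem_grading K i) 1 (MvPolynomial.X j) (by simpa using X_mem_grading K j))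
    let σ := f.fromNormalization.app _ s
    refine mem_basicOpen_of_mem_basicOpen_awayToSection (X_mem_grading K i)
      (by simpa using X_mem_grading K j) (z := f.fromNormalization y) ?_
    change y ∈ f.fromNormalization ⁻¹ᵁ (projSpace K n).basicOpen s
    rw [Scheme.preimage_basicOpen, Scheme.mem_basicOpen _ _ _ hy]
    have h1 : θ (algebraMap _ f.normalization.functionField σ) = homCoord x i / homCoord x j := by
      rw [hev, ← projEval_X_div (K := K) hx j i, ← hf.fieldPtEval_awayToSection,
        ← fieldPtEval_congr f.toNormalization_fromNormalization
          (Proj.basicOpen (grading K n) (MvPolynomial.X i)) (hf.top_le_toNormalization i) (hf.top_le i)]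
      exact (fieldPtEval_comp f.toNormalization f.fromNormalization _ _ s).symm
    obtain ⟨b, hb⟩ := h
    -- The section σ is the function Xᵢ / Xⱼ = Yⱼ / Yᵢ, and regularity of its inverse at y makes it
    -- a unit there.
    refine IsUnit.of_mul_eq_one b (IsFractionRing.injective (f.normalization.presheaf.stalk y)
      f.normalization.functionField (hθ ?_))
    rw [map_mul, map_mul, hb, map_div₀, hθc, hθc, map_one, map_one,
      Scheme.algebraMap_germ_eq_germToFunctionField]
    refine (congrArg (· * (homCoord x j / homCoord x i)) h1).trans ?_
    have hi := homCoord_ne_zero hx i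
    have hj := homCoord_ne_zero hx j
    field_simp

end IsInversePoint

end FanoCover


/-! ### The function field of Y is K(Gⁿ), and the conclusion -/

namespace FanoCover

namespace IsInversePoint

variable {k L : Type u} [Field k] [Field L] [Algebra (RatFunc k) L] {n m q : ℕ}
  {x u : Fin n → L} (hL : IsCurvePowerField k m q x u) {f : Spec (.of L) ⟶ projSpace (RatFunc k) n}
  {hx : ∀ i, x i ≠ 0} (hf : IsInversePoint (RatFunc k) hx f) (p : ℕ) [Fact p.Prime] {r : ℕ}
  (hq : q = p ^ r)

include hL hf hq

/-- The field L is generated by elements integral over chart 0 and their inverses: 1 / xᵢ lies in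
the chart ring, and uᵢ / xᵢ ^ m is integral because its q-th power is a polynomial in 1 / xᵢ. -/
theorem functionFieldEval_surjective :
    Function.Surjective (functionFieldEval f.toNormalization) := by
  let _ := functionFieldAlgebra (f.fromNormalization ≫ projSpaceToSpec (RatFunc k) n)
  have := hf.nonempty_chart
  have hq0 : 0 < q := hq ▸ pow_pos (Fact.out : p.Prime).pos r
  let θ : f.normalization.functionField →ₐ[RatFunc k] L :=
    { functionFieldEval f.toNormalization with
      commutes' := hf.functionFieldEval_baseToFunctionField }
  have hint : ∀ b : L, _root_.IsIntegral (chartAlgebra (RatFunc k) x 0) b → b ∈ θ.fieldRange := by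
    intro b hb
    have h1 : (algebraMap (chartAlgebra (RatFunc k) x 0) L).range ≤
        (fieldPtEval f _ (hf.top_le 0)).range := by
      rw [hf.range_fieldPtEval]
      rintro _ ⟨a, rfl⟩
      exact a.2
    obtain ⟨a, ha⟩ := (range_fieldPtEval_toNormalization f
      (Proj.isAffineOpen_basicOpen _ _ (X_mem_grading (RatFunc k) 0) Nat.one_pos) (hf.top_le 0)
      (hf.top_le_toNormalization 0) b).mpr (RingHom.IsIntegralElem.of_range_le h1 hb)
    exact ⟨_, (functionFieldEval_algebraMap f.toNormalization _ (hf.top_le_toNormalization 0)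
      a).trans ha⟩
  have hmem : ∀ b ∈ chartAlgebra (RatFunc k) x 0, b ∈ θ.fieldRange := fun b hb =>
    hint b (isIntegral_algebraMap (x := (⟨b, hb⟩ : chartAlgebra (RatFunc k) x 0)))
  have hy : ∀ i, (x i)⁻¹ ∈ chartAlgebra (RatFunc k) x 0 := fun i => by
    simpa using homCoord_div_mem_chartAlgebra (K := RatFunc k) hx 0 i.succ
  have hxr : ∀ i, x i ∈ θ.fieldRange := fun i => by
    simpa using inv_mem (hmem _ (hy i))
  have hur : ∀ i, u i ∈ θ.fieldRange := by
    intro i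
    have h1 : (u i * (x i)⁻¹ ^ m) ^ q = (x i)⁻¹ ^ (m * (q - 1)) +
        algebraMap (RatFunc k) L RatFunc.X * (x i)⁻¹ ^ (m * q) := by
      obtain ⟨e, rfl⟩ : ∃ e, q = e + 1 := ⟨q - 1, by omega⟩
      have h0 : x i ^ m * (x i)⁻¹ ^ m = 1 := by rw [← mul_pow, mul_inv_cancel₀ (hx i), one_pow]
      rw [mul_pow, hL.rel, Nat.add_sub_cancel, pow_mul, pow_mul]
      linear_combination ((x i)⁻¹ ^ m) ^ e * h0
    have h2 : _root_.IsIntegral (chartAlgebra (RatFunc k) x 0) (u i * (x i)⁻¹ ^ m) := by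
      refine IsIntegral.of_pow hq0 ?_
      rw [h1]
      exact isIntegral_algebraMap (x := (⟨_, add_mem (pow_mem (hy i) _) (mul_mem
        (Subalgebra.algebraMap_mem _ _) (pow_mem (hy i) _))⟩ : chartAlgebra (RatFunc k) x 0))
    have h3 := mul_mem (hint _ h2) (pow_mem (hxr i) m)
    rwa [inv_pow, inv_mul_cancel_right₀ (pow_ne_zero _ (hx i))] at h3
  have htop : (⊤ : IntermediateField (RatFunc k) L) ≤ θ.fieldRange := by
    rw [← hL.gen, IntermediateField.adjoin_le_iff]
    rintro _ (⟨i, rfl⟩ | ⟨i, rfl⟩)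
    exacts [hxr i, hur i]
  exact fun b => htop (show b ∈ ⊤ from trivial)

theorem isFanoVariety_and_hasCanonicalSingularities [IsAlgClosed k] [CharP k p] (hm : 2 ≤ m)
    (hpm : ¬ p ∣ m) (hn : m * (q - 1) ≤ n) :
    IsFanoVariety k (f.fromNormalization ≫ projSpaceToSpec (RatFunc k) n) ∧
      HasCanonicalSingularities k (f.fromNormalization ≫ projSpaceToSpec (RatFunc k) n) := by
  let s := f.fromNormalization ≫ projSpaceToSpec (RatFunc k) n
  let _ := functionFieldAlgebra s
  let _ := functionFieldSubAlgebra k s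
  have : IsScalarTower k (RatFunc k) f.normalization.functionField := .of_algebraMap_eq fun _ => rfl
  have := hf.nonempty_chart
  have : CharP f.normalization.functionField p :=
    charP_of_injective_algebraMap (algebraMap (RatFunc k) _).injective p
  have : PerfectRing k p := PerfectField.toPerfectRing p
  let θ : f.normalization.functionField →ₐ[RatFunc k] L :=
    { functionFieldEval f.toNormalization with
      commutes' := hf.functionFieldEval_baseToFunctionField }
  let e := AlgEquiv.ofBijective θ ⟨θ.toRingHom.injective, hf.functionFieldEval_surjective hL p hq⟩
  -- The coordinates are transported to the function field of the scheme, where divisors and forms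
  -- are defined.
  have hF := hL.of_algEquiv e
  have hV := hf.isNormalizationCover (x' := fun i => e.symm (x i))
    fun i => e.apply_symm_apply (x i)
  have hX := hV.isIntegrallyClosed_stalk
  have hft : LocallyOfFiniteType s := IsNormalizationCover.locallyOfFiniteType hV hF p hq
  have hsep : IsSeparated s := inferInstanceAs (IsSeparated (f.fromNormalization ≫ _))
  have hqc : QuasiCompact s := inferInstanceAs (QuasiCompact (f.fromNormalization ≫ _))
  have huc : UniversallyClosed s := inferInstanceAs (UniversallyClosed (f.fromNormalization ≫ _))
  have hN : IsNormalVariety s := ⟨inferInstance, hsep, hft, hqc, hX⟩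
  have := hN.isLocallyNoetherian
  exact ⟨⟨hN, {}, hV.isAntiCanonicalAmple hX hF p hq hm hpm hn⟩,
    ⟨hN, hV.hasCanonicalSing hX hF p hq hm hpm hn⟩⟩

end IsInversePoint

theorem isInversePoint_genericPt (k : Type u) [Field k] {n m q : ℕ}
    [IsDomain (CurvePowerRing k n m q)] (hx : ∀ i, xCoord k n m q i ≠ 0) :
    IsInversePoint (RatFunc k) hx (genericPt k n m q) := by
  have h1 : Fin.cons 1 (yCoord k n m q) = fun i => (homCoord (xCoord k n m q) i)⁻¹ := by
    ext i
    cases i using Fin.cases with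
    | zero => simp
    | succ i => simp [yCoord, Ring.inverse_eq_inv']
  have h2 : chartHom k n m q = projEval (K := RatFunc k) (fun i => (homCoord (xCoord k n m q) i)⁻¹)
      (MvPolynomial.X 0) (isUnit_eval₂_X hx 0) := by
    have : ∀ y h, y = (fun i => (homCoord (xCoord k n m q) i)⁻¹) →
        projEval (K := RatFunc k) y (MvPolynomial.X 0) h = projEval (K := RatFunc k)
          (fun i => (homCoord (xCoord k n m q) i)⁻¹) (MvPolynomial.X 0) (isUnit_eval₂_X hx 0) := by
      rintro y h rfl
      rfl
    exact this _ _ h1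
  rw [IsInversePoint, ← h2]
  rfl

end FanoCover

theorem mainTheorem6 (k : Type u) [Field k] [IsAlgClosed k] (p : ℕ) [Fact p.Prime] [CharP k p]
    (r m n q : ℕ) (hq : q = p ^ r) (hm : 2 ≤ m) (hpm : ¬ p ∣ m) (hn : m * (q - 1) ≤ n) :
    IsFanoVariety k (FanoCover.YToSpec k n m q) ∧
      HasCanonicalSingularities k (FanoCover.YToSpec k n m q) := by
  have hdom : IsDomain (FanoCover.CurvePowerRing k n m q) :=
    hq ▸ FanoCover.isDomain_curvePowerRing p (by omega) hpm
  have hL : FanoCover.IsCurvePowerField k m q (FanoCover.xCoord k n m q)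
      (FanoCover.uCoord k n m q) := by
    subst hq
    exact FanoCover.isCurvePowerField_curvePowerField p (by omega) hpm
  exact (FanoCover.isInversePoint_genericPt k
    hL.x_ne_zero).isFanoVariety_and_hasCanonicalSingularities hL p hq hm hpm hn
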